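/- All functions are formal power series over $\mathbb C$ in their times, $\mathbf t=(t_1,t_2,\dots)$, $x=(x_1,x_2,\dots)$, $y=(y_1,y_2,\dots)$. Write $\xi(\mathbf t,z)=\sum_{k\ge1}t_kz^k$, $[z^{-1}]=(z^{-1},z^{-2}/2,z^{-3}/3,\dots)$, and ${\rm Res}_z\sum_i a_iz^i=a_{-1}$. A large BKP tau function is a family $\tau_n(\mathbf t)$, $n\in\mathbb Z$, with $\tau_n(0)\ne0$ for all $n$, such that for all $n',n''\in\mathbb Z$ $${\rm Res}_z\Big(z^{n'-n''-2}\tau_{n'-1}(\mathbf t'-[z^{-1}])\tau_{n''+1}(\mathbf t''+[z^{-1}])e^{\xi(\mathbf t'-\mathbf t'',z)}+z^{n''-n'-2}\tau_{n'+1}(\mathbf t'+[z^{-1}])\tau_{n''-1}(\mathbf t''-[z^{-1}])e^{-\xi(\mathbf t'-\mathbf t'',z)}\Big)=\tfrac12\big(1-(-1)^{n'+n''}\big)\tau_{n'}(\mathbf t')\tau_{n''}(\mathbf t'').$$ A Toda tau function is a family $\sigma_n(x,y)$, $n\in\mathbb Z$, with $\sigma_n(0,0)\neq0$ for all $n$,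 such that for all $n,n'\in\mathbb Z$ $${\rm Res}_z\Big(z^{n-n'-1}\sigma_n(x-[z^{-1}],y)\,\sigma_{n'+1}(x'+[z^{-1}],y')\,e^{\xi(x-x',z)}\Big)={\rm Res}_z\Big(z^{n'-n-1}\sigma_{n+1}(x,y-[z^{-1}])\,\sigma_{n'}(x',y'+[z^{-1}])\,e^{\xi(y-y',z)}\Big).$$ A pair $(\tau_{0,n}(x,y),\tau_{1,n}(x,y))$ satisfies the bilinear equation of the mToda hierarchy if for all $n,n'\in\mathbb Z$ $${\rm Res}_z\Big(z^{n-n'-1}\tau_{0,n}(x-[z^{-1}],y)\tau_{1,n'}(x'+[z^{-1}],y')e^{\xi(x-x',z)}+z^{n'-n-2}\tau_{0,n+1}(x,y-[z^{-1}])\tau_{1,n'-1}(x',y'+[z^{-1}])e^{\xi(y-y',z)}\Big)=\tau_{1,n}(x,y)\tau_{0,n'}(x',y').$$ **Corollary.** Let $\tau_n(\mathbf t)$ be a large BKP tau function. Then there exist two Toda tau functions $\tau^{\rm Toda}_n(x,y)$ and $\tilde\tau^{\rm Toda}_n(x,y)$, different (even up to a constant factor) as families of functions of $(x,y)$, such that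 for all $n\in\mathbb Z$ $$\tau^{\rm Toda}_n(\mathbf t,-\mathbf t)=\tau_n(\mathbf t)\tau_{n-1}(\mathbf t),\qquad \tilde\tau^{\rm Toda}_n(\mathbf t,-\mathbf t)=\tau_n(\mathbf t)^2,$$ and such that the pair $(\tau^{\rm Toda}_n,\tilde\tau^{\rm Toda}_n)$ satisfies the bilinear equation of the mToda hierarchy. In particular, for all $n,n'\in\mathbb Z$, $${\rm Res}_z\Big(z^{n-n'-1}\tau^{\rm Toda}_n(\mathbf t-[z^{-1}],-\mathbf t)\,\tilde\tau^{\rm Toda}_{n'}(\mathbf t'+[z^{-1}],-\mathbf t')\,e^{\xi(\mathbf t-\mathbf t',z)}+z^{n'-n-2}\tau^{\rm Toda}_{n+1}(\mathbf t,-\mathbf t-[z^{-1}])\,\tilde\tau^{\rm Toda}_{n'-1}(\mathbf t',-\mathbf t'+[z^{-1}])\,e^{-\xi(\mathbf t-\mathbf t',z)}\Big)=\tilde\tau^{\rm Toda}_n(\mathbf t,-\mathbf t)\,\tau^{\rm Toda}_{n'}(\mathbf t',-\mathbf t').$$ -/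

import Mathlib

noncomputable section

namespace LargeBKP

open MvPowerSeries

/-! Functions of infinitely many times are formal power series over `ℂ`. A family of times
`t = (t₁, t₂, …)` is indexed by `ℕ+`. Expressions that also involve the spectral parameter live in
`MvPowerSeries (Option σ) ℂ`, where `σ` indexes the times and `X none` stands for `z⁻¹`. -/

variable {σ : Type}

/-- A power series in the times `σ`, regarded as a power series in the times and `z⁻¹`. -/
def lift (u : ℕ+ → MvPowerSeries σ ℂ) : ℕ+ → MvPowerSeries (Option σ) ℂ :=
  fun k => (u k).subst fun s => (X (some s) : MvPowerSeries (Option σ) ℂ)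

/-- The family `[z⁻¹] = (z⁻¹, z⁻² / 2, z⁻³ / 3, …)`. -/
def bracket : ℕ+ → MvPowerSeries (Option σ) ℂ :=
  fun k => ((k : ℂ)⁻¹) • (X none) ^ (k : ℕ)

/-- The coefficient of `z⁻ⁱ` in a power series in the times and `z⁻¹`. -/
def zCoeff (F : MvPowerSeries (Option σ) ℂ) (i : ℕ) : MvPowerSeries σ ℂ :=
  fun d => coeff (Finsupp.optionElim i d) F

/-- `ξ(u, z) = ∑_{k ≥ 1} u_k z ^ k`, as a power series in `z`. -/
def xi (u : ℕ+ → MvPowerSeries σ ℂ) : PowerSeries (MvPowerSeries σ ℂ) :=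
  PowerSeries.mk fun k => if h : 0 < k then u ⟨k, h⟩ else 0

/-- `e ^ ξ(u, z)`, as a power series in `z`. -/
def expXi (u : ℕ+ → MvPowerSeries σ ℂ) : PowerSeries (MvPowerSeries σ ℂ) :=
  (PowerSeries.exp ℂ).subst (xi u)

/-- `Res_z (z ^ m * F * e ^ ξ(u, z))`, the coefficient of `z⁻¹`, where `F = ∑ᵢ Fᵢ z⁻ⁱ`. It is
`∑ Fᵢ * [zʲ] e ^ ξ(u, z)` over all `i, j` with `m - i + j = -1`. This sum is infinite, but
in all uses below only finitely many terms contribute to the coefficient of a given monomial in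
the times: see `finite_support_res`. -/
def res (m : ℤ) (F : MvPowerSeries (Option σ) ℂ) (u : ℕ+ → MvPowerSeries σ ℂ) :
    MvPowerSeries σ ℂ :=
  fun d => ∑ᶠ ij : ℕ × ℕ,
    if m - ij.1 + ij.2 = -1 then coeff d (zCoeff F ij.1 * PowerSeries.coeff ij.2 (expXi u)) else 0

theorem coeff_xi_pow_eq_zero (w : σ → ℕ) (u : ℕ+ → MvPowerSeries σ ℂ)
    (hu : ∀ (k : ℕ+) (d : σ →₀ ℕ), Finsupp.weight w d < k → coeff d (u k) = 0) (n j : ℕ)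
    (d : σ →₀ ℕ) (hd : Finsupp.weight w d < j) :
    coeff d (PowerSeries.coeff j (xi u ^ n)) = 0 := by
  classical
  induction n generalizing j d with
  | zero =>
    have hj : j ≠ 0 := by omega
    simp [PowerSeries.coeff_one, hj]
  | succ n ih =>
    rw [pow_succ, PowerSeries.coeff_mul, map_sum]
    refine Finset.sum_eq_zero fun p hp => ?_
    rw [coeff_mul]
    refine Finset.sum_eq_zero fun q hq => ?_
    rw [Finset.HasAntidiagonal.mem_antidiagonal] at hp hq
    have hw : Finsupp.weight w q.1 + Finsupp.weight w q.2 < p.1 + p.2 := by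
      rw [← map_add, hq, hp]; exact hd
    by_cases h1 : Finsupp.weight w q.1 < p.1
    · rw [ih _ _ h1, zero_mul]
    · have h2 : Finsupp.weight w q.2 < p.2 := by omega
      have h3 : 0 < p.2 := by omega
      rw [xi, PowerSeries.coeff_mk, dif_pos h3, hu ⟨p.2, h3⟩ q.2 h2, mul_zero]

theorem coeff_expXi_eq_zero (w : σ → ℕ) (u : ℕ+ → MvPowerSeries σ ℂ)
    (hu : ∀ (k : ℕ+) (d : σ →₀ ℕ), Finsupp.weight w d < k → coeff d (u k) = 0) (j : ℕ)
    (d : σ →₀ ℕ) (hd : Finsupp.weight w d < j) :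
    coeff d (PowerSeries.coeff j (expXi u)) = 0 := by
  have hs : PowerSeries.HasSubst (xi u) :=
    PowerSeries.HasSubst.of_constantCoeff_zero' (by
      rw [← PowerSeries.coeff_zero_eq_constantCoeff_apply, xi, PowerSeries.coeff_mk]; simp)
  rw [expXi, PowerSeries.coeff_subst' hs,
    finsum_eq_sum _ (PowerSeries.coeff_subst_finite' hs _ j), map_sum]
  refine Finset.sum_eq_zero fun n _ => ?_
  rw [coeff_smul, coeff_xi_pow_eq_zero w u hu n j d hd, mul_zero]

/-- If `u_k` only has monomials of weight at least `k`, for some weights of the times (as for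
independent times, where `t_k` has weight `k`, and for their negatives and differences), then each
coefficient of `res` is a finite sum. -/
theorem finite_support_res (w : σ → ℕ) (m : ℤ) (F : MvPowerSeries (Option σ) ℂ)
    (u : ℕ+ → MvPowerSeries σ ℂ)
    (hu : ∀ (k : ℕ+) (d : σ →₀ ℕ), Finsupp.weight w d < k → coeff d (u k) = 0) (d : σ →₀ ℕ) :
    (Function.support fun ij : ℕ × ℕ =>
      if m - ij.1 + ij.2 = -1 then
        coeff d (zCoeff F ij.1 * PowerSeries.coeff ij.2 (expXi u)) else 0).Finite := by
  classical
  let N := Finsupp.weight w d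
  refine (Set.finite_Iic ((m + 1 + N).toNat, N)).subset fun ij h => ?_
  rw [Function.mem_support] at h
  have h0 : m - ij.1 + ij.2 = -1 := by
    by_contra h0
    exact h (if_neg h0)
  rw [if_pos h0] at h
  have hj : ij.2 ≤ N := by
    by_contra hj
    refine h ?_
    rw [coeff_mul]
    refine Finset.sum_eq_zero fun q hq => ?_
    rw [Finset.HasAntidiagonal.mem_antidiagonal] at hq
    have hw : Finsupp.weight w q.1 + Finsupp.weight w q.2 = N := by
      rw [← map_add, hq]
    rw [coeff_expXi_eq_zero w u hu ij.2 q.2 (by omega), mul_zero]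
  exact ⟨show ij.1 ≤ _ by omega, hj⟩

/-- The value `f(x, y)` of a power series in two families of times. -/
def evalXY {ρ : Type} (f : MvPowerSeries (ℕ+ ⊕ ℕ+) ℂ) (x y : ℕ+ → MvPowerSeries ρ ℂ) :
    MvPowerSeries ρ ℂ :=
  f.subst (Sum.elim x y)

/-- The first of two families of independent times. -/
def fstTime : ℕ+ → MvPowerSeries (ℕ+ ⊕ ℕ+) ℂ := fun k => X (Sum.inl k)

/-- The second of two families of independent times. -/
def sndTime : ℕ+ → MvPowerSeries (ℕ+ ⊕ ℕ+) ℂ := fun k => X (Sum.inr k)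

/-- The tau functions `τ_n(t)`, `n ∈ ℤ`, of the large BKP hierarchy: they do not vanish at the base
point, so that the wave functions exist, and satisfy the bilinear equation of the hierarchy in the
independent times `t'` and `t''`. -/
structure IsLargeBKPTau (τ : ℤ → MvPowerSeries ℕ+ ℂ) : Prop where
  ne_zero : ∀ n, constantCoeff (τ n) ≠ 0
  bilinear : ∀ n' n'' : ℤ,
    let t' := fstTime
    let t'' := sndTime
    res (n' - n'' - 2)
        ((τ (n' - 1)).subst (lift t' - bracket) * (τ (n'' + 1)).subst (lift t'' + bracket))
        (t' - t'')
      + res (n'' - n' - 2)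
        ((τ (n' + 1)).subst (lift t' + bracket) * (τ (n'' - 1)).subst (lift t'' - bracket))
        (-(t' - t''))
    = ((1 / 2 : ℂ) * (1 - (-1) ^ (n' + n''))) • ((τ n').subst t' * (τ n'').subst t'')

/-- The bilinear equation of the Toda hierarchy at the times `x, y, x', y'` and the sites
`n, n'`. -/
def TodaEq (τ : ℤ → MvPowerSeries (ℕ+ ⊕ ℕ+) ℂ) (x y x' y' : ℕ+ → MvPowerSeries σ ℂ) (n n' : ℤ) :
    Prop :=
  res (n - n' - 1)
      (evalXY (τ n) (lift x - bracket) (lift y) * evalXY (τ (n' + 1)) (lift x' + bracket) (lift y'))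
      (x - x')
    = res (n' - n - 1)
      (evalXY (τ (n + 1)) (lift x) (lift y - bracket) * evalXY (τ n') (lift x') (lift y' + bracket))
      (y - y')

/-- The bilinear equation of the mToda hierarchy for the pair `(τ₀, τ₁)` at the times
`x, y, x', y'` and the sites `n, n'`. -/
def MTodaEq (τ₀ τ₁ : ℤ → MvPowerSeries (ℕ+ ⊕ ℕ+) ℂ) (x y x' y' : ℕ+ → MvPowerSeries σ ℂ)
    (n n' : ℤ) : Prop :=
  res (n - n' - 1)
      (evalXY (τ₀ n) (lift x - bracket) (lift y) * evalXY (τ₁ n') (lift x' + bracket) (lift y'))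
      (x - x')
    + res (n' - n - 2)
      (evalXY (τ₀ (n + 1)) (lift x) (lift y - bracket) *
        evalXY (τ₁ (n' - 1)) (lift x') (lift y' + bracket))
      (y - y')
    = evalXY (τ₁ n) x y * evalXY (τ₀ n') x' y'

/-- The independent times `x`, out of the four families `x, y, x', y'`. -/
def varX : ℕ+ → MvPowerSeries ((ℕ+ ⊕ ℕ+) ⊕ (ℕ+ ⊕ ℕ+)) ℂ := fun k => X (Sum.inl (Sum.inl k))

/-- The independent times `y`, out of the four families `x, y, x', y'`. -/
def varY : ℕ+ → MvPowerSeries ((ℕ+ ⊕ ℕ+) ⊕ (ℕ+ ⊕ ℕ+)) ℂ := fun k => X (Sum.inl (Sum.inr k))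

/-- The independent times `x'`, out of the four families `x, y, x', y'`. -/
def varX' : ℕ+ → MvPowerSeries ((ℕ+ ⊕ ℕ+) ⊕ (ℕ+ ⊕ ℕ+)) ℂ := fun k => X (Sum.inr (Sum.inl k))

/-- The independent times `y'`, out of the four families `x, y, x', y'`. -/
def varY' : ℕ+ → MvPowerSeries ((ℕ+ ⊕ ℕ+) ⊕ (ℕ+ ⊕ ℕ+)) ℂ := fun k => X (Sum.inr (Sum.inr k))

/-- The tau functions `τ_n(x, y)`, `n ∈ ℤ`, of the Toda hierarchy. -/
structure IsTodaTau (τ : ℤ → MvPowerSeries (ℕ+ ⊕ ℕ+) ℂ) : Prop where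
  ne_zero : ∀ n, constantCoeff (τ n) ≠ 0
  bilinear : ∀ n n' : ℤ, TodaEq τ varX varY varX' varY' n n'

/-- The pair `(τ₀, τ₁)` satisfies the bilinear equation of the mToda hierarchy, in the independent
times `x, y, x', y'`. -/
def SatisfiesMToda (τ₀ τ₁ : ℤ → MvPowerSeries (ℕ+ ⊕ ℕ+) ℂ) : Prop :=
  ∀ n n' : ℤ, MTodaEq τ₀ τ₁ varX varY varX' varY' n n'

end LargeBKP

end

/-!
A power series `f` is regarded as the functional `dual f` on polynomials whose values at the
monomials are the derivatives of `f` at the origin. Under this duality the shift of the times by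
`[z⁻¹]` together with the factor `e ^ ξ` becomes a vertex operator, and the residue in `z` selects
one of its modes (`coeff_res`). By the boson-fermion correspondence the vertex operators of the large
BKP hierarchy are charged free fermions `ψ`, `ψ*` on the Fock space, so a tau function is a
functional `T` on the Fock space. With `P` the parity of the charge and
`Ω = ∑_m (ψ_m ⊗ ψ*_{-1-m} + ψ*_m ⊗ ψ_{-1-m})`, the bilinear equation says that
`(T ⊗ T) (Ω - ½ (1 - P ⊗ P)) = 0` (`fermionForm_tauFock`).

The Toda tau functions come from the square of the Fock space, on which the fermions of the two
factors are made to commute with each other. Put `Ψ = ψ ⊗ 1 + 1 ⊗ ψ`, `Ψ* = ψ* ⊗ 1 + 1 ⊗ ψ*`, and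
`P₂ = P ⊗ 1 + 1 ⊗ P`. The bilinear equations for the four choices of a factor on either side add up
to the same equation for `φ = T ⊗ T`, `Ψ` and `Ψ*`, with `2 - ½ P₂ ⊗ P₂` on the right
(`fermionForm2_square`). Let `h` be the total current of the two copies and `K` the current
`ψ ⊗ ψ* + ψ* ⊗ ψ`. The modes of `h` and `K` commute. When the modes of `½ (h + κ K)` and
`½ (-h + κ K)`, with `κ = ±1`, are moved through `Ψ` or `Ψ*`, the sign `κ` changes, and a shift of the
mode of `Ψ` appears for just one of the two currents (`FermionPair.mixed_sum`). The tau functions are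
* `φ (exp (∑_k ½ x_k (h_k + K_k) + ½ y_k (-h_k + K_k)) w)` with `w = vac n ⊗ vac n`, and
* `½ φ (exp (∑_k ½ x_k (h_k - K_k) + ½ y_k (-h_k - K_k)) w)` with
  `w = vac (n - 1) ⊗ vac n + vac n ⊗ vac (n - 1)`;

they are `evenFun` and `oddFun`. Both vectors `w` are like a vacuum for `Ψ` and `Ψ*`, which therefore
act on their orbits by vertex operators in `x` only or in `y` only, and interchange the two kinds of
orbits (`FermionPair.IsVacuumLike.sum_act`). As `P₂` kills the second vector, the equation for `φ`
becomes the mToda equation (`isMTodaPair_oddFun_evenFun`). At `y = -x` the current `K` cancels and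
`exp (∑_k x_k h_k)` remains, which gives the products of two values of the large BKP tau function.

The Toda equation for each member of an mToda pair is a consequence of the mToda equation: a sum
with two modes of fermions of the same kind is antisymmetric in its two arguments, while the mToda
equation turns it into a product of functions of one argument each, and an antisymmetric product
vanishes (`finsum_eq_zero_of_antisymm`, `toda_functional`). The two tau functions
are not proportional since the coefficient of `y₁` in the mToda equation at `n' = n` would then be
violated (`mToda_coeff_y`).
-/

noncomputable section

namespace LargeBKP

/-! ### Logarithmic derivatives of power series -/

section ExpSeries
open PowerSeries

variable {R : Type*} [CommRing R] [Algebra ℂ R]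

theorem eq_zero_of_derivative_eq_mul {Q F : R⟦X⟧} (hF : derivative R F = Q * F)
    (h0 : constantCoeff F = 0) : F = 0 := by
  ext n
  rw [map_zero]
  induction n using Nat.strong_induction_on with
  | _ n ih =>
    cases n with
    | zero => simpa using h0
    | succ n =>
      have h := congrArg (coeff n) hF
      rw [coeff_derivative, coeff_mul, Finset.sum_eq_zero] at h
      · have h2 : ((n : ℂ) + 1) • coeff (n + 1) F = 0 := by
          rw [Algebra.smul_def, mul_comm]
          simpa using h
        exact (smul_eq_zero_iff_right (by exact_mod_cast Nat.succ_ne_zero n)).mp h2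
      · intro p hp
        rw [ih p.2 (by have := Finset.HasAntidiagonal.mem_antidiagonal.mp hp; omega), mul_zero]

theorem eq_of_derivative_eq_mul {Q F G : R⟦X⟧} (hF : derivative R F = Q * F)
    (hG : derivative R G = Q * G) (h0 : constantCoeff F = constantCoeff G) : F = G := by
  rw [← sub_eq_zero]
  refine eq_zero_of_derivative_eq_mul (Q := Q) ?_ ?_
  · rw [map_sub, hF, hG, mul_sub]
  · rw [map_sub, h0, sub_self]

theorem exp_subst_eq {g : R⟦X⟧} (hg : constantCoeff g = 0) :
    (exp ℂ).subst g = ((exp ℂ).map (algebraMap ℂ R)).subst g := by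
  have hs : HasSubst g := HasSubst.of_constantCoeff_zero' hg
  ext n
  rw [coeff_subst' hs, coeff_subst' hs]
  refine finsum_congr fun d => ?_
  rw [coeff_map, algebraMap_smul]

theorem derivative_exp_subst {g : R⟦X⟧} (hg : constantCoeff g = 0) :
    derivative R ((exp ℂ).subst g) = derivative R g * (exp ℂ).subst g := by
  have hd : derivative R ((exp ℂ).map (algebraMap ℂ R)) = (exp ℂ).map (algebraMap ℂ R) := by
    ext n
    rw [coeff_derivative, coeff_map, coeff_map, coeff_exp, coeff_exp]
    rw [← Nat.cast_succ, ← map_natCast (algebraMap ℂ R), ← map_mul]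
    congr 1
    have : ((n : ℂ) + 1) ≠ 0 := by exact_mod_cast Nat.succ_ne_zero n
    have h2 : (n.factorial : ℂ) ≠ 0 := by exact_mod_cast n.factorial_ne_zero
    simp [Nat.factorial_succ]
    field_simp
  rw [exp_subst_eq hg, derivative_subst (HasSubst.of_constantCoeff_zero' hg), hd, mul_comm]

theorem constantCoeff_exp_subst {g : R⟦X⟧} (hg : constantCoeff g = 0) :
    constantCoeff ((exp ℂ).subst g) = 1 := by
  have hs : HasSubst g := HasSubst.of_constantCoeff_zero' hg
  rw [← coeff_zero_eq_constantCoeff_apply, coeff_subst' hs, finsum_eq_single _ 0]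
  · simp
  · intro n hn
    simp [hg, hn]

end ExpSeries

/-! ### The creation part of a vertex operator -/

/-- A set of times, each of which has a positive degree (`t_k` has degree `k`), with finitely many
times of each degree. -/
class TimeIndex (σ : Type) where
  /-- The degree of a time. -/
  deg : σ → ℕ
  deg_pos : ∀ q, 0 < deg q
  finite_fiber : ∀ k, {q | deg q = k}.Finite

open TimeIndex

instance : TimeIndex ℕ+ where
  deg k := k
  deg_pos k := k.pos
  finite_fiber k := (Set.finite_le_nat k).preimage PNat.coe_injective.injOn |>.subset
    fun _ hq => le_of_eq hq

instance {σ ρ : Type} [TimeIndex σ] [TimeIndex ρ] : TimeIndex (σ ⊕ ρ) where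
  deg := Sum.elim deg deg
  deg_pos := by rintro (q | q) <;> exact deg_pos q
  finite_fiber k := by
    refine (((finite_fiber (σ := σ) k).image Sum.inl).union
      ((finite_fiber (σ := ρ) k).image Sum.inr)).subset ?_
    rintro (q | q) hq
    · exact Or.inl ⟨q, hq, rfl⟩
    · exact Or.inr ⟨q, hq, rfl⟩

section CreationPart

variable {σ ρ : Type} [TimeIndex σ] [TimeIndex ρ]

@[simp] theorem deg_pnat (k : ℕ+) : deg k = (k : ℕ) := rfl
@[simp] theorem deg_inl (q : σ) : deg (Sum.inl q : σ ⊕ ρ) = deg q := rfl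
@[simp] theorem deg_inr (q : ρ) : deg (Sum.inr q : σ ⊕ ρ) = deg q := rfl

/-- The finite set of times of degree `k`. -/
def fiber (σ : Type) [TimeIndex σ] (k : ℕ) : Finset σ := (finite_fiber k).toFinset

@[simp] theorem mem_fiber {k : ℕ} {q : σ} : q ∈ fiber σ k ↔ deg q = k := by simp [fiber]

theorem fiber_pnat (k : ℕ+) : fiber ℕ+ k = {k} := by ext q; simp

theorem fiber_zero : fiber σ 0 = ∅ := by
  ext q; simpa using (deg_pos q).ne'

theorem sum_fiber_sum {M : Type*} [AddCommMonoid M] (k : ℕ) (f : σ ⊕ ρ → M) :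
    ∑ q ∈ fiber (σ ⊕ ρ) k, f q =
      ∑ q ∈ fiber σ k, f (Sum.inl q) + ∑ q ∈ fiber ρ k, f (Sum.inr q) := by
  have : fiber (σ ⊕ ρ) k = (fiber σ k).disjSum (fiber ρ k) := by
    ext (q | q) <;> simp
  rw [this, Finset.sum_disjSum]

/-- The linear form `∑ v_q p_q` over the times `q` of degree `k`. -/
def form (v : σ → ℂ) (k : ℕ) : MvPolynomial σ ℂ := ∑ q ∈ fiber σ k, v q • MvPolynomial.X q

theorem form_add (v w : σ → ℂ) (k : ℕ) : form (v + w) k = form v k + form w k := by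
  simp [form, add_smul, Finset.sum_add_distrib]

/-- The series `-∑_{k ≥ 1} form v k * ζ ^ k / k`. -/
def logCre (v : σ → ℂ) : PowerSeries (MvPolynomial σ ℂ) :=
  PowerSeries.mk fun k => -(k : ℂ)⁻¹ • form v k

/-- The creation part `exp (-∑_{k ≥ 1} form v k * ζ ^ k / k)` of a vertex operator. -/
def cre (v : σ → ℂ) : PowerSeries (MvPolynomial σ ℂ) := (PowerSeries.exp ℂ).subst (logCre v)

/-- The logarithmic derivative `-∑_{k ≥ 1} form v k * ζ ^ (k - 1)` of `cre v`. -/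
def dlogCre (v : σ → ℂ) : PowerSeries (MvPolynomial σ ℂ) :=
  PowerSeries.mk fun k => -form v (k + 1)

theorem constantCoeff_logCre (v : σ → ℂ) : PowerSeries.constantCoeff (logCre v) = 0 := by
  simp [logCre, ← PowerSeries.coeff_zero_eq_constantCoeff_apply]

@[simp] theorem constantCoeff_cre (v : σ → ℂ) : PowerSeries.constantCoeff (cre v) = 1 :=
  constantCoeff_exp_subst (constantCoeff_logCre v)

theorem derivative_cre (v : σ → ℂ) :
    PowerSeries.derivative _ (cre v) = dlogCre v * cre v := by
  rw [cre, derivative_exp_subst (constantCoeff_logCre v)]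
  congr 1
  ext1 k
  have h : ((k : ℂ) + 1) ≠ 0 := by exact_mod_cast Nat.succ_ne_zero k
  rw [PowerSeries.coeff_derivative, logCre, dlogCre, PowerSeries.coeff_mk, PowerSeries.coeff_mk,
    mul_comm, ← Nat.cast_succ, ← map_natCast (algebraMap ℂ _), ← Algebra.smul_def, smul_smul]
  push_cast
  rw [mul_neg, mul_inv_cancel₀ h, neg_one_smul]

theorem dlogCre_add (v w : σ → ℂ) : dlogCre (v + w) = dlogCre v + dlogCre w := by
  ext1 k; simp [dlogCre, form_add, add_comm]

theorem cre_add (v w : σ → ℂ) : cre (v + w) = cre v * cre w := by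
  refine eq_of_derivative_eq_mul (derivative_cre _) ?_ (by simp)
  rw [Derivation.leibniz, derivative_cre, derivative_cre, dlogCre_add, smul_eq_mul, smul_eq_mul]
  ring

theorem cre_zero : cre (0 : σ → ℂ) = 1 := by
  refine eq_of_derivative_eq_mul (derivative_cre _) ?_ (by simp)
  rw [PowerSeries.derivative_one, mul_one]
  ext1 k; simp [dlogCre, form]

theorem cre_mul_cre_neg (v : σ → ℂ) : cre v * cre (-v) = 1 := by
  rw [← cre_add, add_neg_cancel, cre_zero]

/-- The coefficient of `ζ ^ i` in `cre v`, which is zero for negative `i`. -/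
def creCoeff (v : σ → ℂ) (i : ℤ) : MvPolynomial σ ℂ :=
  if 0 ≤ i then PowerSeries.coeff i.toNat (cre v) else 0

@[simp] theorem creCoeff_natCast (v : σ → ℂ) (i : ℕ) :
    creCoeff v i = PowerSeries.coeff i (cre v) := by simp [creCoeff]

theorem creCoeff_of_neg (v : σ → ℂ) {i : ℤ} (hi : i < 0) : creCoeff v i = 0 := by
  simp [creCoeff, hi]

@[simp] theorem creCoeff_zero (v : σ → ℂ) : creCoeff v 0 = 1 := by
  simp [creCoeff]

/-- The recursion given by the derivative of `cre v`. -/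
theorem creCoeff_succ (v : σ → ℂ) (i : ℕ) :
    ((i : ℂ) + 1) • creCoeff v (i + 1) =
      -∑ k ∈ Finset.range (i + 1), form v (k + 1) * creCoeff v (i - k) := by
  have h := congrArg (PowerSeries.coeff i) (derivative_cre v)
  rw [PowerSeries.coeff_derivative, PowerSeries.coeff_mul,
    Finset.Nat.sum_antidiagonal_eq_sum_range_succ_mk] at h
  rw [Algebra.smul_def, mul_comm, ← Finset.sum_neg_distrib]
  have h2 : creCoeff v (i + 1) = PowerSeries.coeff (i + 1) (cre v) := by
    rw [← creCoeff_natCast]; push_cast; rfl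
  rw [h2]
  rw [← Nat.cast_succ, map_natCast (algebraMap ℂ (MvPolynomial σ ℂ)), Nat.cast_succ, h]
  refine Finset.sum_congr rfl fun k hk => ?_
  have : (i : ℤ) - k = ((i - k : ℕ) : ℤ) := by
    have := Finset.mem_range.mp hk; omega
  rw [this, creCoeff_natCast, dlogCre, PowerSeries.coeff_mk, neg_mul]

theorem pderiv_form (v : σ → ℂ) (q : σ) (k : ℕ) :
    MvPolynomial.pderiv q (form v k) = if deg q = k then MvPolynomial.C (v q) else 0 := by
  classical
  rw [form, map_sum]
  simp only [Derivation.map_smul, MvPolynomial.pderiv_X, Pi.single_apply, smul_ite, smul_zero]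
  rw [Finset.sum_ite_eq' (fiber σ k) q (fun x => v x • (1 : MvPolynomial σ ℂ))]
  simp [MvPolynomial.smul_eq_C_mul]

theorem pderiv_creCoeff (v : σ → ℂ) (q : σ) (i : ℤ) :
    MvPolynomial.pderiv q (creCoeff v i) =
      (-(deg q : ℂ)⁻¹ * v q) • creCoeff v (i - deg q) := by
  by_cases hi : i < 0
  · rw [creCoeff_of_neg v hi, creCoeff_of_neg v (by omega), map_zero, smul_zero]
  obtain ⟨i, rfl⟩ := Int.eq_ofNat_of_zero_le (not_lt.mp hi)
  induction i using Nat.strong_induction_on with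
  | _ i ih =>
  cases i with
  | zero =>
    rw [creCoeff_of_neg v (i := ((0 : ℕ) : ℤ) - deg q) (by have := deg_pos q; omega)]
    simp
  | succ i =>
    have hne : ((i : ℂ) + 1) ≠ 0 := by exact_mod_cast Nat.succ_ne_zero i
    refine smul_right_injective _ hne ?_
    change ((i : ℂ) + 1) • _ = ((i : ℂ) + 1) • _
    push_cast
    rw [← Derivation.map_smul, creCoeff_succ, map_neg, map_sum]
    have h1 : ∀ k ∈ Finset.range (i + 1),
        MvPolynomial.pderiv q (form v (k + 1) * creCoeff v (i - k)) =
          (if deg q = k + 1 then v q • creCoeff v (i - k) else 0) +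
          (-(deg q : ℂ)⁻¹ * v q) • (form v (k + 1) * creCoeff v (i - deg q - k)) := by
      intro k hk
      have hk := Finset.mem_range.mp hk
      have : (i : ℤ) - k = ((i - k : ℕ) : ℤ) := by omega
      rw [MvPolynomial.pderiv_mul, pderiv_form, this, ih (i - k) (by omega) (by omega), ← this,
        mul_smul_comm, ite_mul, zero_mul, MvPolynomial.smul_eq_C_mul (creCoeff v (i - k)),
        show (i : ℤ) - k - deg q = i - deg q - k by ring]
    rw [Finset.sum_congr rfl h1, Finset.sum_add_distrib, ← Finset.smul_sum]
    have hd := deg_pos q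
    obtain ⟨d, hd⟩ : ∃ d, deg q = d + 1 := ⟨deg q - 1, by omega⟩
    rw [hd]
    have h2 : (∑ k ∈ Finset.range (i + 1),
        if d + 1 = k + 1 then v q • creCoeff v ((i : ℤ) - k) else 0) =
          v q • creCoeff v ((i : ℤ) - d) := by
      simp only [add_left_inj]
      rw [Finset.sum_ite_eq (Finset.range (i + 1)) d (fun k => v q • creCoeff v ((i : ℤ) - k))]
      split_ifs with h
      · rfl
      · rw [Finset.mem_range] at h
        rw [creCoeff_of_neg v (by omega), smul_zero]
    rw [h2]
    have hdne : ((d : ℂ) + 1) ≠ 0 := by exact_mod_cast Nat.succ_ne_zero d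
    have e1 : (i : ℤ) + 1 - ((d + 1 : ℕ) : ℤ) = i - d := by push_cast; ring
    rw [e1]
    by_cases hid : i < d + 1
    · have h3 : ∑ k ∈ Finset.range (i + 1),
          form v (k + 1) * creCoeff v ((i : ℤ) - (d + 1 : ℕ) - k) = 0 :=
        Finset.sum_eq_zero fun k _ => by
          rw [creCoeff_of_neg v (by push_cast; omega), mul_zero]
      rw [h3, smul_zero, add_zero, ← neg_smul, smul_smul]
      by_cases hid' : i = d
      · subst hid'
        congr 1
        push_cast
        field_simp
      · rw [creCoeff_of_neg v (by omega), smul_zero, smul_zero]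
    · obtain ⟨j, rfl⟩ : ∃ j, i = j + (d + 1) := ⟨i - (d + 1), by omega⟩
      have h3 : ∑ k ∈ Finset.range (j + (d + 1) + 1),
          form v (k + 1) * creCoeff v (((j + (d + 1) : ℕ) : ℤ) - (d + 1 : ℕ) - k) =
          ∑ k ∈ Finset.range (j + 1), form v (k + 1) * creCoeff v (j - k) := by
        symm
        have e : ((j + (d + 1) : ℕ) : ℤ) - (d + 1 : ℕ) = j := by push_cast; ring
        rw [e]
        refine Finset.sum_subset (by intro x; simp only [Finset.mem_range]; omega) ?_
        intro k _ hk
        rw [Finset.mem_range] at hk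
        rw [creCoeff_of_neg v (by omega), mul_zero]
      rw [h3]
      have h4 := creCoeff_succ v j
      rw [← neg_eq_iff_eq_neg] at h4
      rw [← h4, show (((j + (d + 1) : ℕ) : ℤ) - d) = (j : ℤ) + 1 by push_cast; ring, smul_neg,
        smul_smul, ← neg_smul, ← add_smul, ← neg_smul, smul_smul]
      congr 1
      push_cast
      field_simp
      ring

end CreationPart

/-! ### Shifts of polynomials -/

section VertexOperators

variable {σ ρ : Type} [TimeIndex σ] [TimeIndex ρ]

/-- The shift `p_q ↦ p_q + v_q z ^ deg q`. -/
def shift (v : σ → ℂ) : MvPolynomial σ ℂ →ₐ[ℂ] Polynomial (MvPolynomial σ ℂ) :=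
  MvPolynomial.aeval fun q => Polynomial.C (MvPolynomial.X q) + v q • Polynomial.X ^ deg q

/-- The coefficient of `z ^ j` in the shift `p_q ↦ p_q + v_q z ^ deg q`, which is zero for
negative `j`. -/
def ann (v : σ → ℂ) (j : ℤ) : MvPolynomial σ ℂ →ₗ[ℂ] MvPolynomial σ ℂ :=
  if 0 ≤ j then
    ((Polynomial.lcoeff (MvPolynomial σ ℂ) j.toNat).restrictScalars ℂ) ∘ₗ (shift v).toLinearMap
  else 0

@[simp] theorem ann_natCast (v : σ → ℂ) (j : ℕ) (u : MvPolynomial σ ℂ) :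
    ann v j u = (shift v u).coeff j := by simp [ann]

theorem ann_of_neg (v : σ → ℂ) {j : ℤ} (hj : j < 0) (u : MvPolynomial σ ℂ) : ann v j u = 0 := by
  rw [ann, if_neg (not_le.mpr hj), LinearMap.zero_apply]

theorem ann_one (v : σ → ℂ) (j : ℤ) : ann v j 1 = if j = 0 then 1 else 0 := by
  by_cases hj : j < 0
  · rw [ann_of_neg v hj, if_neg (by omega)]
  obtain ⟨j, rfl⟩ := Int.eq_ofNat_of_zero_le (not_lt.mp hj)
  rw [ann_natCast, map_one, Polynomial.coeff_one]
  simp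

theorem ann_mul_X (v : σ → ℂ) (j : ℤ) (u : MvPolynomial σ ℂ) (q : σ) :
    ann v j (u * MvPolynomial.X q) =
      ann v j u * MvPolynomial.X q + v q • ann v (j - deg q) u := by
  by_cases hj : j < 0
  · rw [ann_of_neg v hj, ann_of_neg v hj, ann_of_neg v (by omega)]; simp
  obtain ⟨j, rfl⟩ := Int.eq_ofNat_of_zero_le (not_lt.mp hj)
  rw [ann_natCast, ann_natCast, map_mul, shift, MvPolynomial.aeval_X, mul_add,
    Polynomial.coeff_add, Polynomial.coeff_mul_C, mul_smul_comm, Polynomial.coeff_smul,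
    Polynomial.coeff_mul_X_pow']
  split_ifs with h
  · rw [show (j : ℤ) - deg q = ((j - deg q : ℕ) : ℤ) by omega, ann_natCast, shift]
  · rw [ann_of_neg v (by omega)]

theorem exists_ann_eq_zero (v : σ → ℂ) (u : MvPolynomial σ ℂ) :
    ∃ B : ℕ, ∀ j : ℤ, (B : ℤ) ≤ j → ann v j u = 0 := by
  refine ⟨(shift v u).natDegree + 1, fun j hj => ?_⟩
  obtain ⟨j, rfl⟩ := Int.eq_ofNat_of_zero_le (show 0 ≤ j by omega)
  rw [ann_natCast]
  exact Polynomial.coeff_eq_zero_of_natDegree_lt (by omega)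

theorem ann_comm (v w : σ → ℂ) (i j : ℤ) (u : MvPolynomial σ ℂ) :
    ann v i (ann w j u) = ann w j (ann v i u) := by
  induction u using MvPolynomial.induction_on generalizing i j with
  | C a =>
    rw [← mul_one (MvPolynomial.C a), ← MvPolynomial.smul_eq_C_mul]
    simp only [map_smul, ann_one]
    split_ifs <;> simp_all [ann_one]
  | add p q hp hq => simp only [map_add, hp, hq]
  | mul_X p q hp =>
    simp only [ann_mul_X, map_add, map_smul, hp]
    abel

theorem sum_ann_ann_neg (v : σ → ℂ) (n : ℤ) (u : MvPolynomial σ ℂ) {B : ℕ}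
    (hv : ∀ j : ℤ, (B : ℤ) ≤ j → ann v j u = 0) :
    ∑ i ∈ Finset.range B, ann (-v) (n - i) (ann v i u) = if n = 0 then u else 0 := by
  by_cases hn : n < 0
  · rw [if_neg (by omega)]
    exact Finset.sum_eq_zero fun i _ => ann_of_neg _ (by omega) _
  obtain ⟨n, rfl⟩ := Int.eq_ofNat_of_zero_le (not_lt.mp hn)
  -- composing the shifts along `v` and `-v` gives the identity
  let φ : MvPolynomial σ ℂ →+* Polynomial (MvPolynomial σ ℂ) :=
    (Polynomial.eval₂RingHom (shift (-v)).toRingHom Polynomial.X).comp (shift v).toRingHom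
  have hφ : φ = Polynomial.C := by
    refine MvPolynomial.ringHom_ext (fun a => ?_) fun q => ?_
    · have h1 (w : σ → ℂ) : shift w (MvPolynomial.C a) = Polynomial.C (MvPolynomial.C a) :=
        (shift w).commutes a
      simp [φ, h1]
    · have h1 (w : σ → ℂ) : shift w (MvPolynomial.X q) =
          Polynomial.C (MvPolynomial.X q) + Polynomial.C (MvPolynomial.C (w q)) *
            Polynomial.X ^ deg q := by
        rw [shift, MvPolynomial.aeval_X, ← Polynomial.smul_eq_C_mul, ← MvPolynomial.algebraMap_eq,
          algebraMap_smul]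
      have h2 (w : σ → ℂ) (a : ℂ) : shift w (MvPolynomial.C a) = Polynomial.C (MvPolynomial.C a) :=
        (shift w).commutes a
      simp [φ, h1, h2]
      ring
  have h := congrArg (fun f : MvPolynomial σ ℂ →+* _ => (f u).coeff n) hφ
  simp only [φ, RingHom.comp_apply, Polynomial.coe_eval₂RingHom, Polynomial.eval₂_def,
    Polynomial.sum_def, Polynomial.finsetSum_coeff, Polynomial.coeff_mul_X_pow',
    Polynomial.coeff_C] at h
  simp only [Int.natCast_eq_zero]
  rw [← h]
  symm
  refine (Finset.sum_subset (s₂ := Finset.range B) (fun j hj => ?_) fun j _ hj => ?_).trans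
    (Finset.sum_congr rfl fun j _ => ?_)
  · rw [Finset.mem_range]
    by_contra hB
    refine Polynomial.mem_support_iff.mp hj ?_
    rw [← hv j (by omega), ann_natCast]
    rfl
  · rw [Polynomial.notMem_support_iff.mp hj]
    simp
  · rw [ann_natCast]
    split_ifs with hjn
    · rw [show (n : ℤ) - j = ((n - j : ℕ) : ℤ) by omega, ann_natCast]
      rfl
    · rw [ann_of_neg _ (by omega)]

/-! ### Vertex operators -/

/-- The coefficient of `z ^ M` in `(∑ E_i z ^ (-i)) * F`, where `E_i` are the coefficients of
`cre v`, and `F` is a polynomial in `z`. -/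
def creMul (v : σ → ℂ) (M : ℤ) :
    Polynomial (MvPolynomial σ ℂ) →ₗ[MvPolynomial σ ℂ] MvPolynomial σ ℂ :=
  Polynomial.lsum fun j => LinearMap.mulLeft (MvPolynomial σ ℂ) (creCoeff v (j - M))

theorem creMul_monomial (v : σ → ℂ) (M : ℤ) (j : ℕ) (a : MvPolynomial σ ℂ) :
    creMul v M (Polynomial.monomial j a) = creCoeff v (j - M) * a := by
  simp [creMul, Polynomial.sum_monomial_index]

theorem creMul_C_mul (v : σ → ℂ) (M : ℤ) (a : MvPolynomial σ ℂ) (F) :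
    creMul v M (Polynomial.C a * F) = a * creMul v M F := by
  rw [← Polynomial.smul_eq_C_mul, map_smul, smul_eq_mul]

theorem creMul_X_pow_mul (v : σ → ℂ) (M : ℤ) (d : ℕ) (F) :
    creMul v M (Polynomial.X ^ d * F) = creMul v (M - d) F := by
  induction F using Polynomial.induction_on' with
  | add p q hp hq => rw [mul_add, map_add, map_add, hp, hq]
  | monomial j a =>
    rw [Polynomial.X_pow_mul_monomial, creMul_monomial, creMul_monomial]
    congr 2
    push_cast; ring

/-- The mode at `z ^ M` of the vertex operator
`u ↦ exp (-∑_{k ≥ 1} form v k * z ^ (-k) / k) * u (p_q + v_q z ^ deg q)`. -/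
def vertex (v : σ → ℂ) (M : ℤ) : MvPolynomial σ ℂ →ₗ[ℂ] MvPolynomial σ ℂ :=
  (creMul v M).restrictScalars ℂ ∘ₗ (shift v).toLinearMap

theorem vertex_apply (v : σ → ℂ) (M : ℤ) (u : MvPolynomial σ ℂ) :
    vertex v M u = creMul v M (shift v u) := rfl

theorem vertex_eq_sum (v : σ → ℂ) (M : ℤ) (u : MvPolynomial σ ℂ) {B : ℕ}
    (hB : ∀ j : ℤ, (B : ℤ) ≤ j → ann v j u = 0) :
    vertex v M u = ∑ j ∈ Finset.range B, creCoeff v (j - M) * ann v j u := by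
  rw [vertex_apply, creMul, Polynomial.lsum_apply, Polynomial.sum_def]
  simp only [ann_natCast]
  refine Finset.sum_subset (fun j hj => ?_) fun j _ hj => ?_
  · rw [Finset.mem_range]
    by_contra hjB
    refine Polynomial.mem_support_iff.mp hj ?_
    rw [← hB j (by omega), ann_natCast]
  · rw [Polynomial.notMem_support_iff.mp hj]
    simp

theorem vertex_eq_zero (v : σ → ℂ) {M : ℤ} {u : MvPolynomial σ ℂ} {B : ℕ}
    (hB : ∀ j : ℤ, (B : ℤ) ≤ j → ann v j u = 0) (hM : (B : ℤ) ≤ M) : vertex v M u = 0 := by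
  rw [vertex_eq_sum v M u hB]
  refine Finset.sum_eq_zero fun j hj => ?_
  rw [creCoeff_of_neg v (by have := Finset.mem_range.mp hj; omega), zero_mul]

theorem vertex_one (v : σ → ℂ) (M : ℤ) : vertex v M 1 = creCoeff v (-M) := by
  rw [vertex_eq_sum v M 1 (B := 1)]
  · simp
  · intro j hj
    rw [ann_one, if_neg (by push_cast at hj; omega)]

theorem vertex_X_mul (v : σ → ℂ) (M : ℤ) (u : MvPolynomial σ ℂ) (q : σ) :
    vertex v M (MvPolynomial.X q * u) =
      MvPolynomial.X q * vertex v M u + v q • vertex v (M - deg q) u := by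
  rw [vertex_apply, map_mul, shift, MvPolynomial.aeval_X, add_mul, map_add, creMul_C_mul,
    smul_mul_assoc, ← algebraMap_smul (MvPolynomial σ ℂ) (v q), map_smul, creMul_X_pow_mul,
    algebraMap_smul]
  rfl

/-- The sum of `v_q w_q` over the times of degree `k`, for two vectors `v` and `w`, is `c` for all
`k ≥ 1`. -/
def HasPairing (v w : σ → ℂ) (c : ℂ) : Prop :=
  ∀ k, 0 < k → ∑ q ∈ fiber σ k, v q * w q = c

theorem HasPairing.symm {v w : σ → ℂ} {c : ℂ} (h : HasPairing v w c) : HasPairing w v c :=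
  fun k hk => by rw [← h k hk]; exact Finset.sum_congr rfl fun q _ => mul_comm _ _

theorem HasPairing.neg_right {v w : σ → ℂ} {c : ℂ} (h : HasPairing v w c) :
    HasPairing v (-w) (-c) :=
  fun k hk => by rw [← h k hk]; simp

theorem HasPairing.neg_left {v w : σ → ℂ} {c : ℂ} (h : HasPairing v w c) :
    HasPairing (-v) w (-c) := h.symm.neg_right.symm

theorem shift_form {v w : σ → ℂ} {c : ℂ} (h : HasPairing v w c) {k : ℕ} (hk : 0 < k) :
    shift v (form w k) = Polynomial.C (form w k) +
      Polynomial.C (MvPolynomial.C c) * Polynomial.X ^ k := by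
  rw [form, map_sum, ← h k hk, map_sum, map_sum, map_sum, Finset.sum_mul, ← Finset.sum_add_distrib]
  refine Finset.sum_congr rfl fun q hq => ?_
  rw [mem_fiber] at hq
  rw [map_smul, shift, MvPolynomial.aeval_X, hq, smul_add, smul_smul, mul_comm (w q),
    ← Polynomial.smul_eq_C_mul, ← MvPolynomial.algebraMap_eq, algebraMap_smul,
    Polynomial.smul_C]

end VertexOperators

/-! ### Products of vertex operators -/

section VertexProducts

variable {σ ρ : Type} [TimeIndex σ] [TimeIndex ρ]

theorem derivative_map {R S : Type*} [CommRing R] [CommRing S] (f : R →+* S) (F : PowerSeries R) :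
    PowerSeries.derivative S (F.map f) = (PowerSeries.derivative R F).map f := by
  ext n
  simp [PowerSeries.coeff_derivative]

theorem constantCoeff_map {R S : Type*} [CommRing R] [CommRing S] (f : R →+* S)
    (F : PowerSeries R) :
    PowerSeries.constantCoeff (F.map f) = f (PowerSeries.constantCoeff F) := by
  rw [← PowerSeries.coeff_zero_eq_constantCoeff_apply, PowerSeries.coeff_map,
    PowerSeries.coeff_zero_eq_constantCoeff_apply]

theorem derivative_mul_one_sub {R : Type*} [CommRing R] (F : PowerSeries R) (z : R) :
    PowerSeries.derivative R (F * (1 - PowerSeries.C z * PowerSeries.X)) =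
      PowerSeries.derivative R F * (1 - PowerSeries.C z * PowerSeries.X) -
        F * PowerSeries.C z := by
  rw [Derivation.leibniz, map_sub, PowerSeries.derivative_one, Derivation.leibniz,
    PowerSeries.derivative_C, PowerSeries.derivative_X]
  simp only [smul_eq_mul]
  ring

/-- The contraction factor of two vertex operators with pairing `-1` is `(1 - z ζ)⁻¹`: the shift
multiplies `cre w` by it. The denominator is kept on the left-hand side. -/
theorem map_shift_cre_mul {v w : σ → ℂ} (h : HasPairing v w (-1)) :
    (cre w).map (shift v).toRingHom * (1 - PowerSeries.C Polynomial.X * PowerSeries.X) =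
      (cre w).map Polynomial.C := by
  let Z : PowerSeries (Polynomial (MvPolynomial σ ℂ)) :=
    PowerSeries.mk fun k => Polynomial.X ^ (k + 1)
  have hZ : Z * (1 - PowerSeries.C Polynomial.X * PowerSeries.X) = PowerSeries.C Polynomial.X := by
    ext1 k
    rw [mul_sub, mul_one, map_sub, mul_comm (PowerSeries.C _), ← mul_assoc,
      PowerSeries.coeff_mul_C, PowerSeries.coeff_C]
    cases k with
    | zero => simp [Z]
    | succ k => rw [PowerSeries.coeff_succ_mul_X]; simp [Z, pow_succ]
  have hd : (dlogCre w).map (shift v).toRingHom = (dlogCre w).map Polynomial.C + Z := by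
    ext1 k
    have := shift_form h k.succ_pos
    simp only [dlogCre, PowerSeries.coeff_map, PowerSeries.coeff_mk, map_add, map_neg, Z]
    change -(shift v (form w (k + 1))) = _
    rw [this]
    simp
    ring
  refine eq_of_derivative_eq_mul (Q := (dlogCre w).map Polynomial.C) ?_ ?_ ?_
  · rw [derivative_mul_one_sub, derivative_map, derivative_cre, map_mul, hd]
    linear_combination (cre w).map (shift v).toRingHom * hZ
  · rw [derivative_map, derivative_cre, map_mul]
  · simp [constantCoeff_map]

/-- The contraction factor of two vertex operators with pairing `1` is `1 - z ζ`. -/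
theorem map_shift_cre {v w : σ → ℂ} (h : HasPairing v w 1) :
    (cre w).map (shift v).toRingHom =
      (cre w).map Polynomial.C * (1 - PowerSeries.C Polynomial.X * PowerSeries.X) := by
  have h1 := map_shift_cre_mul h.neg_right
  have h2 : (cre w).map (shift v).toRingHom * (cre (-w)).map (shift v).toRingHom = 1 := by
    rw [← map_mul, cre_mul_cre_neg, map_one]
  have h3 : (cre w).map Polynomial.C * (cre (-w)).map Polynomial.C = 1 := by
    rw [← map_mul, cre_mul_cre_neg, map_one]
  linear_combination (-(cre w).map Polynomial.C * (cre w).map (shift v).toRingHom) * h1 +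
    ((cre w).map Polynomial.C * (1 - PowerSeries.C Polynomial.X * PowerSeries.X)) * h2 -
    (cre w).map (shift v).toRingHom * h3

theorem shift_creCoeff {v w : σ → ℂ} (h : HasPairing v w 1) (n : ℤ) :
    shift v (creCoeff w n) =
      Polynomial.C (creCoeff w n) - Polynomial.C (creCoeff w (n - 1)) * Polynomial.X := by
  by_cases hn : n < 0
  · simp [creCoeff_of_neg w hn, creCoeff_of_neg w (show n - 1 < 0 by omega)]
  obtain ⟨n, rfl⟩ := Int.eq_ofNat_of_zero_le (not_lt.mp hn)
  have := congrArg (PowerSeries.coeff n) (map_shift_cre h)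
  rw [mul_sub, mul_one, map_sub, mul_comm (PowerSeries.C _), ← mul_assoc, PowerSeries.coeff_mul_C,
    PowerSeries.coeff_map, PowerSeries.coeff_map] at this
  rw [creCoeff_natCast]
  refine this.trans ?_
  cases n with
  | zero => simp [creCoeff_of_neg]
  | succ n =>
    rw [PowerSeries.coeff_succ_mul_X, PowerSeries.coeff_map,
      show ((n + 1 : ℕ) : ℤ) - 1 = n by push_cast; ring, creCoeff_natCast]

theorem shift_creCoeff_neg {v w : σ → ℂ} (h : HasPairing v w (-1)) (n : ℤ) :
    shift v (creCoeff w n) - Polynomial.X * shift v (creCoeff w (n - 1)) =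
      Polynomial.C (creCoeff w n) := by
  by_cases hn : n < 0
  · simp [creCoeff_of_neg w hn, creCoeff_of_neg w (show n - 1 < 0 by omega)]
  obtain ⟨n, rfl⟩ := Int.eq_ofNat_of_zero_le (not_lt.mp hn)
  have := congrArg (PowerSeries.coeff n) (map_shift_cre_mul h)
  rw [mul_sub, mul_one, map_sub, mul_comm (PowerSeries.C _), ← mul_assoc, PowerSeries.coeff_mul_C,
    PowerSeries.coeff_map, PowerSeries.coeff_map] at this
  rw [creCoeff_natCast, ← this, mul_comm]
  cases n with
  | zero => simp [creCoeff_of_neg]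
  | succ n =>
    rw [PowerSeries.coeff_succ_mul_X, PowerSeries.coeff_map,
      show ((n + 1 : ℕ) : ℤ) - 1 = n by push_cast; ring, creCoeff_natCast]
    rfl

/-- Vertex operators with pairing `0` have no contraction. -/
theorem map_shift_cre_zero {v w : σ → ℂ} (h : HasPairing v w 0) :
    (cre w).map (shift v).toRingHom = (cre w).map Polynomial.C := by
  refine eq_of_derivative_eq_mul (Q := (dlogCre w).map Polynomial.C) ?_ ?_ ?_
  · rw [derivative_map, derivative_cre, map_mul]
    congr 1
    ext1 k
    have := shift_form h k.succ_pos
    simp only [dlogCre, PowerSeries.coeff_map, PowerSeries.coeff_mk, map_neg]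
    change -(shift v (form w (k + 1))) = _
    rw [this]
    simp
  · rw [derivative_map, derivative_cre, map_mul]
  · simp [constantCoeff_map]

theorem shift_creCoeff_zero {v w : σ → ℂ} (h : HasPairing v w 0) (n : ℤ) :
    shift v (creCoeff w n) = Polynomial.C (creCoeff w n) := by
  by_cases hn : n < 0
  · simp [creCoeff_of_neg w hn]
  obtain ⟨n, rfl⟩ := Int.eq_ofNat_of_zero_le (not_lt.mp hn)
  have := congrArg (PowerSeries.coeff n) (map_shift_cre_zero h)
  rw [PowerSeries.coeff_map, PowerSeries.coeff_map] at this
  rw [creCoeff_natCast]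
  exact this

theorem vertex_creCoeff_mul {v w : σ → ℂ} (h : HasPairing v w 1) (M n : ℤ)
    (u : MvPolynomial σ ℂ) :
    vertex v M (creCoeff w n * u) =
      creCoeff w n * vertex v M u - creCoeff w (n - 1) * vertex v (M - 1) u := by
  have hX := creMul_X_pow_mul v M 1 (shift v u)
  rw [pow_one, Nat.cast_one] at hX
  rw [vertex_apply, map_mul, shift_creCoeff h, sub_mul, map_sub, creMul_C_mul, mul_assoc,
    creMul_C_mul, hX]
  rfl

theorem vertex_creCoeff_mul_neg {v w : σ → ℂ} (h : HasPairing v w (-1)) (M n : ℤ)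
    (u : MvPolynomial σ ℂ) :
    vertex v M (creCoeff w n * u) - vertex v (M - 1) (creCoeff w (n - 1) * u) =
      creCoeff w n * vertex v M u := by
  have hX := creMul_X_pow_mul v M 1 (shift v (creCoeff w (n - 1) * u))
  rw [pow_one, Nat.cast_one] at hX
  simp only [vertex_apply]
  rw [← hX, ← map_sub, ← creMul_C_mul, ← shift_creCoeff_neg h, map_mul, map_mul]
  congr 1
  ring

theorem vertex_creCoeff_mul_zero {v w : σ → ℂ} (h : HasPairing v w 0) (M n : ℤ)
    (u : MvPolynomial σ ℂ) :
    vertex v M (creCoeff w n * u) = creCoeff w n * vertex v M u := by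
  simp only [vertex_apply]
  rw [← creMul_C_mul, ← shift_creCoeff_zero h, map_mul]

theorem exists_ann_eq_zero_and (v w : σ → ℂ) (u : MvPolynomial σ ℂ) :
    ∃ B : ℕ, (∀ j : ℤ, (B : ℤ) ≤ j → ann v j u = 0) ∧ (∀ j : ℤ, (B : ℤ) ≤ j → ann w j u = 0) := by
  obtain ⟨B, hB⟩ := exists_ann_eq_zero v u
  obtain ⟨B', hB'⟩ := exists_ann_eq_zero w u
  exact ⟨max B B', fun j hj => hB j (by push_cast at hj; omega),
    fun j hj => hB' j (by push_cast at hj; omega)⟩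

/-- The mode at `z ^ M * w ^ N` of the normally ordered product of two vertex operators; `B` bounds
the degree in `z` and `w` of the shifts of `u`. -/
def normalOrdered (v w : σ → ℂ) (B : ℕ) (M N : ℤ) (u : MvPolynomial σ ℂ) : MvPolynomial σ ℂ :=
  ∑ i ∈ Finset.range B, ∑ j ∈ Finset.range B,
    creCoeff v (i - M) * creCoeff w (j - N) * ann v i (ann w j u)

theorem normalOrdered_comm (v w : σ → ℂ) (B : ℕ) (M N : ℤ) (u : MvPolynomial σ ℂ) :
    normalOrdered v w B M N u = normalOrdered w v B N M u := by
  rw [normalOrdered, normalOrdered, Finset.sum_comm]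
  refine Finset.sum_congr rfl fun i _ => Finset.sum_congr rfl fun j _ => ?_
  rw [ann_comm, mul_comm (creCoeff v _)]

theorem normalOrdered_eq {v w : σ → ℂ} {B : ℕ} {u : MvPolynomial σ ℂ}
    (hv : ∀ j : ℤ, (B : ℤ) ≤ j → ann v j u = 0) (M N : ℤ) :
    normalOrdered v w B M N u =
      ∑ j ∈ Finset.range B, creCoeff w (j - N) * vertex v M (ann w j u) := by
  rw [normalOrdered, Finset.sum_comm]
  refine Finset.sum_congr rfl fun j _ => ?_
  rw [vertex_eq_sum v M (ann w j u) (B := B)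
    (fun i hi => by rw [ann_comm, hv i hi, map_zero]), Finset.mul_sum]
  refine Finset.sum_congr rfl fun i _ => ?_
  ring

/-- The product is `1 - z ζ` times the normally ordered product, with `ζ` the inverse of the variable of
the second operator. -/
theorem vertex_vertex {v w : σ → ℂ} (h : HasPairing v w 1) {B : ℕ} {u : MvPolynomial σ ℂ}
    (hv : ∀ j : ℤ, (B : ℤ) ≤ j → ann v j u = 0) (hw : ∀ j : ℤ, (B : ℤ) ≤ j → ann w j u = 0)
    (M N : ℤ) :
    vertex v M (vertex w N u) =
      normalOrdered v w B M N u - normalOrdered v w B (M - 1) (N + 1) u := by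
  rw [vertex_eq_sum w N u hw, map_sum, normalOrdered_eq hv, normalOrdered_eq hv,
    ← Finset.sum_sub_distrib]
  refine Finset.sum_congr rfl fun j _ => ?_
  rw [vertex_creCoeff_mul h, sub_sub]

/-- The contraction factor is `(1 - z ζ)⁻¹`, and its denominator is moved to the left-hand side. -/
theorem vertex_vertex_neg {v w : σ → ℂ} (h : HasPairing v w (-1)) {B : ℕ} {u : MvPolynomial σ ℂ}
    (hv : ∀ j : ℤ, (B : ℤ) ≤ j → ann v j u = 0) (hw : ∀ j : ℤ, (B : ℤ) ≤ j → ann w j u = 0)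
    (M N : ℤ) :
    vertex v M (vertex w N u) - vertex v (M - 1) (vertex w (N + 1) u) =
      normalOrdered v w B M N u := by
  rw [vertex_eq_sum w N u hw, vertex_eq_sum w (N + 1) u hw, map_sum, map_sum, normalOrdered_eq hv,
    ← Finset.sum_sub_distrib]
  refine Finset.sum_congr rfl fun j _ => ?_
  rw [← vertex_creCoeff_mul_neg h, sub_sub]

theorem vertex_comm {v w : σ → ℂ} (h : HasPairing v w 0) (M N : ℤ) (u : MvPolynomial σ ℂ) :
    vertex v M (vertex w N u) = vertex w N (vertex v M u) := by
  obtain ⟨B, hv, hw⟩ := exists_ann_eq_zero_and v w u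
  have key {v w : σ → ℂ} (h : HasPairing v w 0) (hv : ∀ j : ℤ, (B : ℤ) ≤ j → ann v j u = 0)
      (hw : ∀ j : ℤ, (B : ℤ) ≤ j → ann w j u = 0) (M N : ℤ) :
      vertex v M (vertex w N u) = normalOrdered v w B M N u := by
    rw [vertex_eq_sum w N u hw, map_sum, normalOrdered_eq hv]
    exact Finset.sum_congr rfl fun j _ => vertex_creCoeff_mul_zero h _ _ _
  rw [key h hv hw, key h.symm hw hv, normalOrdered_comm]

/-- The factor `1 - z ζ` makes the product antisymmetric up to a shift of the modes. -/
theorem vertex_anticomm {v : σ → ℂ} (h : HasPairing v v 1) (M N : ℤ) (u : MvPolynomial σ ℂ) :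
    vertex v (M + 1) (vertex v N u) = -vertex v (N + 1) (vertex v M u) := by
  obtain ⟨B, hv, -⟩ := exists_ann_eq_zero_and v v u
  rw [vertex_vertex h hv hv, vertex_vertex h hv hv, add_sub_cancel_right, add_sub_cancel_right,
    normalOrdered_comm v v B (M + 1), normalOrdered_comm v v B M]
  ring

theorem sum_creCoeff_mul_creCoeff_neg (v : σ → ℂ) {i k a : ℤ} {T : ℕ} (hi : i < a + T)
    (hk : a ≤ k) :
    ∑ t ∈ Finset.range T, creCoeff v (i - (a + t)) * creCoeff (-v) (a + t - k) =
      if i = k then 1 else 0 := by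
  by_cases hik : i < k
  · rw [if_neg (by omega)]
    refine Finset.sum_eq_zero fun t _ => ?_
    by_cases ht : a + t < k
    · rw [creCoeff_of_neg (-v) (by omega), mul_zero]
    · rw [creCoeff_of_neg v (by omega), zero_mul]
  obtain ⟨n, hn⟩ := Int.eq_ofNat_of_zero_le (show 0 ≤ i - k by omega)
  obtain ⟨b, hb⟩ := Int.eq_ofNat_of_zero_le (show 0 ≤ k - a by omega)
  have h := congrArg (PowerSeries.coeff n) (cre_mul_cre_neg (-v))
  rw [neg_neg, PowerSeries.coeff_mul, Finset.Nat.sum_antidiagonal_eq_sum_range_succ_mk,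
    PowerSeries.coeff_one] at h
  have e : (i = k) ↔ n = 0 := by omega
  simp only [e]
  rw [← h]
  symm
  refine Finset.sum_of_injOn (fun t => t + b) (by intro x _ y _; simp)
    (by intro t ht; simp only [Finset.coe_range, Set.mem_Iio] at ht ⊢; omega) ?_ ?_
  · intro t _ ht
    by_cases h1 : a + t < k
    · rw [creCoeff_of_neg (-v) (by omega), mul_zero]
    · rw [creCoeff_of_neg v, zero_mul]
      by_contra h2
      refine ht ⟨t - b, ?_, ?_⟩
      · simp only [Finset.coe_range, Set.mem_Iio]; omega
      · simp only; omega
  · intro t ht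
    have ht := Finset.mem_range.mp ht
    rw [show i - (a + (t + b : ℕ)) = ((n - t : ℕ) : ℤ) by omega,
      show a + (t + b : ℕ) - k = (t : ℤ) by omega, creCoeff_natCast, creCoeff_natCast, mul_comm]

/-- The sum of the products in the two orders is a delta function in `z` and `w`, on whose diagonal
the normally ordered product of the operators for `v` and `-v` is the identity. -/
theorem vertex_neg_anticomm {v : σ → ℂ} (h : HasPairing v v 1) (M N : ℤ) (u : MvPolynomial σ ℂ) :
    vertex v M (vertex (-v) (N + 1) u) + vertex (-v) N (vertex v (M + 1) u) =
      if M + N = -1 then u else 0 := by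
  obtain ⟨B, hv, hw⟩ := exists_ann_eq_zero_and v (-v) u
  have hvw := h.neg_right
  have hwv := h.neg_left
  obtain ⟨c, rfl⟩ : ∃ c, N = c - M := ⟨M + N, by ring⟩
  -- the anticommutator does not depend on `M` for a fixed sum `c` of the two indices
  let f : ℤ → MvPolynomial σ ℂ := fun M =>
    vertex v M (vertex (-v) (c - M + 1) u) + vertex (-v) (c - M) (vertex v (M + 1) u)
  have hf : ∀ M, f M = f (M - 1) := by
    intro M
    have h1 := vertex_vertex_neg hvw hv hw M (c - M + 1)
    have h2 := vertex_vertex_neg hwv hw hv (c - M + 1) M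
    rw [normalOrdered_comm, ← h1] at h2
    simp only [f]
    rw [show c - (M - 1) + 1 = c - M + 1 + 1 by ring, show c - (M - 1) = c - M + 1 by ring,
      sub_add_cancel M 1]
    rw [show c - M + 1 - 1 = c - M by ring] at h2
    linear_combination -h2
  have hf' : ∀ (n : ℕ) (M : ℤ), f (M + n) = f M := by
    intro n M
    induction n with
    | zero => simp
    | succ n ih => rw [hf, ← ih]; congr 1; push_cast; ring
  -- for `M` small the first term vanishes, for `M` large the second one does
  let a : ℤ := c + 1 - B
  let T : ℕ := (B - a).toNat + B
  have htel : ∀ T : ℕ, vertex v (a + T) (vertex (-v) (c - (a + T) + 1) u) =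
      ∑ t ∈ Finset.range T, normalOrdered v (-v) B (a + 1 + t) (c + 1 - (a + 1 + t)) u := by
    intro T
    induction T with
    | zero =>
      rw [vertex_eq_zero (-v) hw (by simp only [a]; push_cast; omega)]
      simp
    | succ T ih =>
      rw [Finset.sum_range_succ, ← ih, ← vertex_vertex_neg hvw hv hw]
      rw [show a + ((T + 1 : ℕ) : ℤ) = a + 1 + T by push_cast; ring,
        show c - (a + 1 + (T : ℤ)) + 1 = c + 1 - (a + 1 + T) by ring,
        show a + 1 + (T : ℤ) - 1 = a + T by ring,
        show c + 1 - (a + 1 + (T : ℤ)) + 1 = c - (a + T) + 1 by ring]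
      ring
  have hTa : (B : ℤ) ≤ a + T := by simp only [T]; push_cast; omega
  have hfT : f (a + T) = if c = -1 then u else 0 := by
    simp only [f]
    rw [vertex_eq_zero v hv (by omega), map_zero, add_zero, htel]
    simp only [normalOrdered]
    rw [Finset.sum_comm]
    simp only [Finset.sum_comm (s := Finset.range T)]
    rw [Finset.sum_congr rfl fun i hi => Finset.sum_congr rfl fun j hj => by
      rw [← Finset.sum_mul]]
    have h3 : ∀ i ∈ Finset.range B, ∀ j ∈ Finset.range B,
        (∑ t ∈ Finset.range T, creCoeff v ((i : ℤ) - (a + 1 + t)) *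
          creCoeff (-v) ((j : ℤ) - (c + 1 - (a + 1 + t)))) * ann v i (ann (-v) j u) =
        if (i : ℤ) = c + 1 - j then ann v (c + 1 - j) (ann (-v) j u) else 0 := by
      intro i hi j hj
      rw [Finset.mem_range] at hi hj
      have := sum_creCoeff_mul_creCoeff_neg v (i := i) (k := c + 1 - j) (a := a + 1) (T := T)
        (by omega) (by simp only [a]; omega)
      rw [Finset.sum_congr rfl fun t _ => by
        rw [show (j : ℤ) - (c + 1 - (a + 1 + t)) = a + 1 + t - (c + 1 - j) by ring]]
      rw [this]
      split_ifs with hij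
      · rw [one_mul, hij]
      · rw [zero_mul]
    rw [Finset.sum_congr rfl fun i hi => Finset.sum_congr rfl fun j hj => h3 i hi j hj,
      Finset.sum_comm]
    have h4 := sum_ann_ann_neg (-v) (c + 1) u hw
    rw [neg_neg] at h4
    have e : c = -1 ↔ c + 1 = 0 := by omega
    simp only [e]
    rw [← h4]
    refine Finset.sum_congr rfl fun j hj => ?_
    by_cases hcj : 0 ≤ c + 1 - j ∧ c + 1 - j < B
    · obtain ⟨m, hm⟩ := Int.eq_ofNat_of_zero_le hcj.1
      rw [Finset.sum_eq_single m]
      · rw [if_pos hm.symm]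
      · intro b _ hb
        rw [if_neg (by omega)]
      · intro hmB
        rw [Finset.mem_range] at hmB
        omega
    · rw [Finset.sum_eq_zero]
      · by_cases h0 : 0 ≤ c + 1 - j
        · rw [ann_comm, hv _ (by omega), map_zero]
        · rw [ann_of_neg v (by omega)]
      · intro i hi
        rw [Finset.mem_range] at hi
        rw [if_neg (by omega)]
  have : f M = if c = -1 then u else 0 := by
    rcases le_total (a + T) M with hM | hM
    · obtain ⟨n, hn⟩ := Int.eq_ofNat_of_zero_le (sub_nonneg.mpr hM)
      rw [← hfT, ← hf' n (a + T)]
      congr 1; omega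
    · obtain ⟨n, hn⟩ := Int.eq_ofNat_of_zero_le (sub_nonneg.mpr hM)
      rw [← hfT, ← hf' n M]
      congr 1; omega
  rw [show M + (c - M) = c by ring]
  exact this

end VertexProducts

/-! ### Fermions on the Fock space -/

/-- The polynomial fermionic Fock space: a copy of the ring of polynomials in the times for each
charge. -/
abbrev Fock : Type := ℤ →₀ MvPolynomial ℕ+ ℂ

/-- The constant vector with the value `s`. -/
def constVec (s : ℤˣ) : ℕ+ → ℂ := fun _ => ((s : ℤ) : ℂ)

theorem constVec_neg (s : ℤˣ) : constVec (-s) = -constVec s := by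
  ext; simp [constVec]

theorem units_mul_self (s : ℤˣ) : (s : ℤ) * s = 1 := by
  rw [← Units.val_mul, ← sq, Int.units_sq, Units.val_one]

theorem units_mul_self_complex (s : ℤˣ) : ((s : ℤ) : ℂ) * ((s : ℤ) : ℂ) = 1 := by
  exact_mod_cast units_mul_self s

theorem form_constVec (s : ℤˣ) (k : ℕ+) :
    form (constVec s) k = ((s : ℤ) : ℂ) • MvPolynomial.X k := by
  rw [form, fiber_pnat]
  simp [constVec]

theorem hasPairing_constVec (s : ℤˣ) : HasPairing (constVec s) (constVec s) 1 := by
  intro k hk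
  lift k to ℕ+ using hk
  rw [fiber_pnat]
  simp [constVec, units_mul_self_complex]

/-- The modes of the fermions `ψ = psi 1` and `ψ* = psi (-1)`, which change the charge by `∓1`. They
are numbered so that the mode `n` of `ψ` and the mode `-1 - n` of `ψ*` do not anticommute, and modes
with large numbers annihilate any given vector. -/
def psi (s : ℤˣ) (n : ℤ) : Fock →ₗ[ℂ] Fock :=
  Finsupp.lsum ℂ fun a => Finsupp.lsingle (a - s) ∘ₗ vertex (constVec s) (n - s * a + 1)

theorem psi_single (s : ℤˣ) (n a : ℤ) (u : MvPolynomial ℕ+ ℂ) :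
    psi s n (Finsupp.single a u) =
      Finsupp.single (a - s) (vertex (constVec s) (n - s * a + 1) u) := by
  simp [psi]

theorem psi_anticomm (s : ℤˣ) (m n : ℤ) (x : Fock) : psi s m (psi s n x) = -psi s n (psi s m x) := by
  induction x using Finsupp.induction_linear with
  | zero => simp
  | add x y hx hy => simp only [map_add, hx, hy, neg_add]
  | single a u =>
    simp only [psi_single]
    rw [← Finsupp.single_neg, mul_sub, units_mul_self,
      show m - ((s : ℤ) * a - 1) + 1 = (m - s * a + 1) + 1 by ring,
      show n - ((s : ℤ) * a - 1) + 1 = (n - s * a + 1) + 1 by ring,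
      vertex_anticomm (hasPairing_constVec s)]

theorem psi_neg_anticomm (s : ℤˣ) (m n : ℤ) (x : Fock) :
    psi s m (psi (-s) n x) + psi (-s) n (psi s m x) = if m + n = -1 then x else 0 := by
  induction x using Finsupp.induction_linear with
  | zero => simp
  | add x y hx hy =>
    simp only [map_add]
    rw [add_add_add_comm, hx, hy]
    split_ifs <;> simp
  | single a u =>
    simp only [psi_single, Units.val_neg, constVec_neg]
    rw [show m - (s : ℤ) * (a - -s) + 1 = (m - s * a) + (1 - s * s) by ring, units_mul_self,
      show n - -(s : ℤ) * (a - s) + 1 = (n + s * a) + (1 - s * s) by ring, units_mul_self,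
      show n - -(s : ℤ) * a + 1 = n + s * a + 1 by ring, sub_self, add_zero, add_zero,
      sub_neg_eq_add, add_sub_cancel_right, sub_neg_eq_add (a - (s : ℤ)), sub_add_cancel,
      ← Finsupp.single_add,
      vertex_neg_anticomm (hasPairing_constVec s),
      show m - (s : ℤ) * a + (n + s * a) = m + n by ring]
    split_ifs <;> simp

theorem exists_psi_eq_zero (x : Fock) : ∃ B : ℤ, ∀ (s : ℤˣ) (n : ℤ), B ≤ n → psi s n x = 0 := by
  induction x using Finsupp.induction_linear with
  | zero => exact ⟨0, fun s n _ => map_zero _⟩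
  | add x y hx hy =>
    obtain ⟨A, hA⟩ := hx
    obtain ⟨B, hB⟩ := hy
    refine ⟨max A B, fun s n hn => ?_⟩
    rw [map_add, hA s n (by omega), hB s n (by omega), add_zero]
  | single a u =>
    obtain ⟨A, hA⟩ := exists_ann_eq_zero (constVec 1) u
    obtain ⟨B, hB⟩ := exists_ann_eq_zero (constVec (-1)) u
    refine ⟨A + B + |a|, fun s n hn => ?_⟩
    have h1 := le_abs_self a
    have h2 := neg_abs_le a
    rw [psi_single]
    rcases Int.units_eq_one_or s with rfl | rfl
    · rw [vertex_eq_zero _ hA (by push_cast; omega), Finsupp.single_zero]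
    · rw [vertex_eq_zero _ hB (by push_cast; omega), Finsupp.single_zero]

/-- Multiplication by the time `p_k`. -/
def boson (k : ℕ+) : Fock →ₗ[ℂ] Fock :=
  Finsupp.mapRange.linearMap (LinearMap.mulLeft ℂ (MvPolynomial.X k))

theorem boson_single (k : ℕ+) (a : ℤ) (u : MvPolynomial ℕ+ ℂ) :
    boson k (Finsupp.single a u) = Finsupp.single a (MvPolynomial.X k * u) := by
  simp [boson]

theorem boson_comm (k l : ℕ+) (x : Fock) : boson k (boson l x) = boson l (boson k x) := by
  induction x using Finsupp.induction_linear with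
  | zero => simp
  | add x y hx hy => simp only [map_add, hx, hy]
  | single a u => simp only [boson_single]; rw [mul_left_comm]

theorem boson_psi (s : ℤˣ) (n : ℤ) (k : ℕ+) (x : Fock) :
    boson k (psi s n x) = psi s n (boson k x) - ((s : ℤ) : ℂ) • psi s (n - k) x := by
  rw [eq_sub_iff_add_eq]
  induction x using Finsupp.induction_linear with
  | zero => simp
  | add x y hx hy => simp only [map_add, smul_add, ← hx, ← hy]; abel
  | single a u =>
    simp only [psi_single, boson_single, vertex_X_mul]
    rw [Finsupp.smul_single, ← Finsupp.single_add, deg_pnat, constVec,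
      show n - (s : ℤ) * a + 1 - (k : ℕ) = n - k - s * a + 1 by ring]

/-- The vacuum of charge `a`. -/
def vac (a : ℤ) : Fock := Finsupp.single a 1

theorem psi_vac (s : ℤˣ) (n a : ℤ) :
    psi s n (vac a) = Finsupp.single (a - s) (creCoeff (constVec s) (s * a - 1 - n)) := by
  rw [vac, psi_single, vertex_one]
  congr 2
  ring

theorem psi_vac_of_lt (s : ℤˣ) {n a : ℤ} (h : s * a - 1 < n) : psi s n (vac a) = 0 := by
  rw [psi_vac, creCoeff_of_neg _ (by omega), Finsupp.single_zero]

theorem psi_vac_top (s : ℤˣ) (a : ℤ) : psi s (s * a - 1) (vac a) = vac (a - s) := by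
  rw [psi_vac, sub_self, creCoeff_zero, vac]

/-- The logarithmic derivative of `cre v` as the product of its derivative and `cre (-v)`. -/
theorem sum_mul_creCoeff_mul_creCoeff_neg {σ : Type} [TimeIndex σ] (v : σ → ℂ) (k : ℕ) :
    ∑ t ∈ Finset.range (k + 1), ((k + 1 - t : ℕ) : ℂ) •
      (creCoeff (-v) t * creCoeff v ((k + 1 : ℕ) - t)) = -form v (k + 1) := by
  have h : PowerSeries.derivative _ (cre v) * cre (-v) = dlogCre v := by
    rw [derivative_cre, mul_assoc, cre_mul_cre_neg, mul_one]
  have h2 := congrArg (PowerSeries.coeff k) h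
  rw [mul_comm, PowerSeries.coeff_mul, Finset.Nat.sum_antidiagonal_eq_sum_range_succ_mk] at h2
  rw [dlogCre, PowerSeries.coeff_mk] at h2
  rw [← h2]
  refine Finset.sum_congr rfl fun t ht => ?_
  have ht := Finset.mem_range.mp ht
  rw [PowerSeries.coeff_derivative, show ((k + 1 : ℕ) : ℤ) - t = ((k - t + 1 : ℕ) : ℤ) by omega,
    creCoeff_natCast, creCoeff_natCast, show k + 1 - t = k - t + 1 by omega, Algebra.smul_def,
    map_natCast]
  push_cast
  ring

theorem vertex_creCoeff_neg_eq_sum {σ : Type} [TimeIndex σ] {v : σ → ℂ} (h : HasPairing v v 1)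
    (k T : ℕ) :
    vertex v ((T : ℤ) - k) (creCoeff (-v) T) =
      ∑ t ∈ Finset.range (T + 1), creCoeff (-v) t * creCoeff v (k - t) := by
  induction T with
  | zero =>
    simp only [Nat.cast_zero, creCoeff_zero, zero_sub, vertex_one, neg_neg, zero_add,
      Finset.range_one, Finset.sum_singleton, one_mul, sub_zero]
  | succ T ih =>
    rw [Finset.sum_range_succ, ← ih]
    have := vertex_creCoeff_mul_neg h.neg_right (((T + 1 : ℕ) : ℤ) - k) ((T + 1 : ℕ) : ℤ) 1
    rw [mul_one, mul_one, vertex_one] at this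
    rw [show ((T + 1 : ℕ) : ℤ) - k - 1 = T - k by push_cast; ring,
      show ((T + 1 : ℕ) : ℤ) - 1 = T by push_cast; ring, neg_sub] at this
    rw [← this]
    ring

theorem sum_range_sum_range_succ {M : Type*} [AddCommMonoid M] [Module ℂ M] (k : ℕ) (f : ℕ → M) :
    ∑ T ∈ Finset.range k, ∑ t ∈ Finset.range (T + 1), f t =
      ∑ t ∈ Finset.range k, ((k - t : ℕ) : ℂ) • f t := by
  induction k with
  | zero => simp
  | succ k ih =>
    rw [Finset.sum_range_succ, ih, Finset.sum_range_succ _ k, ← add_assoc,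
      ← Finset.sum_add_distrib, Finset.sum_range_succ _ k]
    congr 1
    · refine Finset.sum_congr rfl fun t ht => ?_
      have ht := Finset.mem_range.mp ht
      rw [show k + 1 - t = (k - t) + 1 by omega, Nat.cast_succ, add_smul, one_smul]
    · simp

/-- The action of `p_k` on a vacuum is bilinear in the fermions: on a vacuum only the modes with
`r < k` contribute to the current `ψ ψ*`. -/
theorem boson_vac (s : ℤˣ) (k : ℕ+) (a : ℤ) {i : ℕ} (hi : k ≤ i) :
    ((s : ℤ) : ℂ) • boson k (vac a) =
      -∑ r ∈ Finset.range i, psi s (s * a - 1 - r) (psi (-s) (-k - 1 - (s * a - 1 - r)) (vac a)) := by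
  have h := hasPairing_constVec s
  obtain ⟨k', hk'⟩ : ∃ k', (k : ℕ) = k' + 1 := ⟨k - 1, by have := k.pos; omega⟩
  have h1 : ∀ r : ℕ, psi s (s * a - 1 - r) (psi (-s) (-k - 1 - (s * a - 1 - r)) (vac a)) =
      Finsupp.single a (vertex (constVec s) (-1 - r) (creCoeff (constVec (-s)) (k - 1 - r))) := by
    intro r
    rw [psi_vac, psi_single, Units.val_neg, sub_neg_eq_add, add_sub_cancel_right, mul_add,
      units_mul_self]
    congr 2
    · ring_nf
    · congr 1; ring
  rw [Finset.sum_congr rfl fun r _ => h1 r, vac, boson_single, Finsupp.smul_single,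
    ← Finsupp.single_finsetSum, ← Finsupp.single_neg, mul_one, ← form_constVec]
  congr 1
  have h2 : ∑ r ∈ Finset.range i,
      vertex (constVec s) (-1 - r) (creCoeff (constVec (-s)) (k - 1 - r)) =
      ∑ r ∈ Finset.range (k : ℕ),
      vertex (constVec s) (-1 - r) (creCoeff (constVec (-s)) (k - 1 - r)) := by
    symm
    refine Finset.sum_subset (by intro x; simp only [Finset.mem_range]; omega) fun r _ hr => ?_
    rw [Finset.mem_range] at hr
    rw [creCoeff_of_neg _ (by omega), map_zero]
  rw [h2, ← Finset.sum_range_reflect]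
  have h3 : ∀ T ∈ Finset.range (k : ℕ), vertex (constVec s) (-1 - ((k - 1 - T : ℕ) : ℤ))
      (creCoeff (constVec (-s)) (k - 1 - ((k - 1 - T : ℕ) : ℤ))) =
      ∑ t ∈ Finset.range (T + 1),
        creCoeff (-constVec s) t * creCoeff (constVec s) ((k : ℕ) - t) := by
    intro T hT
    have hT := Finset.mem_range.mp hT
    rw [← vertex_creCoeff_neg_eq_sum h, constVec_neg]
    congr 2 <;> omega
  rw [Finset.sum_congr rfl h3, sum_range_sum_range_succ, hk', sum_mul_creCoeff_mul_creCoeff_neg, neg_neg]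

/-- The parity of the charge, with the eigenvalue `(-1) ^ a` on charge `a`. -/
def parity : Fock →ₗ[ℂ] Fock :=
  Finsupp.lsum ℂ fun a => ((-1 : ℂ) ^ a) • Finsupp.lsingle a

theorem parity_single (a : ℤ) (u : MvPolynomial ℕ+ ℂ) :
    parity (Finsupp.single a u) = (-1 : ℂ) ^ a • Finsupp.single a u := by
  simp [parity]

theorem parity_psi (s : ℤˣ) (n : ℤ) (x : Fock) : parity (psi s n x) = -psi s n (parity x) := by
  induction x using Finsupp.induction_linear with
  | zero => simp
  | add x y hx hy => simp only [map_add, hx, hy, neg_add]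
  | single a u =>
    rw [psi_single, parity_single, parity_single, map_smul, psi_single, ← neg_smul]
    congr 1
    rcases Int.units_eq_one_or s with rfl | rfl
    · rw [Units.val_one, zpow_sub₀ (by norm_num)]; simp [div_neg]
    · rw [Units.val_neg, Units.val_one, sub_neg_eq_add, zpow_add₀ (by norm_num)]; simp

theorem parity_boson (k : ℕ+) (x : Fock) : parity (boson k x) = boson k (parity x) := by
  induction x using Finsupp.induction_linear with
  | zero => simp
  | add x y hx hy => simp only [map_add, hx, hy]
  | single a u => rw [boson_single, parity_single, parity_single, map_smul, boson_single]

/-! ### Two commuting copies of the fermions -/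

/-- Two copies of the modes of charged free fermions, `left 1`, `left (-1)` and `right 1`,
`right (-1)`, together with the modes of a current of which all of them have charge one. The copies
commute with each other: no sign is introduced. -/
structure FermionPair (V : Type*) [AddCommGroup V] [Module ℂ V] where
  /-- The fermions of the first copy. -/
  left : ℤˣ → ℤ → Module.End ℂ V
  /-- The fermions of the second copy. -/
  right : ℤˣ → ℤ → Module.End ℂ V
  /-- The modes of the total current. -/
  total : ℕ+ → Module.End ℂ V
  left_right : ∀ s t m n x, left s m (right t n x) = right t n (left s m x)
  left_anticomm : ∀ s m n x, left s m (left s n x) = -left s n (left s m x)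
  right_anticomm : ∀ s m n x, right s m (right s n x) = -right s n (right s m x)
  left_neg_anticomm : ∀ s m n x,
    left s m (left (-s) n x) + left (-s) n (left s m x) = if m + n = -1 then x else 0
  right_neg_anticomm : ∀ s m n x,
    right s m (right (-s) n x) + right (-s) n (right s m x) = if m + n = -1 then x else 0
  exists_eq_zero : ∀ x, ∃ B : ℤ, ∀ s n, B ≤ n → left s n x = 0 ∧ right s n x = 0
  total_comm : ∀ k l x, total k (total l x) = total l (total k x)
  total_left : ∀ k s n x,
    total k (left s n x) = left s n (total k x) - ((s : ℤ) : ℂ) • left s (n - k) x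
  total_right : ∀ k s n x,
    total k (right s n x) = right s n (total k x) - ((s : ℤ) : ℂ) • right s (n - k) x

theorem finite_support_of_bounds {M : Type*} [Zero M] {f : ℤ → M} {A B : ℤ}
    (hA : ∀ m, m < A → f m = 0) (hB : ∀ m, B ≤ m → f m = 0) : f.HasFiniteSupport := by
  refine (Set.finite_Icc A B).subset fun m hm => ⟨?_, ?_⟩
  · by_contra h
    exact hm (hA m (by omega))
  · by_contra h
    exact hm (hB m (by omega))

namespace FermionPair

variable {V : Type*} [AddCommGroup V] [Module ℂ V]

theorem map_finsum_end (f : Module.End ℂ V) {g : ℤ → V} (hg : g.HasFiniteSupport) :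
    f (∑ᶠ m, g m) = ∑ᶠ m, f (g m) := f.toAddMonoidHom.map_finsum hg

theorem finite_support_map (f : Module.End ℂ V) {g : ℤ → V} (hg : g.HasFiniteSupport) :
    (fun m => f (g m)).HasFiniteSupport := by
  refine hg.subset fun m hm h => hm ?_
  simp only [h, map_zero]

variable (P : FermionPair V)

/-- The same fermions with the two copies interchanged. -/
def swap : FermionPair V where
  left := P.right
  right := P.left
  total := P.total
  left_right s t m n x := (P.left_right t s n m x).symm
  left_anticomm := P.right_anticomm
  right_anticomm := P.left_anticomm
  left_neg_anticomm := P.right_neg_anticomm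
  right_neg_anticomm := P.left_neg_anticomm
  exists_eq_zero x := by
    obtain ⟨B, hB⟩ := P.exists_eq_zero x
    exact ⟨B, fun s n h => (hB s n h).symm⟩
  total_comm := P.total_comm
  total_left := P.total_right
  total_right := P.total_left

theorem left_neg_anticomm' (s : ℤˣ) {m n : ℤ} (h : m + n ≠ -1) (x : V) :
    P.left s m (P.left (-s) n x) = -P.left (-s) n (P.left s m x) := by
  rw [eq_neg_iff_add_eq_zero, left_neg_anticomm, if_neg h]

theorem finite_left_right (s t : ℤˣ) (p q : ℤ) (x : V) :
    (fun m : ℤ => P.left s (m + p) (P.right t (q - m) x)).HasFiniteSupport := by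
  obtain ⟨B, hB⟩ := P.exists_eq_zero x
  refine finite_support_of_bounds (A := q - B) (B := B - p) (fun m hm => ?_) fun m hm => ?_
  · rw [(hB t (q - m) (by omega)).2, map_zero]
  · rw [left_right, (hB s (m + p) (by omega)).1, map_zero]

theorem finite_left_right' (s t : ℤˣ) (q : ℤ) (x : V) :
    (fun m : ℤ => P.left s m (P.right t (q - m) x)).HasFiniteSupport := by
  simpa using P.finite_left_right s t 0 q x

theorem finite_left_left (s : ℤˣ) {p q : ℤ} (h : p + q ≠ -1) (x : V) :
    (fun m : ℤ => P.left s (m + p) (P.left (-s) (q - m) x)).HasFiniteSupport := by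
  obtain ⟨B, hB⟩ := P.exists_eq_zero x
  refine finite_support_of_bounds (A := q - B) (B := B - p) (fun m hm => ?_) fun m hm => ?_
  · rw [(hB (-s) (q - m) (by omega)).1, map_zero]
  · rw [P.left_neg_anticomm' s (by omega), (hB s (m + p) (by omega)).1, map_zero, neg_zero]

/-- The operator `∑_m ψ_m ⊗ ψ*_{-k-1-m}` for `s = 1`, and `∑_m ψ*_m ⊗ ψ_{-k-1-m}` for `s = -1`. -/
def halfCurrent (s : ℤˣ) (k : ℕ+) : Module.End ℂ V where
  toFun x := ∑ᶠ m : ℤ, P.left s m (P.right (-s) (-k - 1 - m) x)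
  map_add' x y := by
    simp only [map_add]
    exact finsum_add_distrib (P.finite_left_right' _ _ _ _) (P.finite_left_right' _ _ _ _)
  map_smul' c x := by
    simp only [map_smul, RingHom.id_apply]
    rw [smul_finsum' c (P.finite_left_right' _ _ _ _)]

theorem halfCurrent_apply (s : ℤˣ) (k : ℕ+) (x : V) :
    P.halfCurrent s k x = ∑ᶠ m : ℤ, P.left s m (P.right (-s) (-k - 1 - m) x) := rfl

/-- The modes of the current `ψ ⊗ ψ* + ψ* ⊗ ψ`, which mixes the two copies. -/
def current (k : ℕ+) : Module.End ℂ V := P.halfCurrent 1 k + P.halfCurrent (-1) k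

theorem current_eq (s : ℤˣ) (k : ℕ+) : P.current k = P.halfCurrent s k + P.halfCurrent (-s) k := by
  rcases Int.units_eq_one_or s with rfl | rfl
  · rfl
  · rw [current, neg_neg, add_comm]

theorem halfCurrent_swap (s : ℤˣ) (k : ℕ+) : P.swap.halfCurrent s k = P.halfCurrent (-s) k := by
  ext x
  rw [halfCurrent_apply, halfCurrent_apply, ← finsum_comp_equiv (Equiv.subLeft (-(k : ℤ) - 1))]
  refine finsum_congr fun m => ?_
  simp only [Equiv.subLeft_apply, sub_sub_cancel, swap, neg_neg]
  rw [left_right]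

theorem current_swap (k : ℕ+) : P.swap.current k = P.current k := by
  rw [current, halfCurrent_swap, halfCurrent_swap, neg_neg, current, add_comm]

theorem halfCurrent_left_self (s : ℤˣ) (k : ℕ+) (n : ℤ) (x : V) :
    P.halfCurrent s k (P.left s n x) = -P.left s n (P.halfCurrent s k x) := by
  rw [halfCurrent_apply, halfCurrent_apply, map_finsum_end _ (P.finite_left_right' _ _ _ _),
    ← finsum_neg_distrib]
  refine finsum_congr fun m => ?_
  rw [← left_right, left_anticomm]

theorem halfCurrent_neg_left (s : ℤˣ) (k : ℕ+) (n : ℤ) (x : V) :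
    P.halfCurrent (-s) k (P.left s n x) =
      P.right s (n - k) x - P.left s n (P.halfCurrent (-s) k x) := by
  rw [eq_sub_iff_add_eq, halfCurrent_apply, halfCurrent_apply,
    map_finsum_end _ (P.finite_left_right' _ _ _ _),
    ← finsum_add_distrib (P.finite_left_right' _ _ _ _), neg_neg, finsum_eq_single _ (-1 - n)]
  · have := P.left_neg_anticomm s n (-1 - n) (P.right s (-k - 1 - (-1 - n)) x)
    rw [if_pos (by ring)] at this
    rw [← left_right, add_comm, this]
    congr 2; ring
  · intro m hm
    have := P.left_neg_anticomm s n m (P.right s (-k - 1 - m) x)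
    rw [if_neg (by omega)] at this
    rw [← left_right, add_comm, this]
  · exact finite_support_map _ (P.finite_left_right' (-s) (- -s) (-k - 1) x)

/-- The mixing current interchanges the two copies; it anticommutes with the fermions up to this, as
each of its terms has one fermion of either copy. -/
theorem current_left (s : ℤˣ) (k : ℕ+) (n : ℤ) (x : V) :
    P.current k (P.left s n x) = P.right s (n - k) x - P.left s n (P.current k x) := by
  rw [P.current_eq s, LinearMap.add_apply, LinearMap.add_apply, halfCurrent_left_self,
    halfCurrent_neg_left, map_add]
  abel

theorem current_right (s : ℤˣ) (k : ℕ+) (n : ℤ) (x : V) :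
    P.current k (P.right s n x) = P.left s (n - k) x - P.right s n (P.current k x) := by
  rw [← current_swap]
  exact P.swap.current_left s k n x

theorem finsum_left_left_cancel (k l : ℕ+) (s : ℤˣ) (x : V) :
    ∑ᶠ m : ℤ, P.left s (m + (-k)) (P.left (-s) (-l - 1 - m) x) +
      ∑ᶠ m : ℤ, P.left (-s) (m + (-k)) (P.left s (-l - 1 - m) x) = 0 := by
  rw [← finsum_comp_equiv (Equiv.subLeft ((k : ℤ) - l - 1)), add_eq_zero_iff_eq_neg,
    ← finsum_neg_distrib]
  refine finsum_congr fun m => ?_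
  have h1 := k.pos
  have h2 := l.pos
  simp only [Equiv.subLeft_apply]
  rw [P.left_neg_anticomm' s (by omega)]
  congr 3 <;> ring_nf

theorem finsum_left_left_cancel' (k l : ℕ+) (s : ℤˣ) (x : V) :
    ∑ᶠ m : ℤ, P.left s (m + 0) (P.left (-s) (-l - 1 - k - m) x) +
      ∑ᶠ m : ℤ, P.left (-s) (m + 0) (P.left s (-l - 1 - k - m) x) = 0 := by
  rw [← finsum_comp_equiv (Equiv.subLeft (-(k : ℤ) - l - 1)), add_eq_zero_iff_eq_neg,
    ← finsum_neg_distrib]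
  refine finsum_congr fun m => ?_
  have h1 := k.pos
  have h2 := l.pos
  simp only [Equiv.subLeft_apply]
  rw [P.left_neg_anticomm' s (by omega)]
  congr 3 <;> ring_nf

theorem current_halfCurrent (s : ℤˣ) (k l : ℕ+) (x : V) :
    P.current k (P.halfCurrent s l x) =
      ∑ᶠ m : ℤ, P.right s (m + (-k)) (P.right (-s) (-l - 1 - m) x) -
      ∑ᶠ m : ℤ, P.left s (m + 0) (P.left (-s) (-l - 1 - k - m) x) +
      P.halfCurrent s l (P.current k x) := by
  have h1 := k.pos
  have h2 := l.pos
  have h3 : (fun m : ℤ => P.right s (m + (-k)) (P.right (-s) (-l - 1 - m) x)).HasFiniteSupport :=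
    P.swap.finite_left_left s (by omega) x
  have h4 := P.finite_left_left s (p := 0) (q := -l - 1 - k) (by omega) x
  have h5 : (fun m : ℤ => P.right s (m + (-k)) (P.right (-s) (-l - 1 - m) x) -
    P.left s (m + 0) (P.left (-s) (-l - 1 - k - m) x)).HasFiniteSupport := h3.sub h4
  rw [halfCurrent_apply, map_finsum_end _ (P.finite_left_right' _ _ _ _), halfCurrent_apply,
    ← finsum_sub_distrib h3 h4,
    ← finsum_add_distrib h5 (P.finite_left_right' _ _ _ _)]
  refine finsum_congr fun m => ?_
  rw [current_left, current_right, map_sub, ← sub_add, add_zero, ← sub_eq_add_neg]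
  congr 3
  congr 1
  ring_nf

theorem current_comm (k l : ℕ+) (x : V) :
    P.current k (P.current l x) = P.current l (P.current k x) := by
  have h1 := P.finsum_left_left_cancel' k l 1 x
  have h2 := P.swap.finsum_left_left_cancel k l 1 x
  change ∑ᶠ m : ℤ, P.right 1 (m + (-k)) (P.right (-1) (-l - 1 - m) x) +
    ∑ᶠ m : ℤ, P.right (-1) (m + (-k)) (P.right 1 (-l - 1 - m) x) = 0 at h2
  rw [P.current_eq 1 l, LinearMap.add_apply, map_add, current_halfCurrent, current_halfCurrent,
    LinearMap.add_apply, neg_neg, eq_neg_of_add_eq_zero_left h1, eq_neg_of_add_eq_zero_left h2]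
  abel

theorem total_halfCurrent (s : ℤˣ) (k l : ℕ+) (x : V) :
    P.total k (P.halfCurrent s l x) = P.halfCurrent s l (P.total k x) := by
  have h3 := (P.finite_left_right' s (-s) (-l - 1 - k) x)
  have h4 := (P.finite_left_right s (-s) (-k) (-l - 1) x)
  have h5 : ∑ᶠ m : ℤ, P.left s (m + (-k)) (P.right (-s) (-l - 1 - m) x) =
      ∑ᶠ m : ℤ, P.left s m (P.right (-s) (-l - 1 - k - m) x) := by
    rw [← finsum_comp_equiv (Equiv.addRight (k : ℤ))]
    refine finsum_congr fun m => ?_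
    simp only [Equiv.coe_addRight]
    rw [add_neg_cancel_right, show -(l : ℤ) - 1 - (m + k) = -l - 1 - k - m by ring]
  have h6 : (fun m : ℤ => P.left s m (P.right (-s) (-l - 1 - k - m) x) -
    P.left s (m + (-k)) (P.right (-s) (-l - 1 - m) x)).HasFiniteSupport := h3.sub h4
  have h7 : (fun m : ℤ => ((s : ℤ) : ℂ) • (P.left s m (P.right (-s) (-l - 1 - k - m) x) -
      P.left s (m + (-k)) (P.right (-s) (-l - 1 - m) x))).HasFiniteSupport :=
    finite_support_map (LinearMap.lsmul ℂ V ((s : ℤ) : ℂ)) h6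
  symm
  rw [halfCurrent_apply, halfCurrent_apply, map_finsum_end _ (P.finite_left_right' _ _ _ _),
    ← add_zero (finsum _), ← smul_zero ((s : ℤ) : ℂ), ← sub_eq_zero.mpr h5.symm,
    ← finsum_sub_distrib h3 h4, smul_finsum' _ h6,
    ← finsum_add_distrib (P.finite_left_right' _ _ _ _) h7]
  refine finsum_congr fun m => ?_
  rw [total_left, total_right, map_sub, map_smul, Units.val_neg, Int.cast_neg, neg_smul,
    sub_neg_eq_add, smul_sub, show -(l : ℤ) - 1 - k - m = -l - 1 - m - k by ring, sub_eq_add_neg m]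
  abel

theorem total_current (k l : ℕ+) (x : V) :
    P.total k (P.current l x) = P.current l (P.total k x) := by
  rw [current, LinearMap.add_apply, map_add, total_halfCurrent, total_halfCurrent,
    LinearMap.add_apply]

/-! ### The combinations that the mixing current diagonalizes -/

/-- The operators `½ (t h_k + κ K_k)`, with `h` the total and `K` the mixing current, where `t = 1`
on the first and `t = -1` on the second family of times. -/
def mixed (κ : ℤˣ) : ℕ+ ⊕ ℕ+ → Module.End ℂ V :=
  Sum.elim (fun k => (2⁻¹ : ℂ) • (P.total k + ((κ : ℤ) : ℂ) • P.current k))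
    (fun k => (2⁻¹ : ℂ) • (-P.total k + ((κ : ℤ) : ℂ) • P.current k))

theorem mixed_comm (κ : ℤˣ) (i j : ℕ+ ⊕ ℕ+) (x : V) :
    P.mixed κ i (P.mixed κ j x) = P.mixed κ j (P.mixed κ i x) := by
  rcases i with k | k <;> rcases j with l | l <;>
  · simp only [mixed, Sum.elim_inl, Sum.elim_inr, LinearMap.smul_apply, LinearMap.add_apply,
      LinearMap.neg_apply, map_add, map_smul, map_neg, total_current, P.total_comm k l,
      P.current_comm k l]
    module

/-- The sum of the fermions of the two copies. -/
def sum (s : ℤˣ) (n : ℤ) : Module.End ℂ V := P.left s n + P.right s n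

/-- The difference of the fermions of the two copies. -/
def diff (s : ℤˣ) (n : ℤ) : Module.End ℂ V := P.left s n - P.right s n

theorem total_sum (s : ℤˣ) (k : ℕ+) (n : ℤ) (x : V) :
    P.total k (P.sum s n x) = P.sum s n (P.total k x) - ((s : ℤ) : ℂ) • P.sum s (n - k) x := by
  simp only [sum, LinearMap.add_apply, map_add, total_left, total_right]
  module

theorem current_sum (s : ℤˣ) (k : ℕ+) (n : ℤ) (x : V) :
    P.current k (P.sum s n x) = P.sum s (n - k) x - P.sum s n (P.current k x) := by
  simp only [sum, LinearMap.add_apply, map_add, current_left, current_right]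
  module

theorem sum_diff (s : ℤˣ) (m n : ℤ) (x : V) :
    P.sum s m (P.diff s n x) = -P.sum s n (P.diff s m x) := by
  simp only [sum, diff, LinearMap.add_apply, LinearMap.sub_apply, map_sub, left_right]
  rw [P.left_anticomm s m n, P.right_anticomm s m n]
  abel

theorem exists_sum_eq_zero (x : V) : ∃ B : ℤ, ∀ s n, B ≤ n → P.sum s n x = 0 := by
  obtain ⟨B, hB⟩ := P.exists_eq_zero x
  refine ⟨B, fun s n h => ?_⟩
  rw [sum, LinearMap.add_apply, (hB s n h).1, (hB s n h).2, add_zero]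

/-- The vector of charges of the fermion `s` with respect to the currents `mixed`. -/
def chargeVec (κ s : ℤˣ) : ℕ+ ⊕ ℕ+ → ℂ :=
  Sum.elim (fun _ => 2⁻¹ * (((s : ℤ) : ℂ) - ((κ : ℤ) : ℂ)))
    (fun _ => 2⁻¹ * (-((s : ℤ) : ℂ) - ((κ : ℤ) : ℂ)))

/-- Moving a current through a fermion changes the sign `κ`. The charge vanishes on the second family
of times for `κ = -s`, and on the first for `κ = s`. -/
theorem mixed_sum (κ s : ℤˣ) (i : ℕ+ ⊕ ℕ+) (n : ℤ) (x : V) :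
    P.mixed κ i (P.sum s n x) =
      P.sum s n (P.mixed (-κ) i x) - chargeVec κ s i • P.sum s (n - deg i) x := by
  rcases i with k | k <;>
  · simp only [mixed, chargeVec, Sum.elim_inl, Sum.elim_inr, LinearMap.smul_apply,
      LinearMap.add_apply, LinearMap.neg_apply, map_add, map_smul, map_neg, total_sum, current_sum,
      Units.val_neg, Int.cast_neg, deg_inl, deg_inr, deg_pnat]
    module

end FermionPair

/-! ### Polynomials in commuting operators -/

open scoped IsMulCommutative in
/-- The value of polynomials on a family of commuting elements of an algebra. -/
def commEval {ι R A : Type*} [CommRing R] [Ring A] [Algebra R A] (a : ι → A)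
    (h : ∀ i j, a i * a j = a j * a i) : MvPolynomial ι R →ₐ[R] A :=
  have : IsMulCommutative (Algebra.adjoin R (Set.range a)) :=
    Algebra.isMulCommutative_adjoin R (by rintro _ ⟨i, rfl⟩ _ ⟨j, rfl⟩; exact h i j)
  (Algebra.adjoin R (Set.range a)).val.comp
    (MvPolynomial.aeval fun i =>
      (⟨a i, Algebra.subset_adjoin ⟨i, rfl⟩⟩ : Algebra.adjoin R (Set.range a)))

@[simp] theorem commEval_X {ι R A : Type*} [CommRing R] [Ring A] [Algebra R A] (a : ι → A)
    (h : ∀ i j, a i * a j = a j * a i) (i : ι) :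
    commEval (R := R) a h (MvPolynomial.X i) = a i := by
  simp [commEval]

namespace FermionPair

variable {V : Type*} [AddCommGroup V] [Module ℂ V] (P : FermionPair V)

/-- The action of polynomials in two families of times through the currents `mixed`. -/
def act (κ : ℤˣ) : MvPolynomial (ℕ+ ⊕ ℕ+) ℂ →ₐ[ℂ] Module.End ℂ V :=
  commEval (P.mixed κ) fun i j => LinearMap.ext fun x => P.mixed_comm κ i j x

@[simp] theorem act_X (κ : ℤˣ) (i : ℕ+ ⊕ ℕ+) : P.act κ (MvPolynomial.X i) = P.mixed κ i := by
  simp [act]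

/-- The sum `∑_j act κ p_j (sum s (n - j) x)`, for a polynomial `∑_j p_j z ^ j`. -/
def actSum (κ s : ℤˣ) (n : ℤ) (x : V) : Polynomial (MvPolynomial (ℕ+ ⊕ ℕ+) ℂ) →ₗ[ℂ] V :=
  Polynomial.lsum fun j => (LinearMap.applyₗ (P.sum s (n - j) x)) ∘ₗ (P.act κ).toLinearMap

theorem actSum_monomial (κ s : ℤˣ) (n : ℤ) (x : V) (j : ℕ) (p : MvPolynomial (ℕ+ ⊕ ℕ+) ℂ) :
    P.actSum κ s n x (Polynomial.monomial j p) = P.act κ p (P.sum s (n - j) x) := by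
  simp [actSum, Polynomial.sum_monomial_index]

theorem actSum_mixed (κ s : ℤˣ) (n : ℤ) (x : V) (i : ℕ+ ⊕ ℕ+)
    (F : Polynomial (MvPolynomial (ℕ+ ⊕ ℕ+) ℂ)) :
    P.actSum κ s n (P.mixed (-κ) i x) F =
      P.actSum κ s n x (F * shift (chargeVec κ s) (MvPolynomial.X i)) := by
  induction F using Polynomial.induction_on' with
  | add p q hp hq => rw [add_mul, map_add, map_add, hp, hq]
  | monomial j a =>
    rw [shift, MvPolynomial.aeval_X, mul_add, map_add, mul_smul_comm, map_smul,
      Polynomial.monomial_mul_X_pow, Polynomial.monomial_mul_C, actSum_monomial, actSum_monomial,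
      actSum_monomial, map_mul, act_X, Module.End.mul_apply, mixed_sum, map_sub, map_smul,
      Nat.cast_add, sub_add_eq_sub_sub]
    abel

theorem sum_act_eq_actSum (κ s : ℤˣ) (n : ℤ) (x : V) (u : MvPolynomial (ℕ+ ⊕ ℕ+) ℂ) :
    P.sum s n (P.act (-κ) u x) = P.actSum κ s n x (shift (chargeVec κ s) u) := by
  induction u using MvPolynomial.induction_on generalizing x with
  | C a =>
    have h : shift (chargeVec κ s) (MvPolynomial.C a) =
        Polynomial.monomial 0 (MvPolynomial.C a) := by
      rw [← MvPolynomial.algebraMap_eq, AlgHom.commutes]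
      rfl
    rw [h, actSum_monomial, ← MvPolynomial.algebraMap_eq, AlgHom.commutes, AlgHom.commutes]
    simp [Module.algebraMap_end_apply]
  | add p q hp hq => rw [map_add, map_add, map_add, LinearMap.add_apply, map_add, hp, hq]
  | mul_X p i hp => rw [map_mul, map_mul, act_X, Module.End.mul_apply, hp, actSum_mixed]

theorem actSum_eq {κ s : ℤˣ} {A : ℤ} {w g : V}
    (h : ∀ m, P.sum s m w = P.act κ (creCoeff (chargeVec κ s) (A - m)) g) (n : ℤ)
    (F : Polynomial (MvPolynomial (ℕ+ ⊕ ℕ+) ℂ)) :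
    P.actSum κ s n w F = P.act κ (creMul (chargeVec κ s) (n - A) F) g := by
  induction F using Polynomial.induction_on' with
  | add p q hp hq => rw [map_add, map_add, map_add, LinearMap.add_apply, hp, hq]
  | monomial j a =>
    rw [actSum_monomial, creMul_monomial, h, mul_comm, map_mul, Module.End.mul_apply,
      show (j : ℤ) - (n - A) = A - (n - j) by ring]

/-- A vector on which the fermions `sum s` act as on a vacuum, with `sum s A` the last mode that
does not annihilate it. -/
structure IsVacuumLike (s : ℤˣ) (A : ℤ) (w : V) : Prop where
  /-- All modes beyond `A` annihilate the vector. -/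
  sum_eq_zero : ∀ n, A < n → P.sum s n w = 0
  diff_eq_zero : ∀ n, -2 - A < n → P.diff (-s) n w = 0
  /-- The currents are bilinear in the differences of the fermions, as for a vacuum. -/
  current_eq : ∀ (i : ℕ) (k : ℕ+), k < i → ((s : ℤ) : ℂ) • P.total k w + P.current k w =
    -∑ r ∈ Finset.range i, P.diff s (A - r) (P.diff (-s) (-k - 1 - (A - r)) w)

variable {P}

theorem act_form_chargeVec (κ s : ℤˣ) (k : ℕ+) :
    P.act κ (form (chargeVec κ s) k) =
      (2⁻¹ : ℂ) • (((s : ℤ) : ℂ) • P.total k - P.current k) := by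
  rw [form, sum_fiber_sum, fiber_pnat]
  simp only [Finset.sum_singleton, map_add, map_smul, act_X, mixed, Sum.elim_inl, Sum.elim_inr,
    chargeVec]
  have h := units_mul_self_complex κ
  match_scalars
  · ring
  · linear_combination (-2⁻¹ : ℂ) * h

theorem act_form_sum (κ s : ℤˣ) (k : ℕ+) (m : ℤ) (w : V) :
    P.act κ (form (chargeVec κ s) k) (P.sum s m w) =
      (2⁻¹ : ℂ) • P.sum s m (((s : ℤ) : ℂ) • P.total k w + P.current k w) - P.sum s (m - k) w := by
  rw [act_form_chargeVec]
  simp only [LinearMap.smul_apply, LinearMap.sub_apply, total_sum, current_sum, map_add, map_smul]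
  have h := units_mul_self_complex s
  match_scalars
  · ring
  · linear_combination (-2⁻¹ : ℂ) * h
  · ring

/-- The terms cancel in pairs since the product of two fermions is antisymmetric in the modes. -/
theorem sum_sum_diff_diff (s : ℤˣ) (A c : ℤ) (I : ℕ) (w : V) :
    ∑ p ∈ Finset.range I, ∑ r ∈ Finset.range I,
      P.sum s (A - p) (P.diff s (A - r) (P.diff (-s) (c + p + r) w)) = 0 := by
  set S := ∑ p ∈ Finset.range I, ∑ r ∈ Finset.range I,
      P.sum s (A - p) (P.diff s (A - r) (P.diff (-s) (c + p + r) w)) with hS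
  have h : S = -S := by
    nth_rewrite 1 [hS]
    rw [Finset.sum_comm, hS, ← Finset.sum_neg_distrib]
    refine Finset.sum_congr rfl fun p _ => ?_
    rw [← Finset.sum_neg_distrib]
    refine Finset.sum_congr rfl fun r _ => ?_
    rw [sum_diff, add_right_comm c]
  have h2 : (2 : ℂ) • S = 0 := by
    rw [two_smul]
    nth_rewrite 1 [h]
    exact neg_add_cancel S
  exact (smul_eq_zero.mp h2).resolve_left two_ne_zero

/-- The term of the recursion for `sum s m w` that is not a shift of the mode cancels. -/
theorem IsVacuumLike.sum_current {s : ℤˣ} {A : ℤ} {w : V} (h : P.IsVacuumLike s A w) (I : ℕ) :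
    ∑ k ∈ Finset.range I, P.sum s (A + 1 + k - I) (((s : ℤ) : ℂ) • P.total k.succPNat w +
      P.current k.succPNat w) = 0 := by
  -- The mode `p = I` is added for the antisymmetry; it contributes nothing.
  have h1 := P.sum_sum_diff_diff s A (-1 - A - I) (I + 1) w
  rw [Finset.sum_range_succ] at h1
  have h2 : ∑ r ∈ Finset.range (I + 1),
      P.sum s (A - I) (P.diff s (A - r) (P.diff (-s) (-1 - A - I + I + r) w)) = 0 := by
    refine Finset.sum_eq_zero fun r _ => ?_
    rw [h.diff_eq_zero _ (by omega), map_zero, map_zero]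
  rw [h2, add_zero, ← Finset.sum_range_reflect] at h1
  rw [← neg_eq_zero, ← h1, ← Finset.sum_neg_distrib]
  refine Finset.sum_congr rfl fun k hk => ?_
  have hk := Finset.mem_range.mp hk
  rw [h.current_eq (I + 1) k.succPNat (by rw [Nat.succPNat_coe]; omega), map_neg, neg_neg, map_sum]
  refine Finset.sum_congr rfl fun r _ => ?_
  rw [Nat.succPNat_coe, show A - ((I - 1 - k : ℕ) : ℤ) = A + 1 + k - I by omega,
    show -((k.succ : ℕ) : ℤ) - 1 - (A - r) = -1 - A - I + ((I - 1 - k : ℕ) : ℤ) + r by omega]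

/-- Both sides satisfy the recursion `creCoeff_succ`. -/
theorem IsVacuumLike.sum_eq_act {s : ℤˣ} {A : ℤ} {w : V} (h : P.IsVacuumLike s A w) (κ : ℤˣ)
    (m : ℤ) : P.sum s m w = P.act κ (creCoeff (chargeVec κ s) (A - m)) (P.sum s A w) := by
  by_cases hm : A < m
  · rw [h.sum_eq_zero m hm, creCoeff_of_neg _ (by omega), map_zero, LinearMap.zero_apply]
  obtain ⟨i, hi⟩ := Int.eq_ofNat_of_zero_le (show 0 ≤ A - m by omega)
  obtain rfl : m = A - i := by omega
  clear hm hi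
  induction i using Nat.strong_induction_on with
  | _ i ih =>
    rcases i with _ | i
    · simp
    have h1 := congrArg (fun u => P.act κ u (P.sum s A w)) (creCoeff_succ (chargeVec κ s) i)
    have h2 : ∀ k ∈ Finset.range (i + 1), P.act κ (form (chargeVec κ s) (k + 1) *
        creCoeff (chargeVec κ s) (i - k)) (P.sum s A w) =
        (2⁻¹ : ℂ) • P.sum s (A + 1 + k - (i + 1 : ℕ)) (((s : ℤ) : ℂ) • P.total k.succPNat w +
          P.current k.succPNat w) - P.sum s (A - (i + 1 : ℕ)) w := by
      intro k hk
      have hk := Finset.mem_range.mp hk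
      have h3 := ih (i - k) (by omega)
      rw [show A - (A - ((i - k : ℕ) : ℤ)) = i - k by omega] at h3
      have h4 := P.act_form_sum κ s k.succPNat (A - (i - k : ℕ)) w
      rw [Nat.succPNat_coe] at h4
      rw [map_mul, Module.End.mul_apply, ← h3, ← Nat.succ_eq_add_one k, h4,
        show A - ((i - k : ℕ) : ℤ) - (k.succ : ℕ) = A - (i + 1 : ℕ) by omega,
        show A - ((i - k : ℕ) : ℤ) = A + 1 + k - (i + 1 : ℕ) by omega]
    simp only [map_smul, map_neg, map_sum, LinearMap.smul_apply, LinearMap.neg_apply,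
      LinearMap.sum_apply] at h1
    rw [Finset.sum_congr rfl h2, Finset.sum_sub_distrib, ← Finset.smul_sum, h.sum_current,
      smul_zero, zero_sub, neg_neg, Finset.sum_const, Finset.card_range, ← Nat.cast_smul_eq_nsmul ℂ,
      Nat.cast_succ] at h1
    rw [sub_sub_cancel, Nat.cast_succ]
    exact (smul_right_injective V (Nat.cast_add_one_ne_zero i) h1).symm

/-- The vertex operator formula: on the orbit of a vacuum under the currents, the fermions act
by vertex operators. -/
theorem IsVacuumLike.sum_act {s : ℤˣ} {A : ℤ} {w : V} (h : P.IsVacuumLike s A w) (κ : ℤˣ)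
    (n : ℤ) (u : MvPolynomial (ℕ+ ⊕ ℕ+) ℂ) :
    P.sum s n (P.act (-κ) u w) = P.act κ (vertex (chargeVec κ s) (n - A) u) (P.sum s A w) := by
  rw [sum_act_eq_actSum, actSum_eq P (h.sum_eq_act κ), vertex_apply]

end FermionPair

/-! ### The square of the Fock space -/

section Square

open TensorProduct

theorem rTensor_add_apply_eq_zero (f g : Fock →ₗ[ℂ] Fock) (h : ∀ x, f x + g x = 0)
    (x : Fock ⊗[ℂ] Fock) : f.rTensor Fock x + g.rTensor Fock x = 0 := by
  rw [← LinearMap.add_apply, ← LinearMap.rTensor_add, show f + g = 0 from LinearMap.ext h,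
    LinearMap.rTensor_zero, LinearMap.zero_apply]

theorem lTensor_add_apply_eq_zero (f g : Fock →ₗ[ℂ] Fock) (h : ∀ x, f x + g x = 0)
    (x : Fock ⊗[ℂ] Fock) : f.lTensor Fock x + g.lTensor Fock x = 0 := by
  rw [← LinearMap.add_apply, ← LinearMap.lTensor_add, show f + g = 0 from LinearMap.ext h,
    LinearMap.lTensor_zero, LinearMap.zero_apply]

theorem rTensor_lTensor_comm (f g : Fock →ₗ[ℂ] Fock) (x : Fock ⊗[ℂ] Fock) :
    f.rTensor Fock (g.lTensor Fock x) = g.lTensor Fock (f.rTensor Fock x) := by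
  rw [← LinearMap.comp_apply, ← LinearMap.comp_apply, LinearMap.rTensor_comp_lTensor,
    LinearMap.lTensor_comp_rTensor]

/-- The fermions of the two factors of the square of the Fock space, without a sign, so that they
commute. -/
def tensorPair : FermionPair (Fock ⊗[ℂ] Fock) where
  left s n := (psi s n).rTensor Fock
  right s n := (psi s n).lTensor Fock
  total k := (boson k).rTensor Fock + (boson k).lTensor Fock
  left_right s t m n x := rTensor_lTensor_comm _ _ x
  left_anticomm s m n x := by
    rw [← LinearMap.comp_apply, ← LinearMap.comp_apply, ← LinearMap.rTensor_comp,
      ← LinearMap.rTensor_comp]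
    refine eq_neg_of_add_eq_zero_left (rTensor_add_apply_eq_zero _ _ (fun y => ?_) x)
    rw [LinearMap.comp_apply, psi_anticomm, LinearMap.comp_apply, neg_add_cancel]
  right_anticomm s m n x := by
    rw [← LinearMap.comp_apply, ← LinearMap.comp_apply, ← LinearMap.lTensor_comp,
      ← LinearMap.lTensor_comp]
    refine eq_neg_of_add_eq_zero_left (lTensor_add_apply_eq_zero _ _ (fun y => ?_) x)
    rw [LinearMap.comp_apply, psi_anticomm, LinearMap.comp_apply, neg_add_cancel]
  left_neg_anticomm s m n x := by
    induction x using TensorProduct.induction_on with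
    | zero => simp
    | tmul x y =>
      simp only [LinearMap.rTensor_tmul]
      rw [← add_tmul, psi_neg_anticomm]
      split_ifs <;> simp
    | add x y hx hy =>
      simp only [map_add]
      rw [add_add_add_comm, hx, hy]
      split_ifs <;> simp
  right_neg_anticomm s m n x := by
    induction x using TensorProduct.induction_on with
    | zero => simp
    | tmul x y =>
      simp only [LinearMap.lTensor_tmul]
      rw [← tmul_add, psi_neg_anticomm]
      split_ifs <;> simp
    | add x y hx hy =>
      simp only [map_add]
      rw [add_add_add_comm, hx, hy]
      split_ifs <;> simp
  exists_eq_zero x := by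
    induction x using TensorProduct.induction_on with
    | zero => exact ⟨0, fun s n _ => ⟨map_zero _, map_zero _⟩⟩
    | tmul x y =>
      obtain ⟨A, hA⟩ := exists_psi_eq_zero x
      obtain ⟨B, hB⟩ := exists_psi_eq_zero y
      refine ⟨max A B, fun s n hn => ⟨?_, ?_⟩⟩
      · rw [LinearMap.rTensor_tmul, hA s n (by omega), zero_tmul]
      · rw [LinearMap.lTensor_tmul, hB s n (by omega), tmul_zero]
    | add x y hx hy =>
      obtain ⟨A, hA⟩ := hx
      obtain ⟨B, hB⟩ := hy
      refine ⟨max A B, fun s n hn => ⟨?_, ?_⟩⟩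
      · rw [map_add, (hA s n (by omega)).1, (hB s n (by omega)).1, add_zero]
      · rw [map_add, (hA s n (by omega)).2, (hB s n (by omega)).2, add_zero]
  total_comm k l x := by
    induction x using TensorProduct.induction_on with
    | zero => simp
    | tmul x y =>
      simp only [LinearMap.add_apply, LinearMap.rTensor_tmul, LinearMap.lTensor_tmul, map_add,
        boson_comm k l]
      abel
    | add x y hx hy => simp only [map_add, hx, hy]
  total_left k s n x := by
    induction x using TensorProduct.induction_on with
    | zero => simp
    | tmul x y =>
      simp only [LinearMap.add_apply, LinearMap.rTensor_tmul, LinearMap.lTensor_tmul, map_add,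
        boson_psi, sub_tmul, smul_tmul']
      abel
    | add x y hx hy => simp only [map_add, hx, hy, smul_add]; abel
  total_right k s n x := by
    induction x using TensorProduct.induction_on with
    | zero => simp
    | tmul x y =>
      simp only [LinearMap.add_apply, LinearMap.rTensor_tmul, LinearMap.lTensor_tmul, map_add,
        boson_psi, tmul_sub, tmul_smul]
      abel
    | add x y hx hy => simp only [map_add, hx, hy, smul_add]; abel

/-- The square of the Fock space, as a type of its own, so that its elements are not taken apart as
tensors. -/
def Fock2 : Type := Fock ⊗[ℂ] Fock

instance : AddCommGroup Fock2 := inferInstanceAs (AddCommGroup (Fock ⊗[ℂ] Fock))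
instance : Module ℂ Fock2 := inferInstanceAs (Module ℂ (Fock ⊗[ℂ] Fock))

/-- The product of two vectors in the square of the Fock space. -/
def tm : Fock →ₗ[ℂ] Fock →ₗ[ℂ] Fock2 := TensorProduct.mk ℂ Fock Fock

/-- The fermion pair `tensorPair` on `Fock2`. -/
def fockPair : FermionPair Fock2 := tensorPair

theorem left_tm (s : ℤˣ) (n : ℤ) (x y : Fock) : fockPair.left s n (tm x y) = tm (psi s n x) y := rfl

theorem right_tm (s : ℤˣ) (n : ℤ) (x y : Fock) : fockPair.right s n (tm x y) = tm x (psi s n y) :=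
  rfl

theorem total_tm (k : ℕ+) (x y : Fock) :
    fockPair.total k (tm x y) = tm (boson k x) y + tm x (boson k y) := rfl

theorem sum_tm (s : ℤˣ) (n : ℤ) (x y : Fock) :
    fockPair.sum s n (tm x y) = tm (psi s n x) y + tm x (psi s n y) := rfl

theorem diff_tm (s : ℤˣ) (n : ℤ) (x y : Fock) :
    fockPair.diff s n (tm x y) = tm (psi s n x) y - tm x (psi s n y) := rfl

/-- The formula `boson_vac` for a window of modes that may be moved by one step: the additional mode
contributes nothing. -/
theorem boson_vac_of_mem (s : ℤˣ) (k : ℕ+) {a A : ℤ} (ha : s * a - 1 = A ∨ s * a - 1 = A - 1)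
    {i : ℕ} (hi : k < i) : ((s : ℤ) : ℂ) • boson k (vac a) =
      -∑ r ∈ Finset.range i, psi s (A - r) (psi (-s) (-k - 1 - (A - r)) (vac a)) := by
  have hk := k.pos
  rcases ha with rfl | ha
  · exact boson_vac s k a hi.le
  · obtain ⟨i, rfl⟩ : ∃ j, i = j + 1 := ⟨i - 1, by omega⟩
    have h0 : psi s (A - (0 : ℕ)) (psi (-s) (-k - 1 - (A - (0 : ℕ))) (vac a)) = 0 := by
      have h1 := psi_neg_anticomm s (A - (0 : ℕ)) (-k - 1 - (A - (0 : ℕ))) (vac a)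
      rw [if_neg (by push_cast; omega), psi_vac_of_lt s (by push_cast; omega), map_zero,
        add_zero] at h1
      exact h1
    rw [Finset.sum_range_succ', h0, add_zero, boson_vac s k a (Nat.lt_succ_iff.mp hi)]
    refine congrArg Neg.neg (Finset.sum_congr rfl fun r _ => ?_)
    rw [ha, show A - ((r + 1 : ℕ) : ℤ) = A - 1 - r by push_cast; ring]

theorem finsum_eq_sum_window {M : Type*} [AddCommMonoid M] (f : ℤ → M) (A : ℤ) (i : ℕ)
    (h : ∀ m, A < m → f m = 0) (h' : ∀ m, m ≤ A - i → f m = 0) :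
    ∑ᶠ m, f m = ∑ r ∈ Finset.range i, f (A - r) := by
  rw [← finsum_comp_equiv (Equiv.subLeft A)]
  have hinj : Function.Injective ((↑) : ℕ → ℤ) := Nat.cast_injective
  rw [finsum_eq_finsetSum_of_support_subset (s := (Finset.range i).map ⟨_, hinj⟩),
    Finset.sum_map]
  · rfl
  · intro m hm
    simp only [Finset.coe_map, Function.Embedding.coeFn_mk, Finset.coe_range, Set.mem_image,
      Set.mem_Iio]
    rw [Function.mem_support, Equiv.subLeft_apply] at hm
    have h1 : 0 ≤ m := by
      by_contra hc
      exact hm (h _ (by omega))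
    have h2 : m < i := by
      by_contra hc
      exact hm (h' _ (by omega))
    exact ⟨m.toNat, by omega, by omega⟩

theorem current_vac (s : ℤˣ) (k : ℕ+) {a b A : ℤ} (ha : s * a - 1 = A ∨ s * a - 1 = A - 1)
    (hb : s * b - 1 = A ∨ s * b - 1 = A - 1) {i : ℕ} (hi : k < i) :
    fockPair.current k (tm (vac a) (vac b)) = ∑ r ∈ Finset.range i,
      (tm (psi s (A - r) (vac a)) (psi (-s) (-k - 1 - (A - r)) (vac b)) +
        tm (psi (-s) (-k - 1 - (A - r)) (vac a)) (psi s (A - r) (vac b))) := by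
  rw [fockPair.current_eq s, LinearMap.add_apply, ← fockPair.halfCurrent_swap,
    FermionPair.halfCurrent_apply, FermionPair.halfCurrent_apply, Finset.sum_add_distrib,
    ← finsum_eq_sum_window (fun m => tm (psi s m (vac a)) (psi (-s) (-k - 1 - m) (vac b))) A i,
    ← finsum_eq_sum_window (fun m => tm (psi (-s) (-k - 1 - m) (vac a)) (psi s m (vac b))) A i]
  · rfl
  · intro m hm
    rw [psi_vac_of_lt s (by omega), map_zero]
  · intro m hm
    rw [psi_vac_of_lt (-s) (by rw [Units.val_neg, neg_mul]; omega), map_zero, LinearMap.zero_apply]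
  · intro m hm
    rw [psi_vac_of_lt s (by omega), map_zero, LinearMap.zero_apply]
  · intro m hm
    rw [psi_vac_of_lt (-s) (by rw [Units.val_neg, neg_mul]; omega), map_zero]

/-- The total current gives the terms `ψ ψ* ⊗ 1` and `1 ⊗ ψ ψ*` of the product of the differences, the
mixing current gives the mixed terms. -/
theorem current_eq_tm_vac (s : ℤˣ) {a b A : ℤ} (ha : s * a - 1 = A ∨ s * a - 1 = A - 1)
    (hb : s * b - 1 = A ∨ s * b - 1 = A - 1) (i : ℕ) (k : ℕ+) (hi : k < i) :
    ((s : ℤ) : ℂ) • fockPair.total k (tm (vac a) (vac b)) +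
      fockPair.current k (tm (vac a) (vac b)) = -∑ r ∈ Finset.range i,
      fockPair.diff s (A - r) (fockPair.diff (-s) (-k - 1 - (A - r)) (tm (vac a) (vac b))) := by
  have h1 : ((s : ℤ) : ℂ) • fockPair.total k (tm (vac a) (vac b)) =
      tm (((s : ℤ) : ℂ) • boson k (vac a)) (vac b) +
        tm (vac a) (((s : ℤ) : ℂ) • boson k (vac b)) := by
    rw [total_tm, smul_add, map_smul, map_smul, LinearMap.smul_apply]
  rw [h1, current_vac s k ha hb hi, boson_vac_of_mem s k ha hi, boson_vac_of_mem s k hb hi]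
  simp only [diff_tm, map_sub, Finset.sum_sub_distrib, Finset.sum_add_distrib, map_neg, map_sum,
    LinearMap.sum_apply, LinearMap.neg_apply]
  abel

/-- The symmetric vector of charges `a` and `b`. -/
def vac2 (a b : ℤ) : Fock2 := tm (vac a) (vac b) + tm (vac b) (vac a)

theorem isVacuumLike_tm_vac (s : ℤˣ) (a : ℤ) :
    fockPair.IsVacuumLike s (s * a - 1) (tm (vac a) (vac a)) where
  sum_eq_zero n hn := by
    rw [sum_tm, psi_vac_of_lt s hn, map_zero, map_zero, LinearMap.zero_apply, add_zero]
  diff_eq_zero n hn := by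
    rw [diff_tm, psi_vac_of_lt (-s) (by rw [Units.val_neg, neg_mul]; omega), map_zero, map_zero,
      LinearMap.zero_apply, sub_zero]
  current_eq := current_eq_tm_vac s (Or.inl rfl) (Or.inl rfl)

theorem isVacuumLike_vac2 (s : ℤˣ) (a : ℤ) :
    fockPair.IsVacuumLike s (s * a) (vac2 a (a + s)) where
  sum_eq_zero n hn := by
    have h := units_mul_self s
    rw [vac2, map_add, sum_tm, sum_tm, psi_vac_of_lt s (by omega),
      psi_vac_of_lt s (by rw [mul_add]; omega)]
    simp
  diff_eq_zero n hn := by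
    have h := units_mul_self s
    rw [vac2, map_add, diff_tm, diff_tm,
      psi_vac_of_lt (-s) (a := a + s) (by rw [Units.val_neg, neg_mul, mul_add]; omega)]
    rcases (show -(s : ℤ) * a - 1 < n ∨ n = -(s : ℤ) * a - 1 by rw [neg_mul]; omega) with h1 | rfl
    · rw [psi_vac_of_lt (-s) (by rw [Units.val_neg]; omega)]
      simp
    · -- The two contributions of the last mode of `vac a` cancel.
      have h2 := psi_vac_top (-s) a
      rw [Units.val_neg, sub_neg_eq_add] at h2
      rw [h2]
      simp
  current_eq i k hi := by
    have h := units_mul_self s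
    have h1 := current_eq_tm_vac s (a := a) (b := a + s) (A := s * a) (Or.inr rfl)
      (Or.inl (by rw [mul_add]; omega)) i k hi
    have h2 := current_eq_tm_vac s (a := a + s) (b := a) (A := s * a)
      (Or.inl (by rw [mul_add]; omega)) (Or.inr rfl) i k hi
    simp only [vac2, map_add, Finset.sum_add_distrib, neg_add, ← h1, ← h2]
    module

theorem sum_tm_vac (s : ℤˣ) (a : ℤ) :
    fockPair.sum s (s * a - 1) (tm (vac a) (vac a)) = vac2 (a - s) a := by
  rw [sum_tm, psi_vac_top, vac2]

theorem sum_vac2 (s : ℤˣ) (a : ℤ) :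
    fockPair.sum s (s * a) (vac2 a (a + s)) = (2 : ℂ) • tm (vac a) (vac a) := by
  have h := units_mul_self s
  have h1 := psi_vac_top s (a + s)
  rw [mul_add, h, add_sub_cancel_right, add_sub_cancel_right] at h1
  rw [vac2, map_add, sum_tm, sum_tm, h1, psi_vac_of_lt s (by omega), map_zero, map_zero,
    LinearMap.zero_apply, zero_add, add_zero, two_smul]

end Square

open MvPowerSeries

/-! ### Power series as functionals on polynomials -/

section Dual

variable {ι ρ : Type}

/-- The factorial of a multi-index. -/
def mfact (d : ι →₀ ℕ) : ℂ := d.prod fun _ n => (n.factorial : ℂ)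

theorem mfact_ne_zero (d : ι →₀ ℕ) : mfact d ≠ 0 :=
  Finset.prod_ne_zero_iff.mpr fun q _ => Nat.cast_ne_zero.mpr (Nat.factorial_ne_zero (d q))

@[simp] theorem mfact_zero : mfact (0 : ι →₀ ℕ) = 1 := Finsupp.prod_zero_index

theorem mfact_add_single (d : ι →₀ ℕ) (q : ι) :
    mfact (d + Finsupp.single q 1) = (d q + 1) * mfact d := by
  classical
  have h1 : mfact (d + Finsupp.single q 1) =
      ((d q + 1).factorial : ℂ) * (d.erase q).prod fun _ n => (n.factorial : ℂ) := by
    rw [mfact, ← Finsupp.mul_prod_erase' _ q _ (by simp)]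
    congr 2
    · simp
    · rw [Finsupp.erase_add, Finsupp.erase_single, add_zero]
  have h2 : mfact d = ((d q).factorial : ℂ) * (d.erase q).prod fun _ n => (n.factorial : ℂ) := by
    rw [mfact, ← Finsupp.mul_prod_erase' _ q _ (by simp)]
  rw [h1, h2, Nat.factorial_succ]
  push_cast
  ring

theorem mfact_sumElim {ι' : Type} (d : ι →₀ ℕ) (d' : ι' →₀ ℕ) :
    mfact (d.sumElim d') = mfact d * mfact d' := by
  rw [mfact, Finsupp.sumElim_eq_add, Finsupp.prod_add_index_of_disjoint,
    Finsupp.prod_mapDomain_index_inj Sum.inl_injective,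
    Finsupp.prod_mapDomain_index_inj Sum.inr_injective]
  · rfl
  · classical
    rw [Finset.disjoint_left]
    intro q hq hq'
    obtain ⟨a, _, rfl⟩ := Finset.mem_image.mp (Finsupp.mapDomain_support hq)
    obtain ⟨b, _, hb⟩ := Finset.mem_image.mp (Finsupp.mapDomain_support hq')
    cases hb

/-- The functional on polynomials given by a power series: its value at a monomial is the
corresponding derivative of the power series at the origin. -/
def dual (f : MvPowerSeries ι ℂ) : MvPolynomial ι ℂ →ₗ[ℂ] ℂ :=
  (MvPolynomial.basisMonomials ι ℂ).constr ℂ fun d => mfact d * coeff d f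

theorem dual_monomial_one (f : MvPowerSeries ι ℂ) (d : ι →₀ ℕ) :
    dual f (MvPolynomial.monomial d 1) = mfact d * coeff d f := by
  have h := (MvPolynomial.basisMonomials ι ℂ).constr_basis ℂ (fun d => mfact d * coeff d f) d
  rwa [MvPolynomial.coe_basisMonomials] at h

theorem dual_eq_sum (f : MvPowerSeries ι ℂ) (p : MvPolynomial ι ℂ) :
    dual f p = ∑ d ∈ p.support, MvPolynomial.coeff d p * (mfact d * coeff d f) := by
  conv_lhs => rw [p.as_sum]
  rw [map_sum]
  refine Finset.sum_congr rfl fun d _ => ?_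
  rw [← mul_one (MvPolynomial.coeff d p), ← smul_eq_mul, ← MvPolynomial.smul_monomial, map_smul,
    dual_monomial_one, smul_eq_mul]
  simp

theorem dual_one (f : MvPowerSeries ι ℂ) : dual f 1 = constantCoeff f := by
  have h := dual_monomial_one f 0
  rwa [mfact_zero, one_mul] at h

/-- The power series with given values of the derivatives at the origin. -/
def ofDual (φ : MvPolynomial ι ℂ →ₗ[ℂ] ℂ) : MvPowerSeries ι ℂ :=
  fun d => (mfact d)⁻¹ * φ (MvPolynomial.monomial d 1)

theorem dual_ofDual (φ : MvPolynomial ι ℂ →ₗ[ℂ] ℂ) : dual (ofDual φ) = φ := by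
  refine (MvPolynomial.basisMonomials ι ℂ).ext fun d => ?_
  rw [MvPolynomial.coe_basisMonomials, dual_monomial_one]
  exact mul_inv_cancel_left₀ (mfact_ne_zero d) _

/-- The polynomials `Q e` are the coefficients of the generating series `exp (∑ x_q p_q)`: the
functional of a power series `f` takes the value `coeff e (f(x))` on `Q e`. -/
def IsTest (x : ι → MvPowerSeries ρ ℂ) (Q : (ρ →₀ ℕ) → MvPolynomial ι ℂ) : Prop :=
  ∀ e D, mfact D * MvPolynomial.coeff D (Q e) = coeff e (D.prod fun q n => x q ^ n)

theorem IsTest.coeff_subst {x : ι → MvPowerSeries ρ ℂ} {Q : (ρ →₀ ℕ) → MvPolynomial ι ℂ}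
    (hQ : IsTest x Q) (hx : HasSubst x) (f : MvPowerSeries ι ℂ) (e : ρ →₀ ℕ) :
    coeff e (f.subst x) = dual f (Q e) := by
  rw [MvPowerSeries.coeff_subst hx, dual_eq_sum,
    finsum_eq_finsetSum_of_support_subset (s := (Q e).support)]
  · refine Finset.sum_congr rfl fun d _ => ?_
    rw [← hQ e d, smul_eq_mul]
    ring
  · intro d hd
    rw [Function.mem_support, ← hQ e d] at hd
    rw [Finset.mem_coe, MvPolynomial.mem_support_iff]
    rintro h
    exact hd (by rw [h, mul_zero, smul_zero])

theorem exists_isTest {x : ι → MvPowerSeries ρ ℂ} (hx : HasSubst x) : ∃ Q, IsTest x Q := by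
  classical
  have h : ∀ e : ρ →₀ ℕ, ∃ p : MvPolynomial ι ℂ, ∀ D : ι →₀ ℕ,
      mfact D * MvPolynomial.coeff D p = coeff e (D.prod fun q n => x q ^ n) := by
    intro e
    have hf : {D : ι →₀ ℕ | coeff e (D.prod fun q n => x q ^ n) ≠ 0}.Finite :=
      (coeff_subst_finite hx (fun _ => 1 : MvPowerSeries ι ℂ) e).subset fun D hD h =>
        hD ((one_mul _).symm.trans h)
    refine ⟨∑ D ∈ hf.toFinset,
      MvPolynomial.monomial D ((mfact D)⁻¹ * coeff e (D.prod fun q n => x q ^ n)), fun D => ?_⟩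
    rw [MvPolynomial.coeff_sum]
    simp only [MvPolynomial.coeff_monomial]
    rw [Finset.sum_ite_eq' hf.toFinset D]
    split_ifs with hD
    · rw [mul_inv_cancel_left₀ (mfact_ne_zero D)]
    · rw [Set.Finite.mem_toFinset, Set.mem_ofPred_eq, not_not] at hD
      rw [mul_zero, hD]
  choose Q hQ using h
  exact ⟨Q, hQ⟩

theorem IsTest.pderiv [DecidableEq ρ] {x : ι → MvPowerSeries ρ ℂ} {Q : (ρ →₀ ℕ) → MvPolynomial ι ℂ}
    (hQ : IsTest x Q) (q : ι) (e : ρ →₀ ℕ) : MvPolynomial.pderiv q (Q e) =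
      ∑ p ∈ Finset.HasAntidiagonal.antidiagonal e, coeff p.1 (x q) • Q p.2 := by
  classical
  ext D
  refine mul_left_cancel₀ (mfact_ne_zero D) ?_
  rw [MvPolynomial.coeff_pderiv, MvPolynomial.coeff_sum, Finset.mul_sum]
  have h := hQ e (D + Finsupp.single q 1)
  rw [mfact_add_single, Finsupp.prod_add_index' (by simp) (by intros; rw [pow_add]),
    Finsupp.prod_single_index (by simp), pow_one, mul_comm (D.prod _), coeff_mul] at h
  rw [← mul_assoc, mul_right_comm, mul_comm (mfact D), h]
  refine Finset.sum_congr rfl fun p _ => ?_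
  rw [← hQ, MvPolynomial.coeff_smul, smul_eq_mul]
  ring

theorem isTest_of_pderiv [DecidableEq ρ] {x : ι → MvPowerSeries ρ ℂ} {Q : (ρ →₀ ℕ) → MvPolynomial ι ℂ}
    (h0 : ∀ e, MvPolynomial.constantCoeff (Q e) = coeff e (1 : MvPowerSeries ρ ℂ))
    (hd : ∀ q e, MvPolynomial.pderiv q (Q e) =
      ∑ p ∈ Finset.HasAntidiagonal.antidiagonal e, coeff p.1 (x q) • Q p.2) : IsTest x Q := by
  classical
  intro e D
  obtain ⟨n, hn⟩ : ∃ n, D.degree = n := ⟨_, rfl⟩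
  induction n generalizing D e with
  | zero =>
    obtain rfl := (Finsupp.degree_eq_zero_iff D).mp hn
    rw [mfact_zero, one_mul, Finsupp.prod_zero_index, ← h0 e]
    rfl
  | succ n ih =>
    obtain ⟨q, hq⟩ : ∃ q, D q ≠ 0 := by
      by_contra hc
      push Not at hc
      rw [show D = 0 from Finsupp.ext hc, map_zero] at hn
      omega
    obtain ⟨D, rfl⟩ : ∃ D', D = D' + Finsupp.single q 1 :=
      ⟨D - Finsupp.single q 1, (tsub_add_cancel_of_le (by
        rw [Finsupp.single_le_iff]; omega)).symm⟩
    rw [map_add, Finsupp.degree_single] at hn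
    have h := congrArg (MvPolynomial.coeff D) (hd q e)
    rw [MvPolynomial.coeff_pderiv, MvPolynomial.coeff_sum] at h
    rw [mfact_add_single, Finsupp.prod_add_index' (by simp) (by intros; rw [pow_add]),
      Finsupp.prod_single_index (by simp), pow_one, mul_comm (D.prod _), coeff_mul,
      mul_right_comm, mul_comm _ (MvPolynomial.coeff _ _), h, Finset.sum_mul]
    refine Finset.sum_congr rfl fun p _ => ?_
    rw [← ih p.2 D (by omega), MvPolynomial.coeff_smul, smul_eq_mul]
    ring

end Dual

/-! ### Residues and vertex operators -/

section Residue

variable {σ ρ : Type}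

/-- The generating function of the values of a functional on a family of polynomials. -/
def gen (Q : (ρ →₀ ℕ) → MvPolynomial σ ℂ) (φ : MvPolynomial σ ℂ →ₗ[ℂ] ℂ) : MvPowerSeries ρ ℂ :=
  fun e => φ (Q e)

theorem coeff_gen (Q : (ρ →₀ ℕ) → MvPolynomial σ ℂ) (φ : MvPolynomial σ ℂ →ₗ[ℂ] ℂ) (e : ρ →₀ ℕ) :
    coeff e (gen Q φ) = φ (Q e) := rfl

theorem IsTest.gen_pderiv {x : σ → MvPowerSeries ρ ℂ} {Q : (ρ →₀ ℕ) → MvPolynomial σ ℂ}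
    (hQ : IsTest x Q) (φ : MvPolynomial σ ℂ →ₗ[ℂ] ℂ) (q : σ) :
    gen Q (φ ∘ₗ (MvPolynomial.pderiv q).toLinearMap) = x q * gen Q φ := by
  classical
  ext e
  rw [coeff_gen, coeff_mul, LinearMap.comp_apply]
  change φ (MvPolynomial.pderiv q (Q e)) = _
  rw [hQ.pderiv, map_sum]
  refine Finset.sum_congr rfl fun p _ => ?_
  rw [map_smul, smul_eq_mul, coeff_gen]

variable [TimeIndex σ]

theorem sum_fiber_ite [DecidableEq σ] (N : ℕ) (q : σ) {M : Type*} [AddCommMonoid M] (f : ℕ → σ → M)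
    (h : N < deg q → f (deg q) q = 0) :
    ∑ k ∈ Finset.range (N + 1), ∑ q' ∈ fiber σ k, (if q' = q then f k q' else 0) =
      f (deg q) q := by
  rw [Finset.sum_eq_single (deg q)]
  · rw [Finset.sum_eq_single q]
    · rw [if_pos rfl]
    · intro q' _ hq'
      rw [if_neg hq']
    · intro hq
      exact absurd (mem_fiber.mpr rfl) hq
  · intro k _ hk
    refine Finset.sum_eq_zero fun q' hq' => ?_
    rw [mem_fiber] at hq'
    rw [if_neg]
    rintro rfl
    exact hk hq'.symm
  · intro hq
    rw [Finset.mem_range] at hq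
    refine Finset.sum_eq_zero fun q' hq' => ?_
    rw [mem_fiber] at hq'
    split_ifs with hc
    · rw [hc, h (by omega)]
    · rfl

theorem ann_zero (v : σ → ℂ) (U : MvPolynomial σ ℂ) : ann v 0 U = U := by
  induction U using MvPolynomial.induction_on with
  | C a =>
    rw [← mul_one (MvPolynomial.C a), ← MvPolynomial.smul_eq_C_mul, map_smul, ann_one, if_pos rfl]
  | add p q hp hq => rw [map_add, hp, hq]
  | mul_X U q ih =>
    rw [ann_mul_X, ih, ann_of_neg v (by have := deg_pos q; omega), smul_zero, add_zero]

/-- The derivative in `z` of the shift `p_q ↦ p_q + v_q z ^ deg q`. -/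
theorem smul_ann (v : σ → ℂ) (N : ℕ) (U : MvPolynomial σ ℂ) (j : ℤ) (hj : j ≤ N) :
    (j : ℂ) • ann v j U = ∑ k ∈ Finset.range (N + 1), ∑ q ∈ fiber σ k,
      ((k : ℂ) * v q) • ann v (j - k) (MvPolynomial.pderiv q U) := by
  classical
  induction U using MvPolynomial.induction_on generalizing j with
  | C a =>
    rw [← mul_one (MvPolynomial.C a), ← MvPolynomial.smul_eq_C_mul, map_smul, ann_one]
    simp only [Derivation.map_smul, MvPolynomial.pderiv_one, smul_zero, map_zero,
      Finset.sum_const_zero]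
    split_ifs with h
    · simp [h]
    · simp
  | add p q hp hq => simp only [map_add, smul_add, Finset.sum_add_distrib, hp j hj, hq j hj]
  | mul_X U q ih =>
    have h1 : ∀ (k : ℕ) (q' : σ), ((k : ℂ) * v q') • ann v (j - k) (MvPolynomial.pderiv q'
        (U * MvPolynomial.X q)) = (((k : ℂ) * v q') • ann v (j - k) (MvPolynomial.pderiv q' U)) *
          MvPolynomial.X q + v q • (((k : ℂ) * v q') • ann v (j - deg q - k)
          (MvPolynomial.pderiv q' U)) +
        if q' = q then ((k : ℂ) * v q') • ann v (j - k) U else 0 := by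
      intro k q'
      rw [MvPolynomial.pderiv_mul, MvPolynomial.pderiv_X, map_add, ann_mul_X, smul_add, smul_add,
        smul_mul_assoc, smul_comm (v q), sub_right_comm, Pi.single_apply]
      by_cases h : q' = q
      · rw [if_pos h, if_pos h.symm, mul_one]
      · rw [if_neg h, if_neg (Ne.symm h), mul_zero, map_zero, smul_zero]
    have hd := deg_pos q
    simp only [h1, Finset.sum_add_distrib]
    have h2 := sum_fiber_ite N q (fun k q' => ((k : ℂ) * v q') • ann v (j - k) U)
      (fun h => by rw [ann_of_neg v (by omega), smul_zero])
    rw [h2]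
    simp only [← Finset.sum_mul, ← Finset.smul_sum]
    rw [← ih j hj, ← ih (j - deg q) (by omega), ann_mul_X, smul_add, smul_mul_assoc, add_assoc,
      smul_smul, smul_smul, ← add_smul]
    congr 2
    push_cast
    ring

theorem constantCoeff_xi (u : ℕ+ → MvPowerSeries ρ ℂ) : PowerSeries.constantCoeff (xi u) = 0 := by
  rw [← PowerSeries.coeff_zero_eq_constantCoeff_apply, xi, PowerSeries.coeff_mk]
  simp

theorem coeff_zero_expXi (u : ℕ+ → MvPowerSeries ρ ℂ) : PowerSeries.coeff 0 (expXi u) = 1 := by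
  rw [PowerSeries.coeff_zero_eq_constantCoeff_apply]
  exact constantCoeff_exp_subst (constantCoeff_xi u)

theorem smul_coeff_expXi (u : ℕ+ → MvPowerSeries ρ ℂ) (j : ℕ) :
    (j : ℂ) • PowerSeries.coeff j (expXi u) = ∑ k ∈ Finset.range (j + 1),
      (k : ℂ) • (PowerSeries.coeff k (xi u) * PowerSeries.coeff (j - k) (expXi u)) := by
  rcases j with _ | j
  · simp
  · have h := congrArg (PowerSeries.coeff j) (derivative_exp_subst (constantCoeff_xi u))
    rw [PowerSeries.coeff_derivative, PowerSeries.coeff_mul,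
      Finset.Nat.sum_antidiagonal_eq_sum_range_succ_mk] at h
    rw [Finset.sum_range_succ', Nat.cast_zero, zero_smul, add_zero, Algebra.smul_def,
      map_natCast, Nat.cast_succ, mul_comm]
    refine h.trans (Finset.sum_congr rfl fun k _ => ?_)
    rw [PowerSeries.coeff_derivative, Algebra.smul_def, map_natCast, Nat.add_sub_add_right]
    rw [expXi]
    push_cast
    ring

/-- On the generating series `exp (∑ x_q p_q)`, the shift `p_q ↦ p_q + v_q z ^ deg q` is the
multiplication by `exp ξ(u, z)`. -/
theorem IsTest.gen_ann {x : σ → MvPowerSeries ρ ℂ} {Q : (ρ →₀ ℕ) → MvPolynomial σ ℂ}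
    (hQ : IsTest x Q) {v : σ → ℂ} {u : ℕ+ → MvPowerSeries ρ ℂ}
    (hu : ∀ k : ℕ+, u k = ∑ q ∈ fiber σ k, v q • x q) (φ : MvPolynomial σ ℂ →ₗ[ℂ] ℂ) (j : ℕ) :
    gen Q (φ ∘ₗ ann v j) = PowerSeries.coeff j (expXi u) * gen Q φ := by
  induction j using Nat.strong_induction_on generalizing φ with
  | _ j ih =>
    rcases Nat.eq_zero_or_pos j with rfl | hj
    · rw [coeff_zero_expXi, one_mul]
      congr 1
      exact LinearMap.ext fun U => congrArg φ (ann_zero v U)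
    · have hj' : (j : ℂ) ≠ 0 := by exact_mod_cast hj.ne'
      refine smul_right_injective _ hj' ?_
      change (j : ℂ) • _ = (j : ℂ) • _
      rw [← smul_mul_assoc, smul_coeff_expXi, Finset.sum_mul]
      have h1 : (j : ℂ) • gen Q (φ ∘ₗ ann v j) = ∑ k ∈ Finset.range (j + 1), ∑ q ∈ fiber σ k,
          ((k : ℂ) * v q) • gen Q (φ ∘ₗ ann v (j - k) ∘ₗ (MvPolynomial.pderiv q).toLinearMap) := by
        ext e
        have h2 := congrArg φ (smul_ann v j (Q e) j le_rfl)
        simp only [map_smul, map_sum, Int.cast_natCast] at h2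
        simp only [map_smul, map_sum, coeff_gen]
        exact h2
      rw [h1]
      refine Finset.sum_congr rfl fun k hk => ?_
      have hk := Finset.mem_range.mp hk
      rcases Nat.eq_zero_or_pos k with rfl | hk0
      · simp [fiber_zero]
      · rw [smul_mul_assoc]
        have h3 : ∀ q, gen Q (φ ∘ₗ ann v ((j : ℤ) - k) ∘ₗ (MvPolynomial.pderiv q).toLinearMap) =
            x q * (PowerSeries.coeff (j - k) (expXi u) * gen Q φ) := by
          intro q
          rw [← LinearMap.comp_assoc, hQ.gen_pderiv, ← ih (j - k) (by omega), Nat.cast_sub (by omega)]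
        simp only [h3, mul_smul, ← Finset.smul_sum, ← smul_mul_assoc, ← Finset.sum_mul]
        rw [← mul_assoc, xi, PowerSeries.coeff_mk, dif_pos hk0, hu ⟨k, hk0⟩]
        rfl

end Residue

/-! ### Shifts by the spectral parameter -/

section SpectralShift

variable {σ ρ : Type}

/-- A power series in the times, regarded as a power series in the times and `z⁻¹`. -/
def liftSeries (f : MvPowerSeries ρ ℂ) : MvPowerSeries (Option ρ) ℂ :=
  f.subst fun s => (X (some s) : MvPowerSeries (Option ρ) ℂ)

theorem coeff_liftSeries (f : MvPowerSeries ρ ℂ) (i : ℕ) (e : ρ →₀ ℕ) :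
    coeff (e.optionElim i) (liftSeries f) = if i = 0 then coeff e f else 0 := by
  have h : liftSeries f = rename (Function.Embedding.some : ρ ↪ Option ρ) f :=
    (rename_eq_subst (Function.Embedding.some : ρ ↪ Option ρ) f).symm
  rw [h]
  split_ifs with hi
  · subst hi
    rw [← coeff_embDomain_rename Function.Embedding.some f e]
    congr 2
    refine Finsupp.ext fun q => ?_
    rcases q with _ | q
    · rw [Finsupp.optionElim_apply_none, Finsupp.embDomain_of_notMem_range]
      simp
    · rw [Finsupp.optionElim_apply_some]
      exact (Finsupp.embDomain_apply_self _ _ _).symm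
  · refine coeff_rename_eq_zero _ _ ?_
    rintro ⟨d, hd⟩
    have h2 := DFunLike.congr_fun hd none
    rw [Finsupp.optionElim_apply_none, Finsupp.mapDomain_of_notMem_range _ _ (by simp)] at h2
    exact hi h2.symm

theorem optionElim_some (E : Option ρ →₀ ℕ) : E.some.optionElim (E none) = E := by
  ext (_ | q)
  · rw [Finsupp.optionElim_apply_none]
  · rw [Finsupp.optionElim_apply_some, Finsupp.some_apply]

variable [TimeIndex σ]

/-- The times `x_q - (v_q / deg q) z ^ (-deg q)`. -/
def shiftedTime (v : σ → ℂ) (x : σ → MvPowerSeries ρ ℂ) (q : σ) : MvPowerSeries (Option ρ) ℂ :=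
  liftSeries (x q) - (v q * (deg q : ℂ)⁻¹) • X none ^ deg q

theorem coeff_shiftedTime [DecidableEq ρ] (v : σ → ℂ) (x : σ → MvPowerSeries ρ ℂ) (q : σ) (i : ℕ)
    (e : ρ →₀ ℕ) : coeff (e.optionElim i) (shiftedTime v x q) =
      (if i = 0 then coeff e (x q) else 0) -
        if i = deg q ∧ e = 0 then v q * (deg q : ℂ)⁻¹ else 0 := by
  classical
  rw [shiftedTime, map_sub, coeff_liftSeries, coeff_smul, coeff_X_pow]
  congr 1
  have h : e.optionElim i = Finsupp.single none (deg q) ↔ i = deg q ∧ e = 0 := by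
    constructor
    · intro h
      refine ⟨by simpa using DFunLike.congr_fun h none, ?_⟩
      ext r
      simpa using DFunLike.congr_fun h (some r)
    · rintro ⟨rfl, rfl⟩
      ext (_ | r)
      · simp
      · simp
  by_cases hc : i = deg q ∧ e = 0
  · rw [if_pos (h.mpr hc), if_pos hc, mul_one]
  · rw [if_neg (fun h' => hc (h.mp h')), if_neg hc, mul_zero]

theorem hasSubst_shiftedTime (v : σ → ℂ) {x : σ → MvPowerSeries ρ ℂ} (hx : HasSubst x) :
    HasSubst (shiftedTime v x) where
  const_coeff q := by
    classical
    have h := coeff_shiftedTime v x q 0 0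
    rw [if_pos rfl, if_neg (by have := deg_pos q; omega), sub_zero] at h
    have h0 : (0 : ρ →₀ ℕ).optionElim 0 = (0 : Option ρ →₀ ℕ) := by
      ext (_ | r) <;> simp
    rw [h0] at h
    have := hx.const_coeff q
    rw [← coeff_zero_eq_constantCoeff_apply] at this ⊢
    rwa [h]
  coeff_zero E := by
    classical
    refine ((hx.coeff_zero E.some).union (finite_fiber (σ := σ) (E none))).subset fun q hq => ?_
    by_contra hc
    rw [Set.mem_union, not_or] at hc
    refine hq ?_
    have h1 : coeff E.some (x q) = 0 := not_not.mp hc.1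
    have h2 : ¬(E none = deg q ∧ E.some = 0) := fun h => hc.2 h.1.symm
    rw [← optionElim_some E, coeff_shiftedTime, h1, if_neg h2, ite_self, sub_zero]

theorem constantCoeff_creCoeff (v : σ → ℂ) (i : ℕ) :
    MvPolynomial.constantCoeff (creCoeff v i) = if i = 0 then 1 else 0 := by
  rcases i with _ | i
  · simp
  · have h := congrArg MvPolynomial.constantCoeff (creCoeff_succ v i)
    have hne : ((i : ℂ) + 1) ≠ 0 := by exact_mod_cast Nat.succ_ne_zero i
    rw [map_neg, map_sum, Finset.sum_eq_zero, neg_zero] at h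
    · rw [MvPolynomial.constantCoeff_smul, smul_eq_mul] at h
      rw [if_neg (Nat.succ_ne_zero i)]
      push_cast
      exact (mul_eq_zero.mp h).resolve_left hne
    · intro k _
      rw [map_mul, form, map_sum, Finset.sum_eq_zero, zero_mul]
      intro q _
      simp

theorem sum_antidiagonal_optionElim [DecidableEq ρ] {M : Type*} [AddCommMonoid M] (i : ℕ)
    (e : ρ →₀ ℕ) (f : (Option ρ →₀ ℕ) × (Option ρ →₀ ℕ) → M) :
    ∑ P ∈ Finset.HasAntidiagonal.antidiagonal (e.optionElim i), f P =
      ∑ a ∈ Finset.HasAntidiagonal.antidiagonal i,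
        ∑ p ∈ Finset.HasAntidiagonal.antidiagonal e, f (p.1.optionElim a.1, p.2.optionElim a.2) := by
  rw [← Finset.sum_product']
  symm
  refine Finset.sum_bij' (fun b _ => (b.2.1.optionElim b.1.1, b.2.2.optionElim b.1.2))
    (fun P _ => ((P.1 none, P.2 none), (P.1.some, P.2.some))) ?_ ?_ ?_ ?_ ?_
  · rintro ⟨a, p⟩ h
    rw [Finset.mem_product, Finset.HasAntidiagonal.mem_antidiagonal, Finset.HasAntidiagonal.mem_antidiagonal] at h
    rw [Finset.HasAntidiagonal.mem_antidiagonal]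
    ext (_ | r)
    · simp [← h.1]
    · simp [← h.2]
  · rintro P h
    rw [Finset.HasAntidiagonal.mem_antidiagonal] at h
    rw [Finset.mem_product, Finset.HasAntidiagonal.mem_antidiagonal, Finset.HasAntidiagonal.mem_antidiagonal]
    constructor
    · have := DFunLike.congr_fun h none
      simpa using this
    · ext r
      have := DFunLike.congr_fun h (some r)
      simpa using this
  · rintro ⟨a, p⟩ h
    ext <;> simp
  · rintro P h
    rw [optionElim_some, optionElim_some]
  · rintro ⟨a, p⟩ h
    rfl

/-- On the generating series `exp (∑ x_q p_q)`, the shift of the times by `z⁻¹` is the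
multiplication by the creation part of a vertex operator. -/
theorem IsTest.shiftedTime {x : σ → MvPowerSeries ρ ℂ} {Q : (ρ →₀ ℕ) → MvPolynomial σ ℂ}
    (hQ : IsTest x Q) (v : σ → ℂ) :
    IsTest (shiftedTime v x) fun E => creCoeff v (E none) * Q E.some := by
  classical
  refine isTest_of_pderiv (fun E => ?_) fun q E => ?_
  · have h := hQ E.some 0
    rw [mfact_zero, one_mul, Finsupp.prod_zero_index] at h
    change MvPolynomial.constantCoeff (Q E.some) = _ at h
    rw [map_mul, constantCoeff_creCoeff, h, coeff_one, coeff_one]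
    have h2 : E = 0 ↔ E none = 0 ∧ E.some = 0 := by
      constructor
      · rintro rfl
        exact ⟨rfl, by ext r; simp⟩
      · intro h
        rw [← optionElim_some E, h.1, h.2]
        ext (_ | r) <;> simp
    by_cases h3 : E none = 0 <;> by_cases h4 : E.some = 0 <;> simp [h2, h3, h4]
  · obtain ⟨i, e, rfl⟩ : ∃ i e, E = Finsupp.optionElim i e := ⟨_, _, (optionElim_some E).symm⟩
    rw [sum_antidiagonal_optionElim]
    have hsome : ∀ (i : ℕ) (d : ρ →₀ ℕ), (d.optionElim i).some = d := fun i d => by ext r; simp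
    simp only [coeff_shiftedTime, sub_smul, Finset.sum_sub_distrib, Finsupp.optionElim_apply_none,
      hsome]
    have h1 : ∑ a ∈ Finset.HasAntidiagonal.antidiagonal i,
        ∑ p ∈ Finset.HasAntidiagonal.antidiagonal e, (if a.1 = 0 then coeff p.1 (x q) else 0) •
          (creCoeff v a.2 * Q p.2) = creCoeff v i * MvPolynomial.pderiv q (Q e) := by
      rw [Finset.sum_eq_single (0, i), hQ.pderiv, Finset.mul_sum]
      · refine Finset.sum_congr rfl fun p _ => ?_
        rw [if_pos rfl, mul_smul_comm]
      · rintro ⟨a, b⟩ hab hne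
        rw [Finset.HasAntidiagonal.mem_antidiagonal] at hab
        refine Finset.sum_eq_zero fun p _ => ?_
        dsimp only at hab ⊢
        rw [if_neg, zero_smul]
        rintro rfl
        exact hne (by rw [← hab, zero_add])
      · intro hc
        exact absurd (Finset.HasAntidiagonal.mem_antidiagonal.mpr (zero_add i)) hc
    have h2 : ∑ a ∈ Finset.HasAntidiagonal.antidiagonal i,
        ∑ p ∈ Finset.HasAntidiagonal.antidiagonal e,
          (if a.1 = deg q ∧ p.1 = 0 then v q * (deg q : ℂ)⁻¹ else 0) • (creCoeff v a.2 * Q p.2) =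
        (v q * (deg q : ℂ)⁻¹) • (creCoeff v (i - deg q) * Q e) := by
      by_cases hi : deg q ≤ i
      · rw [Finset.sum_eq_single (deg q, i - deg q), Finset.sum_eq_single (0, e)]
        · rw [if_pos ⟨rfl, rfl⟩, Nat.cast_sub hi]
        · rintro ⟨a, b⟩ hab hne
          rw [Finset.HasAntidiagonal.mem_antidiagonal] at hab
          dsimp only at hab ⊢
          rw [if_neg, zero_smul]
          rintro ⟨-, rfl⟩
          exact hne (by rw [← hab, zero_add])
        · intro hc
          exact absurd (Finset.HasAntidiagonal.mem_antidiagonal.mpr (zero_add e)) hc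
        · rintro ⟨a, b⟩ hab hne
          rw [Finset.HasAntidiagonal.mem_antidiagonal] at hab
          refine Finset.sum_eq_zero fun p _ => ?_
          dsimp only at hab ⊢
          rw [if_neg, zero_smul]
          rintro ⟨rfl, -⟩
          exact hne (by rw [← hab, Nat.add_sub_cancel_left])
        · intro hc
          exact absurd (Finset.HasAntidiagonal.mem_antidiagonal.mpr (Nat.add_sub_cancel' hi)) hc
      · rw [creCoeff_of_neg v (by omega), zero_mul, smul_zero]
        refine Finset.sum_eq_zero fun a ha => Finset.sum_eq_zero fun p _ => ?_
        rw [Finset.HasAntidiagonal.mem_antidiagonal] at ha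
        rw [if_neg (by omega), zero_smul]
    rw [h1, h2, MvPolynomial.pderiv_mul, pderiv_creCoeff, smul_mul_assoc]
    module

/-- The residues of the bilinear equations are the modes of vertex operators. -/
theorem coeff_res {x : σ → MvPowerSeries ρ ℂ} (hx : HasSubst x)
    {Q : (ρ →₀ ℕ) → MvPolynomial σ ℂ} (hQ : IsTest x Q) {v : σ → ℂ} {u : ℕ+ → MvPowerSeries ρ ℂ}
    (hu : ∀ k : ℕ+, u k = ∑ q ∈ fiber σ k, v q • x q) (h : MvPowerSeries σ ℂ) (m : ℤ)
    (e : ρ →₀ ℕ) :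
    coeff e (res m (h.subst (LargeBKP.shiftedTime v x)) u) = dual h (vertex v (-1 - m) (Q e)) := by
  classical
  obtain ⟨B, hB⟩ := exists_ann_eq_zero v (Q e)
  have h1 : ∀ i j : ℕ, coeff e (zCoeff (h.subst (LargeBKP.shiftedTime v x)) i *
      PowerSeries.coeff j (expXi u)) = dual h (creCoeff v i * ann v j (Q e)) := by
    intro i j
    have h2 : zCoeff (h.subst (LargeBKP.shiftedTime v x)) i =
        gen Q (dual h ∘ₗ LinearMap.mulLeft ℂ (creCoeff v i)) := by
      ext d
      have h3 := (hQ.shiftedTime v).coeff_subst (hasSubst_shiftedTime v hx) h (d.optionElim i)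
      rw [Finsupp.optionElim_apply_none] at h3
      have h4 : (d.optionElim i).some = d := by ext r; simp
      rw [h4] at h3
      exact h3
    rw [h2, mul_comm, ← hQ.gen_ann hu]
    rfl
  rw [vertex_eq_sum v _ _ hB, map_sum]
  change (∑ᶠ ij : ℕ × ℕ, _) = _
  simp only [h1]
  rw [finsum_eq_finsetSum_of_support_subset
    (s := (Finset.range B).image fun j : ℕ => ((j + m + 1).toNat, j)), Finset.sum_image]
  · refine Finset.sum_congr rfl fun j _ => ?_
    rw [show (j : ℤ) - (-1 - m) = j + m + 1 by ring]
    dsimp only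
    split_ifs with hc
    · rw [Int.toNat_of_nonneg (by omega)]
    · rw [creCoeff_of_neg v (by omega), zero_mul, map_zero]
  · intro j _ j' _ hjj
    exact (Prod.ext_iff.mp hjj).2
  · rintro ⟨i, j⟩ hij
    rw [Function.mem_support] at hij
    have hc : m - i + j = -1 := by
      by_contra hc
      exact hij (if_neg hc)
    rw [if_pos hc] at hij
    have hj : j < B := by
      by_contra hj
      exact hij (by rw [hB j (by omega), mul_zero, map_zero])
    simp only [Finset.coe_image, Set.mem_image, Finset.mem_coe, Finset.mem_range, Prod.mk.injEq]
    exact ⟨j, hj, by omega, rfl⟩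

end SpectralShift

/-! ### Products in separate times -/

section Separate

variable {σ ρ π : Type}

theorem hasSubst_sumElim {a : σ → MvPowerSeries π ℂ} {b : ρ → MvPowerSeries π ℂ} (ha : HasSubst a)
    (hb : HasSubst b) : HasSubst (Sum.elim a b) where
  const_coeff := by
    rintro (q | q)
    · exact ha.const_coeff q
    · exact hb.const_coeff q
  coeff_zero d := by
    refine (((ha.coeff_zero d).image Sum.inl).union ((hb.coeff_zero d).image Sum.inr)).subset ?_
    rintro (q | q) hq
    · exact Or.inl ⟨q, hq, rfl⟩
    · exact Or.inr ⟨q, hq, rfl⟩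

/-- The product `f(x) g(y)` of two power series in separate times. -/
def separate (f : MvPowerSeries σ ℂ) (g : MvPowerSeries ρ ℂ) : MvPowerSeries (σ ⊕ ρ) ℂ :=
  rename (Function.Embedding.inl : σ ↪ σ ⊕ ρ) f * rename (Function.Embedding.inr : ρ ↪ σ ⊕ ρ) g

theorem subst_separate (f : MvPowerSeries σ ℂ) (g : MvPowerSeries ρ ℂ)
    {a : σ → MvPowerSeries π ℂ} {b : ρ → MvPowerSeries π ℂ} (ha : HasSubst a) (hb : HasSubst b) :
    (separate f g).subst (Sum.elim a b) = f.subst a * g.subst b := by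
  have h := hasSubst_sumElim ha hb
  rw [separate, subst_mul h, rename_eq_subst (Function.Embedding.inl : σ ↪ σ ⊕ ρ),
    rename_eq_subst (Function.Embedding.inr : ρ ↪ σ ⊕ ρ),
    subst_comp_subst_apply (HasSubst.X_comp _) h, subst_comp_subst_apply (HasSubst.X_comp _) h]
  congr 2
  · ext1 q
    exact subst_X h _
  · ext1 q
    exact subst_X h _

theorem coeff_separate (f : MvPowerSeries σ ℂ) (g : MvPowerSeries ρ ℂ) (d : σ →₀ ℕ)
    (d' : ρ →₀ ℕ) : coeff (d.sumElim d') (separate f g) = coeff d f * coeff d' g := by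
  classical
  have e1 : ∀ d : σ →₀ ℕ, d.sumElim (0 : ρ →₀ ℕ) = d.embDomain Function.Embedding.inl := by
    intro d
    rw [Finsupp.embDomain_eq_mapDomain, Finsupp.sumElim_eq_add, Finsupp.mapDomain_zero, add_zero]
    rfl
  have e2 : ∀ d : ρ →₀ ℕ, (0 : σ →₀ ℕ).sumElim d = d.embDomain Function.Embedding.inr := by
    intro d
    rw [Finsupp.embDomain_eq_mapDomain, Finsupp.sumElim_eq_add, Finsupp.mapDomain_zero, zero_add]
    rfl
  rw [separate, coeff_mul, Finset.sum_eq_single (d.sumElim 0, (0 : σ →₀ ℕ).sumElim d')]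
  · dsimp only
    rw [e1, e2, coeff_embDomain_rename, coeff_embDomain_rename]
  · rintro ⟨a, b⟩ hab hne
    rw [Finset.HasAntidiagonal.mem_antidiagonal] at hab
    dsimp only at hab ⊢
    by_cases ha : a ∈ Set.range (Finsupp.mapDomain (Function.Embedding.inl : σ ↪ σ ⊕ ρ))
    · by_cases hb : b ∈ Set.range (Finsupp.mapDomain (Function.Embedding.inr : ρ ↪ σ ⊕ ρ))
      · obtain ⟨a, rfl⟩ := ha
        obtain ⟨b, rfl⟩ := hb
        refine absurd ?_ hne
        have h2 : a.sumElim b = d.sumElim d' := by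
          rw [← hab, Finsupp.sumElim_eq_add]
          rfl
        have h3 : a = d := by
          ext q
          exact DFunLike.congr_fun h2 (Sum.inl q)
        have h4 : b = d' := by
          ext q
          exact DFunLike.congr_fun h2 (Sum.inr q)
        rw [← h3, ← h4, e1, e2, Finsupp.embDomain_eq_mapDomain, Finsupp.embDomain_eq_mapDomain]
      · rw [coeff_rename_eq_zero (Function.Embedding.inr : ρ ↪ σ ⊕ ρ) g hb, mul_zero]
    · rw [coeff_rename_eq_zero (Function.Embedding.inl : σ ↪ σ ⊕ ρ) f ha, zero_mul]
  · intro hc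
    refine absurd (Finset.HasAntidiagonal.mem_antidiagonal.mpr ?_) hc
    ext (q | q) <;> simp

theorem rename_monomial_mul_rename_monomial (d : σ →₀ ℕ) (d' : ρ →₀ ℕ) :
    MvPolynomial.rename Sum.inl (MvPolynomial.monomial d (1 : ℂ)) *
      MvPolynomial.rename Sum.inr (MvPolynomial.monomial d' 1) =
    MvPolynomial.monomial (d.sumElim d') 1 := by
  rw [MvPolynomial.rename_monomial, MvPolynomial.rename_monomial, MvPolynomial.monomial_mul,
    mul_one, Finsupp.sumElim_eq_add]

theorem linearMap_ext_separate {M : Type*} [AddCommMonoid M] [Module ℂ M]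
    {φ ψ : MvPolynomial (σ ⊕ ρ) ℂ →ₗ[ℂ] M}
    (h : ∀ u w, φ (MvPolynomial.rename Sum.inl u * MvPolynomial.rename Sum.inr w) =
      ψ (MvPolynomial.rename Sum.inl u * MvPolynomial.rename Sum.inr w)) : φ = ψ := by
  refine (MvPolynomial.basisMonomials (σ ⊕ ρ) ℂ).ext fun D => ?_
  rw [MvPolynomial.coe_basisMonomials, ← Finsupp.comapDomain_sumElim_comapDomain D,
    show ∀ d d', (fun s => MvPolynomial.monomial s (1 : ℂ)) (Finsupp.sumElim d d') = _ from
      fun d d' => (rename_monomial_mul_rename_monomial d d').symm]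
  exact h _ _

theorem dual_separate (f : MvPowerSeries σ ℂ) (g : MvPowerSeries ρ ℂ) (u : MvPolynomial σ ℂ)
    (w : MvPolynomial ρ ℂ) : dual (separate f g)
      (MvPolynomial.rename Sum.inl u * MvPolynomial.rename Sum.inr w) = dual f u * dual g w := by
  induction u using MvPolynomial.induction_on' with
  | add p q hp hq => simp only [map_add, add_mul, hp, hq]
  | monomial d a =>
    induction w using MvPolynomial.induction_on' with
    | add p q hp hq => simp only [map_add, mul_add, hp, hq]
    | monomial d' b =>
      have h : ∀ {τ : Type} (d : τ →₀ ℕ) (c : ℂ),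
          MvPolynomial.monomial d c = c • MvPolynomial.monomial d (1 : ℂ) := fun d c => by
        rw [MvPolynomial.smul_monomial, smul_eq_mul, mul_one]
      rw [h d a, h d' b]
      simp only [map_smul, smul_mul_assoc, mul_smul_comm, rename_monomial_mul_rename_monomial,
        dual_monomial_one, mfact_sumElim, coeff_separate, smul_eq_mul]
      ring

end Separate

section VertexSeparate

variable {σ ρ : Type} [TimeIndex σ] [TimeIndex ρ]

theorem form_sumElim_zero (v : σ → ℂ) (k : ℕ) :
    form (Sum.elim v (0 : ρ → ℂ)) k = MvPolynomial.rename Sum.inl (form v k) := by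
  rw [form, sum_fiber_sum, form, map_sum]
  simp

theorem form_zero_sumElim (w : ρ → ℂ) (k : ℕ) :
    form (Sum.elim (0 : σ → ℂ) w) k = MvPolynomial.rename Sum.inr (form w k) := by
  rw [form, sum_fiber_sum, form, map_sum]
  simp

theorem creCoeff_eq_of_form_eq {A : MvPolynomial σ ℂ →ₐ[ℂ] MvPolynomial ρ ℂ} {v : σ → ℂ}
    {w : ρ → ℂ} (h : ∀ k, form w k = A (form v k)) (i : ℤ) :
    creCoeff w i = A (creCoeff v i) := by
  by_cases hi : i < 0
  · rw [creCoeff_of_neg w hi, creCoeff_of_neg v hi, map_zero]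
  obtain ⟨i, rfl⟩ := Int.eq_ofNat_of_zero_le (not_lt.mp hi)
  clear hi
  induction i using Nat.strong_induction_on with
  | _ i ih =>
    rcases i with _ | i
    · simp
    have hne : ((i : ℂ) + 1) ≠ 0 := by exact_mod_cast Nat.succ_ne_zero i
    refine smul_right_injective _ hne ?_
    change ((i : ℂ) + 1) • _ = ((i : ℂ) + 1) • _
    push_cast
    rw [← map_smul, creCoeff_succ, creCoeff_succ, map_neg, map_sum]
    refine congrArg Neg.neg (Finset.sum_congr rfl fun k hk => ?_)
    have hk := Finset.mem_range.mp hk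
    rw [h, map_mul, show (i : ℤ) - k = ((i - k : ℕ) : ℤ) by omega, ih (i - k) (by omega)]

theorem creCoeff_sumElim (v : σ → ℂ) (w : ρ → ℂ) (n : ℕ) :
    creCoeff (Sum.elim v w) n = ∑ r ∈ Finset.range (n + 1),
      MvPolynomial.rename Sum.inl (creCoeff v r) *
        MvPolynomial.rename Sum.inr (creCoeff w ((n - r : ℕ) : ℤ)) := by
  have h : Sum.elim v w = Sum.elim v (0 : ρ → ℂ) + Sum.elim (0 : σ → ℂ) w := by
    ext (q | q) <;> simp
  rw [creCoeff_natCast, h, cre_add, PowerSeries.coeff_mul,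
    Finset.Nat.sum_antidiagonal_eq_sum_range_succ_mk]
  refine Finset.sum_congr rfl fun r _ => ?_
  rw [← creCoeff_natCast, ← creCoeff_natCast,
    creCoeff_eq_of_form_eq (fun k => form_sumElim_zero v k),
    creCoeff_eq_of_form_eq (fun k => form_zero_sumElim w k)]

theorem shift_rename_inl (v : σ → ℂ) (w : ρ → ℂ) (u : MvPolynomial σ ℂ) :
    shift (Sum.elim v w) (MvPolynomial.rename Sum.inl u) =
      Polynomial.mapAlgHom (MvPolynomial.rename Sum.inl) (shift v u) := by
  have h : (shift (Sum.elim v w)).comp (MvPolynomial.rename Sum.inl) =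
      (Polynomial.mapAlgHom (MvPolynomial.rename Sum.inl)).comp (shift v) := by
    refine MvPolynomial.algHom_ext fun q => ?_
    rw [AlgHom.comp_apply, AlgHom.comp_apply, MvPolynomial.rename_X, shift, shift,
      MvPolynomial.aeval_X, MvPolynomial.aeval_X, map_add, map_smul]
    simp
  exact DFunLike.congr_fun h u

theorem shift_rename_inr (v : σ → ℂ) (w : ρ → ℂ) (u : MvPolynomial ρ ℂ) :
    shift (Sum.elim v w) (MvPolynomial.rename Sum.inr u) =
      Polynomial.mapAlgHom (MvPolynomial.rename Sum.inr) (shift w u) := by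
  have h : (shift (Sum.elim v w)).comp (MvPolynomial.rename Sum.inr) =
      (Polynomial.mapAlgHom (MvPolynomial.rename Sum.inr)).comp (shift w) := by
    refine MvPolynomial.algHom_ext fun q => ?_
    rw [AlgHom.comp_apply, AlgHom.comp_apply, MvPolynomial.rename_X, shift, shift,
      MvPolynomial.aeval_X, MvPolynomial.aeval_X, map_add, map_smul]
    simp
  exact DFunLike.congr_fun h u

theorem exists_creMul_eq_zero (v : σ → ℂ) (F : Polynomial (MvPolynomial σ ℂ)) :
    ∃ B : ℤ, ∀ M, B ≤ M → creMul v M F = 0 := by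
  induction F using Polynomial.induction_on' with
  | add p q hp hq =>
    obtain ⟨A, hA⟩ := hp
    obtain ⟨B, hB⟩ := hq
    exact ⟨max A B, fun M hM => by rw [map_add, hA M (by omega), hB M (by omega), add_zero]⟩
  | monomial j a =>
    exact ⟨j + 1, fun M hM => by rw [creMul_monomial, creCoeff_of_neg v (by omega), zero_mul]⟩

theorem finite_creMul_mul (φ : MvPolynomial σ ℂ →ₗ[ℂ] ℂ) (ψ : MvPolynomial ρ ℂ →ₗ[ℂ] ℂ)
    (v : σ → ℂ) (w : ρ → ℂ) (M : ℤ) (F : Polynomial (MvPolynomial σ ℂ))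
    (G : Polynomial (MvPolynomial ρ ℂ)) :
    (fun m => φ (creMul v m F) * ψ (creMul w (M - m) G)).HasFiniteSupport := by
  obtain ⟨A, hA⟩ := exists_creMul_eq_zero v F
  obtain ⟨B, hB⟩ := exists_creMul_eq_zero w G
  refine finite_support_of_bounds (A := M - B) (B := A) (fun m hm => ?_) fun m hm => ?_
  · rw [hB _ (by omega), map_zero, mul_zero]
  · rw [hA _ hm, map_zero, zero_mul]

theorem dual_separate_creMul (f : MvPowerSeries σ ℂ) (g : MvPowerSeries ρ ℂ) (v : σ → ℂ)
    (w : ρ → ℂ) (M : ℤ) (F : Polynomial (MvPolynomial σ ℂ)) (G : Polynomial (MvPolynomial ρ ℂ)) :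
    dual (separate f g) (creMul (Sum.elim v w) M
      (Polynomial.mapAlgHom (MvPolynomial.rename Sum.inl : _ →ₐ[ℂ] _) F *
        Polynomial.mapAlgHom (MvPolynomial.rename Sum.inr : _ →ₐ[ℂ] _) G)) =
      ∑ᶠ m, dual f (creMul v m F) * dual g (creMul w (M - m) G) := by
  induction F using Polynomial.induction_on' with
  | add p q hp hq =>
    simp only [map_add, add_mul, hp, hq]
    rw [finsum_add_distrib (finite_creMul_mul _ _ _ _ _ _ _) (finite_creMul_mul _ _ _ _ _ _ _)]
  | monomial a p =>
    induction G using Polynomial.induction_on' with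
    | add r s hr hs =>
      simp only [map_add, mul_add, hr, hs]
      rw [finsum_add_distrib (finite_creMul_mul _ _ _ _ _ _ _) (finite_creMul_mul _ _ _ _ _ _ _)]
    | monomial b r =>
      simp only [Polynomial.coe_mapAlgHom, Polynomial.map_monomial, Polynomial.monomial_mul_monomial,
        creMul_monomial]
      by_cases hN : (a : ℤ) + b - M < 0
      · rw [creCoeff_of_neg _ (by push_cast; omega), zero_mul, map_zero]
        symm
        rw [← finsum_zero (α := ℤ)]
        refine finsum_congr fun m => ?_
        by_cases hm : (a : ℤ) - m < 0
        · rw [creCoeff_of_neg v hm, zero_mul, map_zero, zero_mul]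
        · rw [creCoeff_of_neg w (by omega), zero_mul, map_zero, mul_zero]
      · obtain ⟨N, hN⟩ := Int.eq_ofNat_of_zero_le (not_lt.mp hN)
        rw [finsum_eq_sum_window _ a (N + 1)]
        · rw [show ((a + b : ℕ) : ℤ) - M = N by push_cast; exact hN, creCoeff_sumElim,
            Finset.sum_mul, map_sum]
          refine Finset.sum_congr rfl fun k hk => ?_
          have hk := Finset.mem_range.mp hk
          rw [sub_sub_cancel, show (b : ℤ) - (M - (a - k)) = ((N - k : ℕ) : ℤ) by omega,
            ← dual_separate]
          refine congrArg (dual (separate f g)) ?_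
          rw [map_mul, map_mul]
          exact mul_mul_mul_comm _ _ _ _
        · intro m hm
          rw [creCoeff_of_neg v (by omega), zero_mul, map_zero, zero_mul]
        · intro m hm
          rw [creCoeff_of_neg w (by push_cast at hm; omega), zero_mul, map_zero, mul_zero]

/-- A vertex operator in separate times is a sum of products of vertex operators. -/
theorem dual_separate_vertex (f : MvPowerSeries σ ℂ) (g : MvPowerSeries ρ ℂ) (v : σ → ℂ)
    (w : ρ → ℂ) (M : ℤ) (u : MvPolynomial σ ℂ) (u' : MvPolynomial ρ ℂ) :
    dual (separate f g) (vertex (Sum.elim v w) M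
      (MvPolynomial.rename Sum.inl u * MvPolynomial.rename Sum.inr u')) =
      ∑ᶠ m, dual f (vertex v m u) * dual g (vertex w (M - m) u') := by
  rw [vertex_apply, map_mul, shift_rename_inl, shift_rename_inr, dual_separate_creMul]
  rfl

end VertexSeparate

/-! ### The bilinear equations in terms of vertex operators -/

section Bilinear

theorem lift_sub_bracket {ρ : Type} (x : ℕ+ → MvPowerSeries ρ ℂ) :
    lift x - bracket = shiftedTime (constVec 1) x := by
  ext1 k
  rw [Pi.sub_apply, shiftedTime, constVec]
  simp only [Units.val_one, Int.cast_one, one_mul]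
  rfl

theorem lift_add_bracket {ρ : Type} (x : ℕ+ → MvPowerSeries ρ ℂ) :
    lift x + bracket = shiftedTime (constVec (-1)) x := by
  ext1 k
  rw [Pi.add_apply, shiftedTime, constVec]
  simp only [Units.val_neg, Units.val_one, Int.cast_neg, Int.cast_one, neg_mul, one_mul, neg_smul,
    sub_neg_eq_add]
  rfl

theorem lift_eq_shiftedTime {ρ : Type} (x : ℕ+ → MvPowerSeries ρ ℂ) :
    lift x = shiftedTime 0 x := by
  ext1 k
  rw [shiftedTime, Pi.zero_apply, zero_mul, zero_smul, sub_zero]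
  rfl

variable {σ ρ π : Type} [TimeIndex σ] [TimeIndex ρ]

theorem sumElim_shiftedTime (v : σ → ℂ) (w : ρ → ℂ) (x : σ → MvPowerSeries π ℂ)
    (y : ρ → MvPowerSeries π ℂ) : Sum.elim (shiftedTime v x) (shiftedTime w y) =
      shiftedTime (Sum.elim v w) (Sum.elim x y) := by
  ext1 (q | q) <;> rfl

theorem coeff_res_mul {x : σ → MvPowerSeries π ℂ} {y : ρ → MvPowerSeries π ℂ} (hx : HasSubst x)
    (hy : HasSubst y) {Q : (π →₀ ℕ) → MvPolynomial (σ ⊕ ρ) ℂ} (hQ : IsTest (Sum.elim x y) Q)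
    {v : σ → ℂ} {w : ρ → ℂ} {u : ℕ+ → MvPowerSeries π ℂ}
    (hu : ∀ k : ℕ+, u k = ∑ q ∈ fiber σ k, v q • x q + ∑ q ∈ fiber ρ k, w q • y q)
    (f : MvPowerSeries σ ℂ) (g : MvPowerSeries ρ ℂ) (m : ℤ) (e : π →₀ ℕ) :
    coeff e (res m (f.subst (shiftedTime v x) * g.subst (shiftedTime w y)) u) =
      dual (separate f g) (vertex (Sum.elim v w) (-1 - m) (Q e)) := by
  rw [← subst_separate f g (hasSubst_shiftedTime v hx) (hasSubst_shiftedTime w hy),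
    sumElim_shiftedTime, coeff_res (hasSubst_sumElim hx hy) hQ]
  intro k
  rw [hu, sum_fiber_sum]
  rfl

theorem isTest_X {ι : Type} :
    IsTest (X : ι → MvPowerSeries ι ℂ) fun e => MvPolynomial.monomial e (mfact e)⁻¹ := by
  classical
  intro e D
  have h : (D.prod fun q n => (X q : MvPowerSeries ι ℂ) ^ n) = monomial D 1 := by
    rw [monomial_one_eq]
  rw [h, coeff_monomial, MvPolynomial.coeff_monomial]
  by_cases hD : e = D
  · rw [if_pos hD, if_pos hD, hD, mul_inv_cancel₀ (mfact_ne_zero D)]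
  · rw [if_neg hD, if_neg hD, mul_zero]

theorem linearMap_ext_isTest_X {ι M : Type*} [AddCommGroup M] [Module ℂ M]
    {φ ψ : MvPolynomial ι ℂ →ₗ[ℂ] M} {c : (ι →₀ ℕ) → ℂ} (hc : ∀ e, c e ≠ 0)
    (h : ∀ e, φ (MvPolynomial.monomial e (c e)) = ψ (MvPolynomial.monomial e (c e))) : φ = ψ := by
  refine (MvPolynomial.basisMonomials ι ℂ).ext fun e => ?_
  have h2 := h e
  rw [← mul_one (c e), ← smul_eq_mul, ← MvPolynomial.smul_monomial, map_smul, map_smul] at h2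
  rw [MvPolynomial.coe_basisMonomials]
  exact smul_right_injective M (hc e) h2

/-- The bilinear equation of the large BKP hierarchy on products of polynomials in the two families
of times. -/
theorem IsLargeBKPTau.dual_vertex {τ : ℤ → MvPowerSeries ℕ+ ℂ} (hτ : IsLargeBKPTau τ) (a b : ℤ)
    (u w : MvPolynomial ℕ+ ℂ) :
    ∑ᶠ m, dual (τ (a - 1)) (vertex (constVec 1) m u) *
        dual (τ (b + 1)) (vertex (constVec (-1)) (b - a + 1 - m) w) +
      ∑ᶠ m, dual (τ (a + 1)) (vertex (constVec (-1)) m u) *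
        dual (τ (b - 1)) (vertex (constVec 1) (a - b + 1 - m) w) =
      ((1 / 2 : ℂ) * (1 - (-1) ^ (a + b))) * (dual (τ a) u * dual (τ b) w) := by
  rw [← dual_separate_vertex, ← dual_separate_vertex, ← dual_separate]
  generalize MvPolynomial.rename Sum.inl u * MvPolynomial.rename Sum.inr w = U
  suffices h : dual (separate (τ (a - 1)) (τ (b + 1))) ∘ₗ
        vertex (Sum.elim (constVec 1) (constVec (-1))) (b - a + 1) +
      dual (separate (τ (a + 1)) (τ (b - 1))) ∘ₗ
        vertex (Sum.elim (constVec (-1)) (constVec 1)) (a - b + 1) =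
      ((1 / 2 : ℂ) * (1 - (-1) ^ (a + b))) • dual (separate (τ a) (τ b)) from
    DFunLike.congr_fun h U
  refine linearMap_ext_isTest_X (fun e => inv_ne_zero (mfact_ne_zero e)) fun e => ?_
  have hQ : IsTest (Sum.elim fstTime sndTime)
      fun e : ℕ+ ⊕ ℕ+ →₀ ℕ => MvPolynomial.monomial e (mfact e)⁻¹ := by
    have h : Sum.elim fstTime sndTime = (X : ℕ+ ⊕ ℕ+ → MvPowerSeries (ℕ+ ⊕ ℕ+) ℂ) := by
      ext1 (q | q) <;> rfl
    rw [h]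
    exact isTest_X
  have h1 : HasSubst fstTime :=
    HasSubst.X_comp (Function.Embedding.inl : ℕ+ ↪ ℕ+ ⊕ ℕ+)
  have h2 : HasSubst sndTime :=
    HasSubst.X_comp (Function.Embedding.inr : ℕ+ ↪ ℕ+ ⊕ ℕ+)
  have h := congrArg (coeff e) (hτ.bilinear a b)
  rw [map_add, lift_sub_bracket, lift_sub_bracket, lift_add_bracket, lift_add_bracket,
    coeff_res_mul h1 h2 hQ, coeff_res_mul h1 h2 hQ, coeff_smul, ← subst_separate _ _ h1 h2,
    hQ.coeff_subst (hasSubst_sumElim h1 h2), show -1 - (a - b - 2) = b - a + 1 by ring,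
    show -1 - (b - a - 2) = a - b + 1 by ring] at h
  · exact h
  · intro k
    rw [fiber_pnat]
    simp only [constVec, Finset.sum_singleton, Units.val_neg, Units.val_one, Int.cast_neg,
      Int.cast_one, neg_smul, one_smul]
    exact (neg_sub (fstTime k) (sndTime k)).trans (sub_eq_neg_add _ _)
  · intro k
    rw [fiber_pnat]
    simp [constVec, sub_eq_add_neg]

/-- The vector which is constant on the first family of times and zero on the second. -/
def xVec (s : ℤˣ) : ℕ+ ⊕ ℕ+ → ℂ := Sum.elim (constVec s) 0

/-- The vector which is constant on the second family of times and zero on the first. -/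
def yVec (s : ℤˣ) : ℕ+ ⊕ ℕ+ → ℂ := Sum.elim 0 (constVec s)

theorem evalXY_lift_sub (f : MvPowerSeries (ℕ+ ⊕ ℕ+) ℂ) (x y : ℕ+ → MvPowerSeries π ℂ) :
    evalXY f (lift x - bracket) (lift y) = f.subst (shiftedTime (xVec 1) (Sum.elim x y)) := by
  rw [evalXY, lift_sub_bracket, lift_eq_shiftedTime, sumElim_shiftedTime, xVec]

theorem evalXY_lift_add (f : MvPowerSeries (ℕ+ ⊕ ℕ+) ℂ) (x y : ℕ+ → MvPowerSeries π ℂ) :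
    evalXY f (lift x + bracket) (lift y) = f.subst (shiftedTime (xVec (-1)) (Sum.elim x y)) := by
  rw [evalXY, lift_add_bracket, lift_eq_shiftedTime, sumElim_shiftedTime, xVec]

theorem evalXY_lift_lift_sub (f : MvPowerSeries (ℕ+ ⊕ ℕ+) ℂ) (x y : ℕ+ → MvPowerSeries π ℂ) :
    evalXY f (lift x) (lift y - bracket) = f.subst (shiftedTime (yVec 1) (Sum.elim x y)) := by
  rw [evalXY, lift_sub_bracket, lift_eq_shiftedTime, sumElim_shiftedTime, yVec]

theorem evalXY_lift_lift_add (f : MvPowerSeries (ℕ+ ⊕ ℕ+) ℂ) (x y : ℕ+ → MvPowerSeries π ℂ) :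
    evalXY f (lift x) (lift y + bracket) = f.subst (shiftedTime (yVec (-1)) (Sum.elim x y)) := by
  rw [evalXY, lift_add_bracket, lift_eq_shiftedTime, sumElim_shiftedTime, yVec]

variable {x y x' y' : ℕ+ → MvPowerSeries π ℂ}

theorem coeff_res_xVec (hx : HasSubst x) (hy : HasSubst y) (hx' : HasSubst x') (hy' : HasSubst y')
    {Q : (π →₀ ℕ) → MvPolynomial ((ℕ+ ⊕ ℕ+) ⊕ (ℕ+ ⊕ ℕ+)) ℂ}
    (hQ : IsTest (Sum.elim (Sum.elim x y) (Sum.elim x' y')) Q)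
    (f g : MvPowerSeries (ℕ+ ⊕ ℕ+) ℂ) (m : ℤ) (e : π →₀ ℕ) :
    coeff e (res m (evalXY f (lift x - bracket) (lift y) *
      evalXY g (lift x' + bracket) (lift y')) (x - x')) =
      dual (separate f g) (vertex (Sum.elim (xVec 1) (xVec (-1))) (-1 - m) (Q e)) := by
  rw [evalXY_lift_sub, evalXY_lift_add,
    coeff_res_mul (hasSubst_sumElim hx hy) (hasSubst_sumElim hx' hy') hQ]
  intro k
  rw [sum_fiber_sum, sum_fiber_sum, fiber_pnat]
  simp [xVec, constVec, sub_eq_add_neg]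

theorem coeff_res_yVec (hx : HasSubst x) (hy : HasSubst y) (hx' : HasSubst x') (hy' : HasSubst y')
    {Q : (π →₀ ℕ) → MvPolynomial ((ℕ+ ⊕ ℕ+) ⊕ (ℕ+ ⊕ ℕ+)) ℂ}
    (hQ : IsTest (Sum.elim (Sum.elim x y) (Sum.elim x' y')) Q)
    (f g : MvPowerSeries (ℕ+ ⊕ ℕ+) ℂ) (m : ℤ) (e : π →₀ ℕ) :
    coeff e (res m (evalXY f (lift x) (lift y - bracket) *
      evalXY g (lift x') (lift y' + bracket)) (y - y')) =
      dual (separate f g) (vertex (Sum.elim (yVec 1) (yVec (-1))) (-1 - m) (Q e)) := by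
  rw [evalXY_lift_lift_sub, evalXY_lift_lift_add,
    coeff_res_mul (hasSubst_sumElim hx hy) (hasSubst_sumElim hx' hy') hQ]
  intro k
  rw [sum_fiber_sum, sum_fiber_sum, fiber_pnat]
  simp [yVec, constVec, sub_eq_add_neg]

theorem mTodaEq_of_dual {σ₀ σ₁ : ℤ → MvPowerSeries (ℕ+ ⊕ ℕ+) ℂ} {n n' : ℤ}
    (h : ∀ u w, ∑ᶠ m, dual (σ₀ n) (vertex (xVec 1) m u) *
        dual (σ₁ n') (vertex (xVec (-1)) (n' - n - m) w) +
      ∑ᶠ m, dual (σ₀ (n + 1)) (vertex (yVec 1) m u) *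
        dual (σ₁ (n' - 1)) (vertex (yVec (-1)) (n - n' + 1 - m) w) =
      dual (σ₁ n) u * dual (σ₀ n') w)
    (hx : HasSubst x) (hy : HasSubst y) (hx' : HasSubst x') (hy' : HasSubst y') :
    MTodaEq σ₀ σ₁ x y x' y' n n' := by
  have h1 : dual (separate (σ₀ n) (σ₁ n')) ∘ₗ vertex (Sum.elim (xVec 1) (xVec (-1))) (n' - n) +
      dual (separate (σ₀ (n + 1)) (σ₁ (n' - 1))) ∘ₗ
        vertex (Sum.elim (yVec 1) (yVec (-1))) (n - n' + 1) =
      dual (separate (σ₁ n) (σ₀ n')) := by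
    refine linearMap_ext_separate fun u w => ?_
    rw [LinearMap.add_apply, LinearMap.comp_apply, LinearMap.comp_apply, dual_separate_vertex,
      dual_separate_vertex, dual_separate, h]
  have hxy := hasSubst_sumElim hx hy
  have hxy' := hasSubst_sumElim hx' hy'
  obtain ⟨Q, hQ⟩ := exists_isTest (hasSubst_sumElim hxy hxy')
  rw [MTodaEq]
  ext e
  rw [map_add, coeff_res_xVec hx hy hx' hy' hQ, coeff_res_yVec hx hy hx' hy' hQ, evalXY, evalXY,
    ← subst_separate _ _ hxy hxy', hQ.coeff_subst (hasSubst_sumElim hxy hxy'), ← h1,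
    show -1 - (n - n' - 1) = n' - n by ring, show -1 - (n' - n - 2) = n - n' + 1 by ring]
  rfl

theorem todaEq_of_dual {σ : ℤ → MvPowerSeries (ℕ+ ⊕ ℕ+) ℂ} {n n' : ℤ}
    (h : ∀ u w, ∑ᶠ m, dual (σ n) (vertex (xVec 1) m u) *
        dual (σ (n' + 1)) (vertex (xVec (-1)) (n' - n - m) w) =
      ∑ᶠ m, dual (σ (n + 1)) (vertex (yVec 1) m u) *
        dual (σ n') (vertex (yVec (-1)) (n - n' - m) w))
    (hx : HasSubst x) (hy : HasSubst y) (hx' : HasSubst x') (hy' : HasSubst y') :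
    TodaEq σ x y x' y' n n' := by
  have h1 : dual (separate (σ n) (σ (n' + 1))) ∘ₗ vertex (Sum.elim (xVec 1) (xVec (-1))) (n' - n) =
      dual (separate (σ (n + 1)) (σ n')) ∘ₗ
        vertex (Sum.elim (yVec 1) (yVec (-1))) (n - n') := by
    refine linearMap_ext_separate fun u w => ?_
    rw [LinearMap.comp_apply, LinearMap.comp_apply, dual_separate_vertex,
      dual_separate_vertex, h]
  obtain ⟨Q, hQ⟩ := exists_isTest
    (hasSubst_sumElim (hasSubst_sumElim hx hy) (hasSubst_sumElim hx' hy'))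
  rw [TodaEq]
  ext e
  rw [coeff_res_xVec hx hy hx' hy' hQ, coeff_res_yVec hx hy hx' hy' hQ,
    show -1 - (n - n' - 1) = n' - n by ring, show -1 - (n' - n - 1) = n - n' by ring]
  exact DFunLike.congr_fun h1 (Q e)

end Bilinear

/-! ### The bilinear equation on the Fock space -/

section FockBilinear

/-- The functional on the Fock space given by a family of power series. -/
def tauFock (τ : ℤ → MvPowerSeries ℕ+ ℂ) : Fock →ₗ[ℂ] ℂ := Finsupp.lsum ℂ fun a => dual (τ a)

theorem tauFock_single (τ : ℤ → MvPowerSeries ℕ+ ℂ) (a : ℤ) (u : MvPolynomial ℕ+ ℂ) :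
    tauFock τ (Finsupp.single a u) = dual (τ a) u := by
  simp [tauFock]

theorem finite_tau_psi (T : Fock →ₗ[ℂ] ℂ) (s t : ℤˣ) (x y : Fock) :
    (fun m => T (psi s m x) * T (psi t (-1 - m) y)).HasFiniteSupport := by
  obtain ⟨A, hA⟩ := exists_psi_eq_zero x
  obtain ⟨B, hB⟩ := exists_psi_eq_zero y
  refine finite_support_of_bounds (A := -1 - B) (B := A) (fun m hm => ?_) fun m hm => ?_
  · rw [hB t _ (by omega), map_zero, mul_zero]
  · rw [hA s _ hm, map_zero, zero_mul]

/-- The operator `∑_m (ψ_m ⊗ ψ*_{-1-m} + ψ*_m ⊗ ψ_{-1-m})` followed by the functional `T ⊗ T`. -/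
def fermionForm (T : Fock →ₗ[ℂ] ℂ) (x y : Fock) : ℂ :=
  ∑ᶠ m, T (psi 1 m x) * T (psi (-1) (-1 - m) y) + ∑ᶠ m, T (psi (-1) m x) * T (psi 1 (-1 - m) y)

theorem fermionForm_add_left (T : Fock →ₗ[ℂ] ℂ) (x x' y : Fock) :
    fermionForm T (x + x') y = fermionForm T x y + fermionForm T x' y := by
  simp only [fermionForm, map_add, add_mul]
  rw [finsum_add_distrib (finite_tau_psi _ _ _ _ _) (finite_tau_psi _ _ _ _ _),
    finsum_add_distrib (finite_tau_psi _ _ _ _ _) (finite_tau_psi _ _ _ _ _)]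
  ring

theorem fermionForm_add_right (T : Fock →ₗ[ℂ] ℂ) (x y y' : Fock) :
    fermionForm T x (y + y') = fermionForm T x y + fermionForm T x y' := by
  simp only [fermionForm, map_add, mul_add]
  rw [finsum_add_distrib (finite_tau_psi _ _ _ _ _) (finite_tau_psi _ _ _ _ _),
    finsum_add_distrib (finite_tau_psi _ _ _ _ _) (finite_tau_psi _ _ _ _ _)]
  ring

/-- The bilinear equation of the large BKP hierarchy on the Fock space. -/
theorem fermionForm_tauFock {τ : ℤ → MvPowerSeries ℕ+ ℂ} (hτ : IsLargeBKPTau τ) (x y : Fock) :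
    fermionForm (tauFock τ) x y = (1 / 2 : ℂ) *
      (tauFock τ x * tauFock τ y - tauFock τ (parity x) * tauFock τ (parity y)) := by
  induction x using Finsupp.induction_linear with
  | zero => simp [fermionForm]
  | add x x' hx hx' => rw [fermionForm_add_left, hx, hx']; simp only [map_add]; ring
  | single a u =>
    induction y using Finsupp.induction_linear with
    | zero => simp [fermionForm]
    | add y y' hy hy' => rw [fermionForm_add_right, hy, hy']; simp only [map_add]; ring
    | single b w =>
      have h := hτ.dual_vertex a b u w
      have h1 : ∑ᶠ m, dual (τ (a - 1)) (vertex (constVec 1) (m - 1 * a + 1) u) *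
            dual (τ (b + 1)) (vertex (constVec (-1)) (-1 - m - -1 * b + 1) w) =
          ∑ᶠ m, dual (τ (a - 1)) (vertex (constVec 1) m u) *
            dual (τ (b + 1)) (vertex (constVec (-1)) (b - a + 1 - m) w) := by
        symm
        rw [← finsum_comp_equiv (Equiv.addRight (-a + 1))]
        refine finsum_congr fun m => ?_
        rw [Equiv.coe_addRight]
        congr 4 <;> ring
      have h2 : ∑ᶠ m, dual (τ (a + 1)) (vertex (constVec (-1)) (m - -1 * a + 1) u) *
            dual (τ (b - 1)) (vertex (constVec 1) (-1 - m - 1 * b + 1) w) =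
          ∑ᶠ m, dual (τ (a + 1)) (vertex (constVec (-1)) m u) *
            dual (τ (b - 1)) (vertex (constVec 1) (a - b + 1 - m) w) := by
        symm
        rw [← finsum_comp_equiv (Equiv.addRight (a + 1))]
        refine finsum_congr fun m => ?_
        rw [Equiv.coe_addRight]
        congr 4 <;> ring
      simp only [fermionForm, psi_single, tauFock_single, parity_single, map_smul, smul_eq_mul,
        Units.val_neg, Units.val_one, sub_neg_eq_add b, sub_neg_eq_add a]
      rw [h1, h2, h, zpow_add₀ (by norm_num)]
      ring

/-- The functional `T ⊗ T` on the square of the Fock space. -/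
def square (T : Fock →ₗ[ℂ] ℂ) : Fock2 →ₗ[ℂ] ℂ :=
  TensorProduct.lift ((LinearMap.mul ℂ ℂ).compl₁₂ T T)

theorem square_tm (T : Fock →ₗ[ℂ] ℂ) (x y : Fock) : square T (tm x y) = T x * T y := by
  simp only [square, tm]
  exact TensorProduct.lift.tmul _ _

theorem Fock2.induction_on {p : Fock2 → Prop} (x : Fock2) (zero : p 0) (tm : ∀ x y, p (tm x y))
    (add : ∀ x y, p x → p y → p (x + y)) : p x :=
  TensorProduct.induction_on x zero tm add

/-- The sum of the parities of the charges of the two factors. -/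
def parity2 : Fock2 →ₗ[ℂ] Fock2 := parity.rTensor Fock + parity.lTensor Fock

theorem parity2_tm (x y : Fock) : parity2 (tm x y) = tm (parity x) y + tm x (parity y) := rfl

theorem finite_square_sum (φ : Fock2 →ₗ[ℂ] ℂ) (s t : ℤˣ) (x y : Fock2) :
    (fun m => φ (fockPair.sum s m x) * φ (fockPair.sum t (-1 - m) y)).HasFiniteSupport := by
  obtain ⟨A, hA⟩ := fockPair.exists_sum_eq_zero x
  obtain ⟨B, hB⟩ := fockPair.exists_sum_eq_zero y
  refine finite_support_of_bounds (A := -1 - B) (B := A) (fun m hm => ?_) fun m hm => ?_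
  · rw [hB t _ (by omega), map_zero, mul_zero]
  · rw [hA s _ hm, map_zero, zero_mul]

/-- The operator `∑_m (Ψ_m ⊗ Ψ*_{-1-m} + Ψ*_m ⊗ Ψ_{-1-m})` followed by the functional `φ ⊗ φ`,
where `Ψ` is the sum of the fermions of the two factors. -/
def fermionForm2 (φ : Fock2 →ₗ[ℂ] ℂ) (x y : Fock2) : ℂ :=
  ∑ᶠ m, φ (fockPair.sum 1 m x) * φ (fockPair.sum (-1) (-1 - m) y) +
    ∑ᶠ m, φ (fockPair.sum (-1) m x) * φ (fockPair.sum 1 (-1 - m) y)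

theorem fermionForm2_add_left (φ : Fock2 →ₗ[ℂ] ℂ) (x x' y : Fock2) :
    fermionForm2 φ (x + x') y = fermionForm2 φ x y + fermionForm2 φ x' y := by
  simp only [fermionForm2, map_add, add_mul]
  rw [finsum_add_distrib (finite_square_sum _ _ _ _ _) (finite_square_sum _ _ _ _ _),
    finsum_add_distrib (finite_square_sum _ _ _ _ _) (finite_square_sum _ _ _ _ _)]
  ring

theorem fermionForm2_add_right (φ : Fock2 →ₗ[ℂ] ℂ) (x y y' : Fock2) :
    fermionForm2 φ x (y + y') = fermionForm2 φ x y + fermionForm2 φ x y' := by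
  simp only [fermionForm2, map_add, mul_add]
  rw [finsum_add_distrib (finite_square_sum _ _ _ _ _) (finite_square_sum _ _ _ _ _),
    finsum_add_distrib (finite_square_sum _ _ _ _ _) (finite_square_sum _ _ _ _ _)]
  ring

theorem finsum_square_tm (T : Fock →ₗ[ℂ] ℂ) (s t : ℤˣ) (x₁ x₂ y₁ y₂ : Fock) :
    ∑ᶠ m, square T (fockPair.sum s m (tm x₁ x₂)) * square T (fockPair.sum t (-1 - m) (tm y₁ y₂)) =
      (∑ᶠ m, T (psi s m x₁) * T (psi t (-1 - m) y₁)) * (T x₂ * T y₂) +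
      (∑ᶠ m, T (psi s m x₁) * T (psi t (-1 - m) y₂)) * (T x₂ * T y₁) +
      (∑ᶠ m, T (psi s m x₂) * T (psi t (-1 - m) y₁)) * (T x₁ * T y₂) +
      (∑ᶠ m, T (psi s m x₂) * T (psi t (-1 - m) y₂)) * (T x₁ * T y₁) := by
  have hf : ∀ (x y : Fock) (c : ℂ),
      (fun m => T (psi s m x) * T (psi t (-1 - m) y) * c).HasFiniteSupport := fun x y c =>
    (finite_tau_psi T s t x y).subset fun m hm h => hm (by
      dsimp only at h ⊢
      rw [h, zero_mul])
  have ha : ∀ (x x' y y' : Fock) (c c' : ℂ), (fun m => T (psi s m x) * T (psi t (-1 - m) y) * c +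
      T (psi s m x') * T (psi t (-1 - m) y') * c').HasFiniteSupport := fun x x' y y' c c' =>
    (hf x y c).add (hf x' y' c')
  rw [finsum_mul, finsum_mul, finsum_mul, finsum_mul, add_assoc, ← finsum_add_distrib (hf _ _ _) (hf _ _ _),
    ← finsum_add_distrib (hf _ _ _) (hf _ _ _),
    ← finsum_add_distrib (ha _ _ _ _ _ _) (ha _ _ _ _ _ _)]
  refine finsum_congr fun m => ?_
  simp only [sum_tm, map_add, square_tm]
  ring

/-- On products, the left side has four terms, in each of which the fermions act on one factor of `x`
and on one factor of `y`. The bilinear equation applies to each of them; the four terms with parities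
are those of the product of the values at `parity2 x` and `parity2 y`. -/
theorem fermionForm2_square {τ : ℤ → MvPowerSeries ℕ+ ℂ} (hτ : IsLargeBKPTau τ) (x y : Fock2) :
    fermionForm2 (square (tauFock τ)) x y = 2 * (square (tauFock τ) x * square (tauFock τ) y) -
      (1 / 2 : ℂ) * (square (tauFock τ) (parity2 x) * square (tauFock τ) (parity2 y)) := by
  induction x using Fock2.induction_on with
  | zero => simp [fermionForm2]
  | add x x' hx hx' => rw [fermionForm2_add_left, hx, hx']; simp only [map_add]; ring
  | tm x₁ x₂ =>
    induction y using Fock2.induction_on with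
    | zero => simp [fermionForm2]
    | add y y' hy hy' => rw [fermionForm2_add_right, hy, hy']; simp only [map_add]; ring
    | tm y₁ y₂ =>
      have h := fermionForm_tauFock hτ
      simp only [fermionForm] at h
      rw [fermionForm2, finsum_square_tm, finsum_square_tm]
      simp only [parity2_tm, map_add, square_tm]
      linear_combination (tauFock τ x₂ * tauFock τ y₂) * h x₁ y₁ +
        (tauFock τ x₂ * tauFock τ y₁) * h x₁ y₂ + (tauFock τ x₁ * tauFock τ y₂) * h x₂ y₁ +
        (tauFock τ x₁ * tauFock τ y₁) * h x₂ y₂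

/-! ### The parity on the square of the Fock space -/

theorem parity2_total (k : ℕ+) (x : Fock2) :
    parity2 (fockPair.total k x) = fockPair.total k (parity2 x) := by
  induction x using Fock2.induction_on with
  | zero => simp
  | add x y hx hy => simp only [map_add, hx, hy]
  | tm x y =>
    simp only [total_tm, parity2_tm, map_add, parity_boson]
    abel

theorem parity2_left_right (s t : ℤˣ) (m n : ℤ) (x : Fock2) :
    parity2 (fockPair.left s m (fockPair.right t n x)) =
      -fockPair.left s m (fockPair.right t n (parity2 x)) := by
  induction x using Fock2.induction_on with
  | zero => simp
  | add x y hx hy => simp only [map_add, hx, hy, neg_add]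
  | tm x y =>
    simp only [left_tm, right_tm, parity2_tm, map_add, parity_psi, map_neg, LinearMap.neg_apply,
      neg_add]

theorem parity2_current (k : ℕ+) (x : Fock2) :
    parity2 (fockPair.current k x) = -fockPair.current k (parity2 x) := by
  have h : ∀ s, parity2 (fockPair.halfCurrent s k x) = -fockPair.halfCurrent s k (parity2 x) := by
    intro s
    rw [FermionPair.halfCurrent_apply, FermionPair.halfCurrent_apply,
      FermionPair.map_finsum_end _ (fockPair.finite_left_right' _ _ _ _), ← finsum_neg_distrib]
    exact finsum_congr fun m => parity2_left_right _ _ _ _ _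
  rw [FermionPair.current, LinearMap.add_apply, map_add, h, h, LinearMap.add_apply, neg_add]

theorem parity2_mixed (κ : ℤˣ) (i : ℕ+ ⊕ ℕ+) (x : Fock2) :
    parity2 (fockPair.mixed κ i x) = fockPair.mixed (-κ) i (parity2 x) := by
  rcases i with k | k <;>
  · simp only [FermionPair.mixed, Sum.elim_inl, Sum.elim_inr, LinearMap.smul_apply,
      LinearMap.add_apply, LinearMap.neg_apply, map_smul, map_add, map_neg, parity2_total,
      parity2_current, Units.val_neg, Int.cast_neg]
    module

theorem parity2_act (κ : ℤˣ) (u : MvPolynomial (ℕ+ ⊕ ℕ+) ℂ) (x : Fock2) :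
    parity2 (fockPair.act κ u x) = fockPair.act (-κ) u (parity2 x) := by
  induction u using MvPolynomial.induction_on generalizing x with
  | C a =>
    rw [← MvPolynomial.algebraMap_eq, AlgHom.commutes, AlgHom.commutes,
      Module.algebraMap_end_apply, Module.algebraMap_end_apply, map_smul]
  | add p q hp hq => simp only [map_add, LinearMap.add_apply, hp, hq]
  | mul_X p i hp =>
    rw [map_mul, map_mul, Module.End.mul_apply, Module.End.mul_apply, hp,
      FermionPair.act_X, FermionPair.act_X, parity2_mixed]

/-- The two charges have opposite parities. -/
theorem parity2_vac2 (a : ℤ) : parity2 (vac2 (a - 1) a) = 0 := by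
  have h : ∀ b, parity (vac b) = (-1 : ℂ) ^ b • vac b := fun b => parity_single b 1
  rw [vac2, map_add, parity2_tm, parity2_tm, h, h, zpow_sub₀ (by norm_num)]
  simp only [map_smul, LinearMap.smul_apply]
  module

end FockBilinear

/-! ### The mToda equation -/

section MToda

theorem chargeVec_eq_xVec (s : ℤˣ) : FermionPair.chargeVec (-s) s = xVec s := by
  ext1 (k | k) <;>
  · simp only [FermionPair.chargeVec, xVec, constVec, Sum.elim_inl, Sum.elim_inr, Units.val_neg,
      Int.cast_neg, Pi.zero_apply]
    ring

theorem chargeVec_eq_yVec (s : ℤˣ) : FermionPair.chargeVec s s = yVec (-s) := by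
  ext1 (k | k) <;>
  · simp only [FermionPair.chargeVec, yVec, constVec, Sum.elim_inl, Sum.elim_inr, Units.val_neg,
      Int.cast_neg, Pi.zero_apply]
    ring

theorem vac2_comm (a b : ℤ) : vac2 a b = vac2 b a := add_comm _ _

variable (T : Fock →ₗ[ℂ] ℂ)

/-- The mToda equation for two families of functionals on polynomials. It implies the equation for
the corresponding families of power series by `mTodaEq_of_dual`. -/
def IsMTodaPair (F G : ℤ → MvPolynomial (ℕ+ ⊕ ℕ+) ℂ →ₗ[ℂ] ℂ) : Prop :=
  ∀ (n n' : ℤ) (u w : MvPolynomial (ℕ+ ⊕ ℕ+) ℂ),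
    ∑ᶠ m, F n (vertex (xVec 1) m u) * G n' (vertex (xVec (-1)) (n' - n - m) w) +
      ∑ᶠ m, F (n + 1) (vertex (yVec 1) m u) *
        G (n' - 1) (vertex (yVec (-1)) (n - n' + 1 - m) w) = G n u * F n' w

/-- The tau function with the value `τ_n ²` at `y = -x`, as a functional on polynomials: it comes from
a vector of even total charge. -/
def evenFun (n : ℤ) : MvPolynomial (ℕ+ ⊕ ℕ+) ℂ →ₗ[ℂ] ℂ :=
  square T ∘ₗ LinearMap.applyₗ (tm (vac n) (vac n)) ∘ₗ (fockPair.act 1).toLinearMap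

/-- The tau function with the value `τ_n τ_{n-1}` at `y = -x`, as a functional on polynomials: it comes
from a vector of odd total charge. -/
def oddFun (n : ℤ) : MvPolynomial (ℕ+ ⊕ ℕ+) ℂ →ₗ[ℂ] ℂ :=
  (2⁻¹ : ℂ) • square T ∘ₗ LinearMap.applyₗ (vac2 (n - 1) n) ∘ₗ (fockPair.act (-1)).toLinearMap

theorem square_act_tm_vac (n : ℤ) (u : MvPolynomial (ℕ+ ⊕ ℕ+) ℂ) :
    square T (fockPair.act 1 u (tm (vac n) (vac n))) = evenFun T n u := rfl

theorem square_act_vac2 (n : ℤ) (u : MvPolynomial (ℕ+ ⊕ ℕ+) ℂ) :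
    square T (fockPair.act (-1) u (vac2 (n - 1) n)) = 2 * oddFun T n u := by
  have h : oddFun T n u = 2⁻¹ * square T (fockPair.act (-1) u (vac2 (n - 1) n)) := rfl
  rw [h, mul_inv_cancel_left₀ two_ne_zero]

theorem square_sum_one_even (m n : ℤ) (u : MvPolynomial (ℕ+ ⊕ ℕ+) ℂ) :
    square T (fockPair.sum 1 m (fockPair.act 1 u (tm (vac n) (vac n)))) =
      2 * oddFun T n (vertex (xVec 1) (m - n + 1) u) := by
  have h := (isVacuumLike_tm_vac 1 n).sum_act (-1) m u
  rw [neg_neg, sum_tm_vac, chargeVec_eq_xVec, Units.val_one, one_mul, sub_sub_eq_add_sub,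
    add_sub_right_comm] at h
  rw [h, square_act_vac2]

theorem square_sum_neg_one_even (m n : ℤ) (u : MvPolynomial (ℕ+ ⊕ ℕ+) ℂ) :
    square T (fockPair.sum (-1) m (fockPair.act 1 u (tm (vac n) (vac n)))) =
      2 * oddFun T (n + 1) (vertex (yVec 1) (m + n + 1) u) := by
  have h := (isVacuumLike_tm_vac (-1) n).sum_act (-1) m u
  rw [neg_neg, sum_tm_vac, chargeVec_eq_yVec, Units.val_neg, Units.val_one, neg_neg, vac2_comm,
    sub_neg_eq_add, show m - (-1 * n - 1) = m + n + 1 by ring] at h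
  rw [h, ← square_act_vac2, add_sub_cancel_right]

theorem square_sum_one_odd (m n : ℤ) (u : MvPolynomial (ℕ+ ⊕ ℕ+) ℂ) :
    square T (fockPair.sum 1 m (fockPair.act (-1) u (vac2 (n - 1) n))) =
      2 * evenFun T (n - 1) (vertex (yVec (-1)) (m - n + 1) u) := by
  have h := (isVacuumLike_vac2 1 (n - 1)).sum_act 1 m u
  rw [sum_vac2, chargeVec_eq_yVec, Units.val_one, sub_add_cancel, one_mul, map_smul,
    show m - (n - 1) = m - n + 1 by ring] at h
  rw [h, map_smul, square_act_tm_vac, smul_eq_mul]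

theorem square_sum_neg_one_odd (m n : ℤ) (u : MvPolynomial (ℕ+ ⊕ ℕ+) ℂ) :
    square T (fockPair.sum (-1) m (fockPair.act (-1) u (vac2 (n - 1) n))) =
      2 * evenFun T n (vertex (xVec (-1)) (m + n) u) := by
  have h := (isVacuumLike_vac2 (-1) n).sum_act 1 m u
  rw [sum_vac2, ← neg_neg (1 : ℤˣ), neg_neg (-1 : ℤˣ), chargeVec_eq_xVec, Units.val_neg,
    Units.val_one, ← sub_eq_add_neg, vac2_comm, map_smul,
    neg_neg, show m - (-1 * n) = m + n by ring] at h
  rw [h, map_smul, square_act_tm_vac, smul_eq_mul]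

theorem isMTodaPair_oddFun_evenFun {τ : ℤ → MvPowerSeries ℕ+ ℂ} (hτ : IsLargeBKPTau τ) :
    IsMTodaPair (oddFun (tauFock τ)) (evenFun (tauFock τ)) := by
  intro n n' u w
  have h := fermionForm2_square hτ (fockPair.act 1 u (tm (vac n) (vac n)))
    (fockPair.act (-1) w (vac2 (n' - 1) n'))
  rw [parity2_act, parity2_act, parity2_vac2, map_zero, map_zero, mul_zero, mul_zero, sub_zero,
    square_act_tm_vac, square_act_vac2] at h
  have h1 : ∑ᶠ m, 4 * (oddFun (tauFock τ) n (vertex (xVec 1) m u) *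
        evenFun (tauFock τ) n' (vertex (xVec (-1)) (n' - n - m) w)) =
      ∑ᶠ m, square (tauFock τ) (fockPair.sum 1 m (fockPair.act 1 u (tm (vac n) (vac n)))) *
        square (tauFock τ)
          (fockPair.sum (-1) (-1 - m) (fockPair.act (-1) w (vac2 (n' - 1) n'))) := by
    rw [← finsum_comp_equiv (Equiv.addRight (-n + 1))]
    refine finsum_congr fun m => ?_
    simp only [Equiv.coe_addRight]
    rw [square_sum_one_even, square_sum_neg_one_odd,
      show m + (-n + 1) = m - n + 1 by ring, show n' - n - (m - n + 1) = -1 - m + n' by ring]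
    ring
  have h2 : ∑ᶠ m, 4 * (oddFun (tauFock τ) (n + 1) (vertex (yVec 1) m u) *
        evenFun (tauFock τ) (n' - 1) (vertex (yVec (-1)) (n - n' + 1 - m) w)) =
      ∑ᶠ m, square (tauFock τ) (fockPair.sum (-1) m (fockPair.act 1 u (tm (vac n) (vac n)))) *
        square (tauFock τ)
          (fockPair.sum 1 (-1 - m) (fockPair.act (-1) w (vac2 (n' - 1) n'))) := by
    rw [← finsum_comp_equiv (Equiv.addRight (n + 1))]
    refine finsum_congr fun m => ?_
    simp only [Equiv.coe_addRight]
    rw [square_sum_neg_one_even, square_sum_one_odd, ← add_assoc,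
      show n - n' + 1 - (m + n + 1) = -1 - m - n' + 1 by ring]
    ring
  rw [fermionForm2, ← h1, ← h2, ← mul_finsum, ← mul_finsum] at h
  linear_combination (4⁻¹ : ℂ) * h

end MToda

/-! ### From the mToda equation to the Toda equation -/

section Toda

/-- If `∑_k φ(a_k u) ψ(a'_k w) = α(u) β(w)` and `a'_k b_j` is antisymmetric in `k` and `j` under
`ψ`, then `α(u₁) ∑_j φ(a_j u₂) β(b_j w) = ∑_{j,k} φ(a_k u₁) φ(a_j u₂) ψ(a'_k b_j w)` is
antisymmetric in `u₁` and `u₂`. For `u₁ = u₂ = u₀` with `α(u₀) ≠ 0` this gives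
`∑_j φ(a_j u₀) β(b_j w) = 0`, and then for `u₁ = u₀` the same sum vanishes for all `u₂`. -/
theorem finsum_eq_zero_of_antisymm {J U W : Type*} {φ α : U → ℂ} {ψ β : W → ℂ} {a : J → U → U}
    {a' b : J → W → W}
    (h : ∀ u w, ∑ᶠ k, φ (a k u) * ψ (a' k w) = α u * β w)
    (hab : ∀ j k w, ψ (a' k (b j w)) = -ψ (a' j (b k w)))
    (hfin : ∀ u w, ∃ S : Finset J, ∀ k ∉ S, φ (a k u) = 0 ∨
      (β (b k w) = 0 ∧ ∀ j, ψ (a' j (b k w)) = 0))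
    {u₀ : U} (hu₀ : α u₀ ≠ 0) (u : U) (w : W) : ∑ᶠ j, φ (a j u) * β (b j w) = 0 := by
  classical
  have key : ∀ u₁ u₂, α u₁ * ∑ᶠ j, φ (a j u₂) * β (b j w) =
      -(α u₂ * ∑ᶠ j, φ (a j u₁) * β (b j w)) := by
    intro u₁ u₂
    obtain ⟨S₁, hS₁⟩ := hfin u₁ w
    obtain ⟨S₂, hS₂⟩ := hfin u₂ w
    have expand : ∀ v v' : U, (∀ k ∉ S₁ ∪ S₂, φ (a k v) = 0 ∨
          (β (b k w) = 0 ∧ ∀ j, ψ (a' j (b k w)) = 0)) →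
        (∀ k ∉ S₁ ∪ S₂, φ (a k v') = 0 ∨ (β (b k w) = 0 ∧ ∀ j, ψ (a' j (b k w)) = 0)) →
        α v * ∑ᶠ j, φ (a j v') * β (b j w) = ∑ j ∈ S₁ ∪ S₂, ∑ k ∈ S₁ ∪ S₂,
          φ (a j v') * (φ (a k v) * ψ (a' k (b j w))) := by
      intro v v' hv hv'
      rw [finsum_eq_sum_of_support_subset (s := S₁ ∪ S₂), Finset.mul_sum]
      · refine Finset.sum_congr rfl fun j _ => ?_
        rw [← Finset.mul_sum, mul_left_comm, ← h, finsum_eq_sum_of_support_subset (s := S₁ ∪ S₂)]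
        intro k hk
        rw [Function.mem_support] at hk
        by_contra hkS
        rcases hv k hkS with h1 | ⟨-, h1⟩
        · exact hk (by rw [h1, zero_mul])
        · exact hk (by rw [hab, h1, neg_zero, mul_zero])
      · intro k hk
        rw [Function.mem_support] at hk
        by_contra hkS
        rcases hv' k hkS with h1 | ⟨h1, -⟩
        · exact hk (by rw [h1, zero_mul])
        · exact hk (by rw [h1, mul_zero])
    have h₁ : ∀ k ∉ S₁ ∪ S₂, φ (a k u₁) = 0 ∨ (β (b k w) = 0 ∧ ∀ j, ψ (a' j (b k w)) = 0) :=
      fun k hk => hS₁ k fun h => hk (Finset.mem_union_left _ h)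
    have h₂ : ∀ k ∉ S₁ ∪ S₂, φ (a k u₂) = 0 ∨ (β (b k w) = 0 ∧ ∀ j, ψ (a' j (b k w)) = 0) :=
      fun k hk => hS₂ k fun h => hk (Finset.mem_union_right _ h)
    rw [expand u₁ u₂ h₁ h₂, expand u₂ u₁ h₂ h₁, Finset.sum_comm, ← Finset.sum_neg_distrib]
    refine Finset.sum_congr rfl fun j _ => ?_
    rw [← Finset.sum_neg_distrib]
    refine Finset.sum_congr rfl fun k _ => ?_
    rw [hab]
    ring
  have h0 : ∑ᶠ j, φ (a j u₀) * β (b j w) = 0 := by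
    have h1 := key u₀ u₀
    have h2 : α u₀ * ∑ᶠ j, φ (a j u₀) * β (b j w) = 0 := by linear_combination (2⁻¹ : ℂ) * h1
    exact (mul_eq_zero.mp h2).resolve_left hu₀
  have h1 := key u₀ u
  rw [h0, mul_zero, neg_zero] at h1
  exact (mul_eq_zero.mp h1).resolve_left hu₀

theorem finsum_sum_type {α β M : Type*} [AddCommMonoid M] {f : α ⊕ β → M}
    (hl : (fun i => f (Sum.inl i)).HasFiniteSupport)
    (hr : (fun i => f (Sum.inr i)).HasFiniteSupport) :
    ∑ᶠ i, f i = ∑ᶠ i, f (Sum.inl i) + ∑ᶠ i, f (Sum.inr i) := by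
  rw [← finsum_mem_univ, ← Set.range_inl_union_range_inr,
    finsum_mem_union' Set.isCompl_range_inl_range_inr.disjoint,
    finsum_mem_range Sum.inl_injective, finsum_mem_range Sum.inr_injective]
  · exact (hl.image Sum.inl).subset (by rintro _ ⟨⟨i, rfl⟩, hi⟩; exact ⟨i, hi, rfl⟩)
  · exact (hr.image Sum.inr).subset (by rintro _ ⟨⟨i, rfl⟩, hi⟩; exact ⟨i, hi, rfl⟩)

theorem exists_vertex_eq_zero {ι : Type} [TimeIndex ι] (v : ι → ℂ) (u : MvPolynomial ι ℂ) :
    ∃ B : ℤ, ∀ M, B ≤ M → vertex v M u = 0 := by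
  obtain ⟨B, hB⟩ := exists_ann_eq_zero v u
  exact ⟨B, fun M hM => vertex_eq_zero v hB hM⟩

theorem exists_vertex_xVec_yVec_eq_zero (u : MvPolynomial (ℕ+ ⊕ ℕ+) ℂ) :
    ∃ B : ℤ, ∀ s M, B ≤ M → vertex (xVec s) M u = 0 ∧ vertex (yVec s) M u = 0 := by
  obtain ⟨B₁, h₁⟩ := exists_vertex_eq_zero (xVec 1) u
  obtain ⟨B₂, h₂⟩ := exists_vertex_eq_zero (xVec (-1)) u
  obtain ⟨B₃, h₃⟩ := exists_vertex_eq_zero (yVec 1) u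
  obtain ⟨B₄, h₄⟩ := exists_vertex_eq_zero (yVec (-1)) u
  refine ⟨max (max B₁ B₂) (max B₃ B₄), fun s M hM => ?_⟩
  simp only [max_le_iff] at hM
  rcases Int.units_eq_one_or s with rfl | rfl
  · exact ⟨h₁ M hM.1.1, h₃ M hM.2.1⟩
  · exact ⟨h₂ M hM.1.2, h₄ M hM.2.2⟩

theorem hasPairing_xVec (s : ℤˣ) : HasPairing (xVec s) (xVec s) 1 := by
  intro k hk
  rw [sum_fiber_sum, ← hasPairing_constVec s k hk]
  simp [xVec]

theorem hasPairing_yVec (s : ℤˣ) : HasPairing (yVec s) (yVec s) 1 := by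
  intro k hk
  rw [sum_fiber_sum, ← hasPairing_constVec s k hk]
  simp [yVec]

theorem hasPairing_xVec_yVec (s t : ℤˣ) : HasPairing (xVec s) (yVec t) 0 := by
  intro k hk
  rw [sum_fiber_sum]
  simp [xVec, yVec]

/-- A charge and a polynomial. -/
abbrev State : Type := ℤ × MvPolynomial (ℕ+ ⊕ ℕ+) ℂ

/-- The vertex operators of charge `1` in the first and the second family of times. The latter also
raise the charge of the state. -/
def raise : ℤ ⊕ ℤ → State → State :=
  Sum.elim (fun m p => (p.1, vertex (xVec 1) (m - p.1) p.2))
    (fun m p => (p.1 + 1, vertex (yVec 1) (m + p.1) p.2))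

/-- The vertex operators of charge `-1`, with the modes opposite to those of `raise`. -/
def lower : ℤ ⊕ ℤ → State → State :=
  Sum.elim (fun m p => (p.1, vertex (xVec (-1)) (p.1 - m) p.2))
    (fun m p => (p.1 - 1, vertex (yVec (-1)) (1 - m - p.1) p.2))

/-- The operators `raise`, with signs and modes changed for the antisymmetry `raise_raise'`. -/
def raise' : ℤ ⊕ ℤ → State → State :=
  Sum.elim (fun m p => (p.1, vertex (xVec 1) (m - 1 - p.1) p.2))
    (fun m p => (p.1 + 1, -vertex (yVec 1) (m + p.1) p.2))

/-- The operators `lower`, with signs and modes changed for the antisymmetry `lower_lower'`. -/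
def lower' : ℤ ⊕ ℤ → State → State :=
  Sum.elim (fun m p => (p.1, vertex (xVec (-1)) (p.1 - 1 - m) p.2))
    (fun m p => (p.1 - 1, -vertex (yVec (-1)) (1 - m - p.1) p.2))

theorem raise_raise' (j k : ℤ ⊕ ℤ) (p : State) :
    raise k (raise' j p) = ((raise j (raise' k p)).1, -(raise j (raise' k p)).2) := by
  have hx := vertex_anticomm (hasPairing_xVec 1)
  have hy := vertex_anticomm (hasPairing_yVec 1)
  have hxy := vertex_comm (hasPairing_xVec_yVec 1 1)
  rcases j with j | j <;> rcases k with k | k <;>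
    simp only [raise, raise', Sum.elim_inl, Sum.elim_inr, map_neg, neg_neg, Prod.mk.injEq, true_and]
  · rw [show k - p.1 = k - 1 - p.1 + 1 by ring, hx]
    congr 3; ring
  · rw [hxy, sub_right_comm, sub_sub]
  · rw [hxy, sub_right_comm, sub_sub]
  · rw [← add_assoc, hy, neg_neg, add_assoc]

theorem lower_lower' (j k : ℤ ⊕ ℤ) (p : State) :
    lower k (lower' j p) = ((lower j (lower' k p)).1, -(lower j (lower' k p)).2) := by
  have hx := vertex_anticomm (hasPairing_xVec (-1))
  have hy := vertex_anticomm (hasPairing_yVec (-1))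
  have hxy := vertex_comm (hasPairing_xVec_yVec (-1) (-1))
  rcases j with j | j <;> rcases k with k | k <;>
    simp only [lower, lower', Sum.elim_inl, Sum.elim_inr, map_neg, neg_neg, Prod.mk.injEq, true_and]
  · rw [show p.1 - k = p.1 - 1 - k + 1 by ring, hx]
    congr 3; ring
  · rw [hxy]
  · rw [hxy]
  · rw [show 1 - k - (p.1 - 1) = 1 - k - p.1 + 1 by ring, hy, neg_neg,
      show 1 - j - (p.1 - 1) = 1 - j - p.1 + 1 by ring]

theorem raise_snd_eq_zero (k : ℤ ⊕ ℤ) {p : State} (h : p.2 = 0) : (raise k p).2 = 0 := by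
  rcases k with k | k <;> simp [raise, h]

theorem lower_snd_eq_zero (k : ℤ ⊕ ℤ) {p : State} (h : p.2 = 0) : (lower k p).2 = 0 := by
  rcases k with k | k <;> simp [lower, h]

theorem exists_finset_raise_lower (p q : State) : ∃ S : Finset (ℤ ⊕ ℤ), ∀ k ∉ S,
    ((raise k p).2 = 0 ∧ (raise' k p).2 = 0) ∨ ((lower k q).2 = 0 ∧ (lower' k q).2 = 0) := by
  obtain ⟨B, hB⟩ := exists_vertex_xVec_yVec_eq_zero p.2
  obtain ⟨C, hC⟩ := exists_vertex_xVec_yVec_eq_zero q.2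
  refine ⟨(Finset.Icc (q.1 - 1 - C) (B + p.1 + 1)).disjSum
    (Finset.Icc (1 - q.1 - C) (B - p.1)), fun k hk => ?_⟩
  rcases k with k | k
  · rw [Finset.inl_mem_disjSum, Finset.mem_Icc, not_and_or] at hk
    rcases hk with hk | hk
    · exact Or.inr ⟨(hC (-1) _ (by omega)).1, (hC (-1) _ (by omega)).1⟩
    · exact Or.inl ⟨(hB 1 _ (by omega)).1, (hB 1 _ (by omega)).1⟩
  · rw [Finset.inr_mem_disjSum, Finset.mem_Icc, not_and_or] at hk
    rcases hk with hk | hk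
    · have h := (hC (-1) (1 - k - q.1) (by omega)).2
      exact Or.inr ⟨h, neg_eq_zero.mpr h⟩
    · have h := (hB 1 (k + p.1) (by omega)).2
      exact Or.inl ⟨h, neg_eq_zero.mpr h⟩

variable (F G : ℤ → MvPolynomial (ℕ+ ⊕ ℕ+) ℂ →ₗ[ℂ] ℂ)

theorem finite_vertex_vertex (f g : MvPolynomial (ℕ+ ⊕ ℕ+) ℂ →ₗ[ℂ] ℂ) (v w : ℕ+ ⊕ ℕ+ → ℂ) (N : ℤ)
    (x y : MvPolynomial (ℕ+ ⊕ ℕ+) ℂ) :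
    (fun m => f (vertex v m x) * g (vertex w (N - m) y)).HasFiniteSupport := by
  obtain ⟨B, hB⟩ := exists_vertex_eq_zero v x
  obtain ⟨C, hC⟩ := exists_vertex_eq_zero w y
  refine finite_support_of_bounds (A := N - C) (B := B) (fun m hm => ?_) fun m hm => ?_
  · rw [hC _ (by omega), map_zero, mul_zero]
  · rw [hB _ hm, map_zero, zero_mul]

theorem finsum_int_sum {f : ℤ ⊕ ℤ → ℂ} {g h : ℤ → ℂ} (hg : g.HasFiniteSupport)
    (hh : h.HasFiniteSupport) (c d : ℤ) (hl : ∀ m, f (Sum.inl (m + c)) = g m)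
    (hr : ∀ m, f (Sum.inr (m + d)) = h m) : ∑ᶠ k, f k = ∑ᶠ m, g m + ∑ᶠ m, h m := by
  have hl' : (fun i => f (Sum.inl i)) = g ∘ Equiv.subRight c := by
    ext1 m
    rw [Function.comp_apply, Equiv.subRight_apply, ← hl, sub_add_cancel]
  have hr' : (fun i => f (Sum.inr i)) = h ∘ Equiv.subRight d := by
    ext1 m
    rw [Function.comp_apply, Equiv.subRight_apply, ← hr, sub_add_cancel]
  rw [finsum_sum_type, hl', hr']
  · exact congrArg₂ _ (finsum_comp_equiv _) (finsum_comp_equiv _)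
  · rw [hl']
    exact hg.preimage (Equiv.injective _).injOn
  · rw [hr']
    exact hh.preimage (Equiv.injective _).injOn

/-- The mToda equation in terms of the operators `raise` and `lower`. -/
theorem finsum_raise_lower (p q : State) :
    ∑ᶠ k, F (raise k p).1 (raise k p).2 * G (lower k q).1 (lower k q).2 =
      ∑ᶠ m, F p.1 (vertex (xVec 1) m p.2) * G q.1 (vertex (xVec (-1)) (q.1 - p.1 - m) q.2) +
      ∑ᶠ m, F (p.1 + 1) (vertex (yVec 1) m p.2) *
        G (q.1 - 1) (vertex (yVec (-1)) (p.1 - q.1 + 1 - m) q.2) := by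
  refine finsum_int_sum (finite_vertex_vertex _ _ _ _ _ _ _) (finite_vertex_vertex _ _ _ _ _ _ _)
    p.1 (-p.1) (fun m => ?_) fun m => ?_ <;>
  · simp only [raise, lower, Sum.elim_inl, Sum.elim_inr]
    congr 4 <;> ring

theorem finsum_raise_lower' (p q : State) :
    ∑ᶠ k, F (raise k p).1 (raise k p).2 * F (lower' k q).1 (lower' k q).2 =
      ∑ᶠ m, F p.1 (vertex (xVec 1) m p.2) * F q.1 (vertex (xVec (-1)) (q.1 - 1 - p.1 - m) q.2) +
      ∑ᶠ m, -(F (p.1 + 1) (vertex (yVec 1) m p.2) *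
        F (q.1 - 1) (vertex (yVec (-1)) (p.1 - (q.1 - 1) - m) q.2)) := by
  refine finsum_int_sum (finite_vertex_vertex _ _ _ _ _ _ _)
    (finite_vertex_vertex _ _ _ _ _ _ _).neg p.1 (-p.1) (fun m => ?_) fun m => ?_
  · simp only [raise, lower', Sum.elim_inl]
    congr 4 <;> ring
  · simp only [raise, lower', Sum.elim_inr, map_neg, mul_neg]
    congr 5 <;> ring

theorem finsum_lower_raise' (p q : State) :
    ∑ᶠ k, F (lower k q).1 (lower k q).2 * F (raise' k p).1 (raise' k p).2 =
      ∑ᶠ m, F p.1 (vertex (xVec 1) m p.2) * F q.1 (vertex (xVec (-1)) (q.1 - 1 - p.1 - m) q.2) +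
      ∑ᶠ m, -(F (p.1 + 1) (vertex (yVec 1) m p.2) *
        F (q.1 - 1) (vertex (yVec (-1)) (p.1 - (q.1 - 1) - m) q.2)) := by
  refine finsum_int_sum (finite_vertex_vertex _ _ _ _ _ _ _)
    (finite_vertex_vertex _ _ _ _ _ _ _).neg (p.1 + 1) (-p.1) (fun m => ?_) fun m => ?_
  · simp only [raise', lower, Sum.elim_inl]
    rw [mul_comm]
    congr 4 <;> ring
  · simp only [raise', lower, Sum.elim_inr, map_neg, mul_neg]
    rw [mul_comm]
    congr 5 <;> ring

/-- Both members of a pair of functionals with the mToda property have the Toda property. -/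
theorem toda_functional
    (h : IsMTodaPair F G)
    (hF : F 0 1 ≠ 0) (hG : G 0 1 ≠ 0) {H : ℤ → MvPolynomial (ℕ+ ⊕ ℕ+) ℂ →ₗ[ℂ] ℂ}
    (hH : H = F ∨ H = G) (n n' : ℤ) (u w : MvPolynomial (ℕ+ ⊕ ℕ+) ℂ) :
    ∑ᶠ m, H n (vertex (xVec 1) m u) * H (n' + 1) (vertex (xVec (-1)) (n' - n - m) w) =
      ∑ᶠ m, H (n + 1) (vertex (yVec 1) m u) * H n' (vertex (yVec (-1)) (n - n' - m) w) := by
  have key : ∑ᶠ m, H n (vertex (xVec 1) m u) * H (n' + 1)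
        (vertex (xVec (-1)) (n' + 1 - 1 - n - m) w) +
      ∑ᶠ m, -(H (n + 1) (vertex (yVec 1) m u) *
        H (n' + 1 - 1) (vertex (yVec (-1)) (n - (n' + 1 - 1) - m) w)) = 0 := by
    rcases hH with rfl | rfl
    · rw [← finsum_raise_lower' H (n, u) (n' + 1, w)]
      refine finsum_eq_zero_of_antisymm (φ := fun p => H p.1 p.2) (β := fun p => H p.1 p.2)
        (ψ := fun p => G p.1 p.2) (α := fun p => G p.1 p.2) (a := raise) (a' := lower)
        (b := lower') (fun p q => ?_) (fun j k p => ?_) (fun p q => ?_) (u₀ := (0, 1)) hG _ _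
      · rw [finsum_raise_lower, h]
      · simp only [lower_lower' j k, map_neg]
      · obtain ⟨S, hS⟩ := exists_finset_raise_lower p q
        refine ⟨S, fun k hk => (hS k hk).imp (fun h => ?_) fun h => ⟨?_, fun j => ?_⟩⟩
        · simp only [h.1, map_zero]
        · simp only [h.2, map_zero]
        · simp only [lower_snd_eq_zero j h.2, map_zero]
    · rw [← finsum_lower_raise' H (n, u) (n' + 1, w)]
      refine finsum_eq_zero_of_antisymm (φ := fun p => H p.1 p.2) (β := fun p => H p.1 p.2)
        (ψ := fun p => F p.1 p.2) (α := fun p => F p.1 p.2) (a := lower) (a' := raise)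
        (b := raise') (fun q p => ?_) (fun j k p => ?_) (fun q p => ?_) (u₀ := (0, 1)) hF _ _
      · rw [mul_comm (F _ _), ← h, ← finsum_raise_lower]
        exact finsum_congr fun k => mul_comm _ _
      · simp only [raise_raise' j k, map_neg]
      · obtain ⟨S, hS⟩ := exists_finset_raise_lower p q
        refine ⟨S, fun k hk => (hS k hk).symm.imp (fun h => ?_) fun h => ⟨?_, fun j => ?_⟩⟩
        · simp only [h.1, map_zero]
        · simp only [h.2, map_zero]
        · simp only [raise_snd_eq_zero j h.2, map_zero]
  rwa [finsum_neg_distrib, add_neg_eq_zero, add_sub_cancel_right] at key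

end Toda

/-! ### The values at `y = -x` -/

section Diagonal

/-- The substitution of polynomials dual to that of the times `x, c x` for `x, y` in power series:
it replaces the variable `p_k` by `p_k + c q_k`. -/
def coDiag (c : ℂ) : MvPolynomial ℕ+ ℂ →ₐ[ℂ] MvPolynomial (ℕ+ ⊕ ℕ+) ℂ :=
  MvPolynomial.aeval fun k => MvPolynomial.X (Sum.inl k) + c • MvPolynomial.X (Sum.inr k)

theorem coDiag_X (c : ℂ) (k : ℕ+) : coDiag c (MvPolynomial.X k) =
    MvPolynomial.X (Sum.inl k) + c • MvPolynomial.X (Sum.inr k) := by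
  rw [coDiag, MvPolynomial.aeval_X]

theorem constantCoeff_coDiag (c : ℂ) (u : MvPolynomial ℕ+ ℂ) :
    MvPolynomial.constantCoeff (coDiag c u) = MvPolynomial.constantCoeff u := by
  induction u using MvPolynomial.induction_on with
  | C a => rw [← MvPolynomial.algebraMap_eq, AlgHom.commutes]; simp
  | add p q hp hq => simp only [map_add, hp, hq]
  | mul_X p k hp => rw [map_mul, map_mul, map_mul, coDiag_X]; simp

theorem pderiv_inl_coDiag (c : ℂ) (k : ℕ+) (u : MvPolynomial ℕ+ ℂ) :
    MvPolynomial.pderiv (Sum.inl k) (coDiag c u) = coDiag c (MvPolynomial.pderiv k u) := by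
  classical
  induction u using MvPolynomial.induction_on with
  | C a =>
    rw [MvPolynomial.pderiv_C, map_zero, ← MvPolynomial.algebraMap_eq, AlgHom.commutes,
      Derivation.map_algebraMap]
  | add p q hp hq => simp only [map_add, hp, hq]
  | mul_X p l hp =>
    rw [map_mul, Derivation.leibniz, Derivation.leibniz, hp, map_add, smul_eq_mul, smul_eq_mul,
      smul_eq_mul, smul_eq_mul, map_mul, map_mul, coDiag_X, map_add, Derivation.map_smul,
      MvPolynomial.pderiv_X, MvPolynomial.pderiv_X, MvPolynomial.pderiv_X]
    by_cases h : l = k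
    · subst h
      simp
    · simp [h]

theorem pderiv_inr_coDiag (c : ℂ) (k : ℕ+) (u : MvPolynomial ℕ+ ℂ) :
    MvPolynomial.pderiv (Sum.inr k) (coDiag c u) = c • coDiag c (MvPolynomial.pderiv k u) := by
  classical
  induction u using MvPolynomial.induction_on with
  | C a =>
    rw [MvPolynomial.pderiv_C, map_zero, smul_zero, ← MvPolynomial.algebraMap_eq, AlgHom.commutes,
      Derivation.map_algebraMap]
  | add p q hp hq => simp only [map_add, hp, hq, smul_add]
  | mul_X p l hp =>
    rw [map_mul, Derivation.leibniz, Derivation.leibniz, hp, map_add, smul_eq_mul, smul_eq_mul,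
      smul_eq_mul, smul_eq_mul, map_mul, map_mul, coDiag_X, map_add, Derivation.map_smul,
      MvPolynomial.pderiv_X, MvPolynomial.pderiv_X, MvPolynomial.pderiv_X]
    by_cases h : l = k
    · subst h
      simp [smul_add]
    · simp [h]

theorem isTest_coDiag (c : ℂ) : IsTest (Sum.elim X (c • X) : ℕ+ ⊕ ℕ+ → MvPowerSeries ℕ+ ℂ)
    fun e => coDiag c (MvPolynomial.monomial e (mfact e)⁻¹) := by
  classical
  have hX : IsTest (X : ℕ+ → MvPowerSeries ℕ+ ℂ) _ := isTest_X
  refine isTest_of_pderiv (fun e => ?_) ?_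
  · rw [constantCoeff_coDiag, coeff_one, MvPolynomial.constantCoeff_monomial]
    by_cases h : e = 0
    · rw [if_pos h, if_pos h, h, mfact_zero, inv_one]
    · rw [if_neg h, if_neg h]
  · rintro (k | k) e
    · rw [pderiv_inl_coDiag, hX.pderiv k e, map_sum]
      exact Finset.sum_congr rfl fun p _ => map_smul _ _ _
    · rw [pderiv_inr_coDiag, hX.pderiv k e, map_sum, Finset.smul_sum]
      refine Finset.sum_congr rfl fun p _ => ?_
      rw [map_smul, smul_smul, Sum.elim_inr, Pi.smul_apply, coeff_smul]

theorem hasSubst_X : HasSubst (X : ℕ+ → MvPowerSeries ℕ+ ℂ) := HasSubst.X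

theorem hasSubst_smul {ι π : Type} (c : ℂ) {x : ι → MvPowerSeries π ℂ} (hx : HasSubst x) :
    HasSubst (c • x) := by
  convert hx.smul (MvPowerSeries.C c) using 1
  ext1 k
  rw [Pi.smul_apply, Pi.smul_apply, smul_eq_C_mul, smul_eq_mul]

theorem coeff_evalXY_X_neg_X (f : MvPowerSeries (ℕ+ ⊕ ℕ+) ℂ) (e : ℕ+ →₀ ℕ) :
    coeff e (evalXY f X (-X)) =
      dual f (coDiag (-1) (MvPolynomial.monomial e (mfact e)⁻¹)) := by
  rw [evalXY, ← neg_one_smul ℂ (X : ℕ+ → MvPowerSeries ℕ+ ℂ)]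
  exact (isTest_coDiag (-1)).coeff_subst
    (hasSubst_sumElim hasSubst_X (hasSubst_smul (-1) hasSubst_X)) f e

theorem coeff_mul_eq_dual (f g : MvPowerSeries ℕ+ ℂ) (e : ℕ+ →₀ ℕ) : coeff e (f * g) =
    dual (separate f g) (coDiag 1 (MvPolynomial.monomial e (mfact e)⁻¹)) := by
  have h := (isTest_coDiag 1).coeff_subst
    (hasSubst_sumElim hasSubst_X (hasSubst_smul 1 hasSubst_X)) (separate f g) e
  rwa [one_smul, subst_separate f g hasSubst_X hasSubst_X, subst_self] at h

/-- The difference of the currents `mixed` for the two families of times is the total current. -/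
theorem act_coDiag_mul_X (κ : ℤˣ) (p : MvPolynomial ℕ+ ℂ) (k : ℕ+) (x : Fock2) :
    fockPair.act κ (coDiag (-1) (p * MvPolynomial.X k)) x =
      fockPair.act κ (coDiag (-1) p) (fockPair.total k x) := by
  rw [map_mul, map_mul, Module.End.mul_apply, coDiag_X, map_add, map_smul, FermionPair.act_X,
    FermionPair.act_X]
  congr 1
  simp only [FermionPair.mixed, Sum.elim_inl, Sum.elim_inr, LinearMap.add_apply,
    LinearMap.smul_apply, LinearMap.neg_apply]
  module

theorem square_act_coDiag (τ : ℤ → MvPowerSeries ℕ+ ℂ) (κ : ℤˣ) (a b : ℤ)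
    (p u w : MvPolynomial ℕ+ ℂ) :
    square (tauFock τ)
        (fockPair.act κ (coDiag (-1) p) (tm (Finsupp.single a u) (Finsupp.single b w))) =
      dual (separate (τ a) (τ b)) (coDiag 1 p *
        (MvPolynomial.rename Sum.inl u * MvPolynomial.rename Sum.inr w)) := by
  induction p using MvPolynomial.induction_on generalizing u w with
  | C c =>
    rw [← MvPolynomial.algebraMap_eq, AlgHom.commutes, AlgHom.commutes, AlgHom.commutes,
      Module.algebraMap_end_apply, ← Algebra.smul_def, map_smul, map_smul, square_tm,
      tauFock_single, tauFock_single, dual_separate]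
  | add p q hp hq => simp only [map_add, LinearMap.add_apply, hp, hq, add_mul]
  | mul_X p k hp =>
    rw [act_coDiag_mul_X, total_tm, boson_single, boson_single, map_add, map_add, hp, hp, ← map_add,
      map_mul (coDiag 1), coDiag_X, map_mul, map_mul, MvPolynomial.rename_X, MvPolynomial.rename_X]
    congr 1
    rw [one_smul]
    ring

theorem square_act_coDiag_vac (τ : ℤ → MvPowerSeries ℕ+ ℂ) (κ : ℤˣ) (a b : ℤ) (e : ℕ+ →₀ ℕ) :
    square (tauFock τ) (fockPair.act κ (coDiag (-1) (MvPolynomial.monomial e (mfact e)⁻¹))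
      (tm (vac a) (vac b))) = coeff e (τ a * τ b) := by
  rw [coeff_mul_eq_dual, vac, vac, square_act_coDiag, map_one, map_one, mul_one, mul_one]

theorem evalXY_evenFun (τ : ℤ → MvPowerSeries ℕ+ ℂ) (n : ℤ) :
    evalXY (ofDual (evenFun (tauFock τ) n)) X (-X) = τ n ^ 2 := by
  ext e
  rw [coeff_evalXY_X_neg_X, dual_ofDual, ← square_act_tm_vac, square_act_coDiag_vac, sq]

theorem evalXY_oddFun (τ : ℤ → MvPowerSeries ℕ+ ℂ) (n : ℤ) :
    evalXY (ofDual (oddFun (tauFock τ) n)) X (-X) = τ n * τ (n - 1) := by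
  ext e
  have h := square_act_vac2 (tauFock τ) n
    (coDiag (-1) (MvPolynomial.monomial e (mfact e)⁻¹))
  rw [vac2, map_add, map_add, square_act_coDiag_vac, square_act_coDiag_vac, mul_comm (τ (n - 1))] at h
  rw [coeff_evalXY_X_neg_X, dual_ofDual]
  linear_combination (-2⁻¹ : ℂ) * h

theorem evenFun_one (τ : ℤ → MvPowerSeries ℕ+ ℂ) (n : ℤ) :
    evenFun (tauFock τ) n 1 = constantCoeff (τ n) ^ 2 := by
  have h : evenFun (tauFock τ) n 1 = square (tauFock τ) (tm (vac n) (vac n)) := by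
    rw [← square_act_tm_vac, map_one, Module.End.one_apply]
  rw [h, square_tm, vac, tauFock_single, dual_one, sq]

theorem oddFun_one (τ : ℤ → MvPowerSeries ℕ+ ℂ) (n : ℤ) :
    oddFun (tauFock τ) n 1 = constantCoeff (τ n) * constantCoeff (τ (n - 1)) := by
  have h := square_act_vac2 (tauFock τ) n 1
  rw [map_one, Module.End.one_apply, vac2, map_add, square_tm, square_tm, vac, vac, tauFock_single,
    tauFock_single, dual_one, dual_one] at h
  linear_combination (-2⁻¹ : ℂ) * h

end Diagonal

/-! ### The two Toda tau functions -/

section Main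

/-- A case of the mToda equation: the coefficient of `y₁` at `x' = x`, `y' = y` and `n' = n`. -/
theorem mToda_coeff_y {F G : ℤ → MvPolynomial (ℕ+ ⊕ ℕ+) ℂ →ₗ[ℂ] ℂ}
    (h : IsMTodaPair F G) (n : ℤ) :
    F n (MvPolynomial.X (Sum.inr 1)) * G n 1 + F (n + 1) 1 * G (n - 1) 1 =
      G n (MvPolynomial.X (Sum.inr 1)) * F n 1 := by
  have hx : ∀ m, vertex (xVec 1) m (MvPolynomial.X (Sum.inr 1)) =
      MvPolynomial.X (Sum.inr 1) * creCoeff (xVec 1) (-m) := by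
    intro m
    rw [← mul_one (MvPolynomial.X (Sum.inr 1)), vertex_X_mul, vertex_one, mul_one]
    simp [xVec]
  have hy : ∀ m, vertex (yVec 1) m (MvPolynomial.X (Sum.inr 1)) =
      MvPolynomial.X (Sum.inr 1) * creCoeff (yVec 1) (-m) + creCoeff (yVec 1) (1 - m) := by
    intro m
    rw [← mul_one (MvPolynomial.X (Sum.inr 1)), vertex_X_mul, vertex_one, vertex_one, mul_one]
    simp [yVec, constVec]
  rw [← h n n, finsum_eq_single _ 0, finsum_eq_single _ 1]
  · simp only [hx, hy, vertex_one, sub_self, neg_zero, creCoeff_zero, mul_one, zero_add,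
      creCoeff_of_neg (yVec 1) (show (-1 : ℤ) < 0 by norm_num), mul_zero]
  · intro m hm
    rcases lt_or_gt_of_ne hm with hm | hm
    · rw [vertex_one, creCoeff_of_neg (yVec (-1)) (by omega), map_zero, mul_zero]
    · rw [hy, creCoeff_of_neg _ (by omega), creCoeff_of_neg _ (by omega), mul_zero, zero_add,
        map_zero, zero_mul]
  · intro m hm
    rcases lt_or_gt_of_ne hm with hm | hm
    · rw [vertex_one, creCoeff_of_neg (xVec (-1)) (by omega), map_zero, mul_zero]
    · rw [hx, creCoeff_of_neg _ (by omega), mul_zero, map_zero, zero_mul]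

theorem ofDual_smul {ι : Type} (c : ℂ) (φ : MvPolynomial ι ℂ →ₗ[ℂ] ℂ) :
    ofDual (c • φ) = c • ofDual φ := by
  ext d
  rw [coeff_smul]
  exact mul_left_comm _ _ _

theorem constantCoeff_ofDual {ι : Type} (φ : MvPolynomial ι ℂ →ₗ[ℂ] ℂ) :
    constantCoeff (ofDual φ) = φ 1 := by
  rw [← dual_one, dual_ofDual]

theorem hasSubst_fstTime : HasSubst fstTime :=
  HasSubst.X_comp (Function.Embedding.inl : ℕ+ ↪ ℕ+ ⊕ ℕ+)

theorem hasSubst_sndTime : HasSubst sndTime :=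
  HasSubst.X_comp (Function.Embedding.inr : ℕ+ ↪ ℕ+ ⊕ ℕ+)

theorem hasSubst_neg {ι π : Type} {x : ι → MvPowerSeries π ℂ} (hx : HasSubst x) :
    HasSubst (-x) := by
  rw [← neg_one_smul ℂ x]
  exact hasSubst_smul _ hx

theorem hasSubst_varX : HasSubst varX :=
  HasSubst.X_comp ((Function.Embedding.inl : ℕ+ ↪ ℕ+ ⊕ ℕ+).trans Function.Embedding.inl)

theorem hasSubst_varY : HasSubst varY :=
  HasSubst.X_comp ((Function.Embedding.inr : ℕ+ ↪ ℕ+ ⊕ ℕ+).trans Function.Embedding.inl)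

theorem hasSubst_varX' : HasSubst varX' :=
  HasSubst.X_comp ((Function.Embedding.inl : ℕ+ ↪ ℕ+ ⊕ ℕ+).trans Function.Embedding.inr)

theorem hasSubst_varY' : HasSubst varY' :=
  HasSubst.X_comp ((Function.Embedding.inr : ℕ+ ↪ ℕ+ ⊕ ℕ+).trans Function.Embedding.inr)

theorem isTodaTau_ofDual {F G H : ℤ → MvPolynomial (ℕ+ ⊕ ℕ+) ℂ →ₗ[ℂ] ℂ}
    (h : IsMTodaPair F G)
    (hF : ∀ n, F n 1 ≠ 0) (hG : ∀ n, G n 1 ≠ 0) (hH : H = F ∨ H = G) :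
    IsTodaTau fun n => ofDual (H n) where
  ne_zero n := by
    rw [constantCoeff_ofDual]
    rcases hH with rfl | rfl
    · exact hF n
    · exact hG n
  bilinear n n' := by
    refine todaEq_of_dual (fun u w => ?_) hasSubst_varX hasSubst_varY hasSubst_varX' hasSubst_varY'
    simp only [dual_ofDual]
    exact toda_functional F G h (hF 0) (hG 0) hH n n' u w

theorem mTodaEq_ofDual {F G : ℤ → MvPolynomial (ℕ+ ⊕ ℕ+) ℂ →ₗ[ℂ] ℂ} (h : IsMTodaPair F G) {π : Type}
    {x y x' y' : ℕ+ → MvPowerSeries π ℂ} (hx : HasSubst x) (hy : HasSubst y) (hx' : HasSubst x')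
    (hy' : HasSubst y') (n n' : ℤ) :
    MTodaEq (fun n => ofDual (F n)) (fun n => ofDual (G n)) x y x' y' n n' := by
  refine mTodaEq_of_dual (fun u w => ?_) hx hy hx' hy'
  simp only [dual_ofDual]
  exact h n n' u w

/-- If the two families were proportional, the two terms with `y₁` in `mToda_coeff_y` would cancel. -/
theorem ofDual_ne_smul {F G : ℤ → MvPolynomial (ℕ+ ⊕ ℕ+) ℂ →ₗ[ℂ] ℂ}
    (h : IsMTodaPair F G)
    (hF : ∀ n, F n 1 ≠ 0) (hG : ∀ n, G n 1 ≠ 0) (c : ℂ) :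
    (fun n => ofDual (F n)) ≠ c • fun n => ofDual (G n) := by
  intro hc
  have hFG : ∀ n, F n = c • G n := by
    intro n
    rw [← dual_ofDual (F n), congrFun hc n, Pi.smul_apply, ← ofDual_smul, dual_ofDual]
  have h0 := mToda_coeff_y h 0
  have h1 : F (0 + 1) 1 * G (0 - 1) 1 = 0 := by
    rw [hFG 0] at h0
    simp only [LinearMap.smul_apply, smul_eq_mul] at h0
    linear_combination h0
  exact mul_ne_zero (hF _) (hG _) h1

end Main

end LargeBKP

end

open LargeBKP in
theorem mainTheorem9 (τ : ℤ → MvPowerSeries ℕ+ ℂ) (hτ : IsLargeBKPTau τ) :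
    ∃ τT τT' : ℤ → MvPowerSeries (ℕ+ ⊕ ℕ+) ℂ,
      IsTodaTau τT ∧ IsTodaTau τT' ∧
      (∀ n, evalXY (τT n) MvPowerSeries.X (-MvPowerSeries.X) = τ n * τ (n - 1)) ∧
      (∀ n, evalXY (τT' n) MvPowerSeries.X (-MvPowerSeries.X) = τ n ^ 2) ∧
      (∀ c : ℂ, τT ≠ c • τT') ∧
      SatisfiesMToda τT τT' ∧
      (∀ n n' : ℤ, MTodaEq τT τT' fstTime (-fstTime) sndTime (-sndTime) n n') := by
  have h := isMTodaPair_oddFun_evenFun hτ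
  have hF : ∀ n, oddFun (tauFock τ) n 1 ≠ 0 := fun n => by
    rw [oddFun_one]
    exact mul_ne_zero (hτ.ne_zero _) (hτ.ne_zero _)
  have hG : ∀ n, evenFun (tauFock τ) n 1 ≠ 0 := fun n => by
    rw [evenFun_one]
    exact pow_ne_zero _ (hτ.ne_zero _)
  exact ⟨_, _, isTodaTau_ofDual h hF hG (Or.inl rfl), isTodaTau_ofDual h hF hG (Or.inr rfl),
    evalXY_oddFun τ, evalXY_evenFun τ, ofDual_ne_smul h hF hG,
    mTodaEq_ofDual h hasSubst_varX hasSubst_varY hasSubst_varX' hasSubst_varY',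
    mTodaEq_ofDual h hasSubst_fstTime (hasSubst_neg hasSubst_fstTime) hasSubst_sndTime
      (hasSubst_neg hasSubst_sndTime)⟩
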